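/- Let $N\in\{2,3\}$, let $\mathbb T^N=\mathbb R^N/\mathbb Z^N$ be the flat torus, $T>0$, $\gamma>1$, $\mu>0$ and $2\mu+N\lambda\ge 0$. Consider the compressible Navier–Stokes system $$\rho_t+\operatorname{div}(\rho u)=0,\qquad (\rho u)_t+\operatorname{div}(\rho u\otimes u)+\nabla\rho^\gamma-2\mu\Delta u-\lambda\nabla\operatorname{div}u=0\quad\text{in }(0,T)\times\mathbb T^N,$$ with $\rho|_{t=0}=\rho_0$ and $\rho u|_{t=0}=\rho_0u_0$, where $\rho_0\ge0$, $\rho_0\in L^\gamma(\mathbb T^N)$, $\rho_0|u_0|^2\in L^1(\mathbb T^N)$ and $u_0=0$ on $\{\rho_0=0\}$. Let $(\rho,u)$ be a renormalized finite energy weak solution, that is: * $\rho\ge0$, $\rho\in L^\infty(0,T;L^\gamma)$, $\sqrt\rho\,u\in L^\infty(0,T;L^2)$, $u\in L^2(0,T;H^1)$; * $\rho\in C([0,T];L^\gamma_{\rm weak})$ and $\rho u\in C([0,T];L^{2\gamma/(\gamma+1)}_{\rm weak})$, and the initial conditions hold for these weakly continuous representatives; * both equations hold in $\mathcal D'((0,T)\times\mathbb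 T^N)$, and so does $b(\rho)_t+\operatorname{div}(b(\rho)u)+(b'(\rho)\rho-b(\rho))\operatorname{div}u=0$ for every $b\in C^1(\mathbb R)$ whose derivative vanishes outside a bounded set; * for almost every $t\in(0,T)$, $$\int_{\mathbb T^N}\Big(\tfrac12\rho|u|^2+\tfrac{\rho^\gamma}{\gamma-1}\Big)(t)\,dx+2\mu\int_0^t\!\!\int_{\mathbb T^N}|\nabla u|^2\,dx\,ds+\lambda\int_0^t\!\!\int_{\mathbb T^N}|\operatorname{div}u|^2\,dx\,ds\le\int_{\mathbb T^N}\Big(\tfrac12\rho_0|u_0|^2+\tfrac{\rho_0^\gamma}{\gamma-1}\Big)dx .$$ Suppose moreover that for some constant $\bar\rho<\infty$ $$0\le\rho(t,x)\le\bar\rho\ \text{ for a.e. }(t,x)\in(0,T)\times\mathbb T^N,\qquad \nabla\sqrt\rho\in L^\infty(0,T;L^2(\mathbb T^N))$$ (vacuum is allowed), and that for some exponents $p,q,k\in[1,\infty]$ $$u\in L^p(0,T;L^q(\mathbb T^N)),\quad \tfrac1p+\tfrac1q\le\tfrac5{12},\quad q\ge6,\qquad u_0\in L^k(\mathbb T^N),\quad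 \tfrac1k+\tfrac1q\le\tfrac12 .$$ Then for every $t\in[0,T]$ the functions $\rho(t)|u(t)|^2$ and $\rho(t)^\gamma$ are integrable and $$\int_{\mathbb T^N}\Big(\tfrac12\rho|u|^2+\tfrac{\rho^\gamma}{\gamma-1}\Big)(t)\,dx+2\mu\int_0^t\!\!\int_{\mathbb T^N}|\nabla u|^2\,dx\,ds+\lambda\int_0^t\!\!\int_{\mathbb T^N}|\operatorname{div}u|^2\,dx\,ds=\int_{\mathbb T^N}\Big(\tfrac12\rho_0|u_0|^2+\tfrac{\rho_0^\gamma}{\gamma-1}\Big)dx .$$ -/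

import Mathlib

open MeasureTheory Set
open scoped ENNReal ContDiff

noncomputable section

namespace CNS

/-- The flat torus `𝕋ᴺ = (ℝ/ℤ)ᴺ`; `volume` is its Haar probability measure. -/
abbrev Torus (N : ℕ) : Type := UnitAddTorus (Fin N)

/-- Vectors of `ℝᴺ` with the Euclidean norm. -/
abbrev Vec (N : ℕ) : Type := EuclideanSpace ℝ (Fin N)

/-- `N × N` matrices with the Frobenius norm; for a velocity gradient `A`,
the entry `A (i, j)` is `∂ⱼ uᵢ`. -/
abbrev Mat (N : ℕ) : Type := EuclideanSpace ℝ (Fin N × Fin N)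

/-- The canonical projection `ℝᴺ → 𝕋ᴺ`. -/
def toTorus {N : ℕ} (y : Fin N → ℝ) : Torus N := fun i => (y i : UnitAddCircle)

/-- The partial derivative `∂ⱼ φ` of a function on the torus. -/
def pderiv {N : ℕ} (j : Fin N) (φ : Torus N → ℝ) (x : Torus N) : ℝ :=
  deriv (fun s : ℝ => φ (x + Pi.single j (s : UnitAddCircle))) 0

/-- The trace of a velocity gradient, i.e. the divergence of the velocity. -/
def tr {N : ℕ} (A : Mat N) : ℝ := ∑ i, A (i, i)

/-- Smooth functions on the torus. -/
def IsSmooth {N : ℕ} (φ : Torus N → ℝ) : Prop :=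
  ContDiff ℝ ∞ (fun y : Fin N → ℝ => φ (toTorus y))

/-- Test functions on `(0,T) × 𝕋ᴺ`: smooth, with compact support. -/
structure IsTest {N : ℕ} (T : ℝ) (φ : ℝ → Torus N → ℝ) : Prop where
  smooth : ContDiff ℝ ∞ (fun z : ℝ × (Fin N → ℝ) => φ z.1 (toTorus z.2))
  support : ∃ a b : ℝ, 0 < a ∧ b < T ∧ ∀ t x, t ∉ Icc a b → φ t x = 0

/-- The function `g` is the weak partial derivative `∂ⱼ f` on the torus. -/
def HasWeakPartial {N : ℕ} (j : Fin N) (f g : Torus N → ℝ) : Prop :=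
  Integrable f ∧ Integrable g ∧
    ∀ φ : Torus N → ℝ, IsSmooth φ → ∫ x, f x * pderiv j φ x = -∫ x, g x * φ x

/-- The Bochner class `f ∈ L^p(0,T; L^q(𝕋ᴺ))`. -/
def MemLpLq {N : ℕ} {E : Type*} [NormedAddCommGroup E] (T : ℝ) (f : ℝ → Torus N → E)
    (p q : ℝ≥0∞) : Prop :=
  AEStronglyMeasurable (Function.uncurry f) ((volume.restrict (Ioo 0 T)).prod volume) ∧
    eLpNorm (fun t => eLpNorm (f t) q volume) p (volume.restrict (Ioo 0 T)) < ⊤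

/-- `f ∈ C([0,T]; L^r_weak(𝕋ᴺ))`. -/
def WeaklyContinuous {N : ℕ} {E : Type*} [NormedAddCommGroup E] [InnerProductSpace ℝ E]
    (T : ℝ) (f : ℝ → Torus N → E) (r : ℝ≥0∞) : Prop :=
  (∀ t ∈ Icc 0 T, MemLp (f t) r volume) ∧
    ∀ s : ℝ≥0∞, ENNReal.HolderConjugate r s → ∀ g : Torus N → E, MemLp g s volume →
      ContinuousOn (fun t => ∫ x, inner ℝ (f t x) (g x)) (Icc 0 T)

/-- The energy `∫ ½ ρ|u|² + ρ^γ/(γ-1)` of a density and a velocity on the torus. -/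
def energy {N : ℕ} (γ : ℝ) (ρ : Torus N → ℝ) (u : Torus N → Vec N) : ℝ :=
  ∫ x, (1 / 2 * ρ x * ‖u x‖ ^ 2 + ρ x ^ γ / (γ - 1))

/-- The energy dissipated up to time `t`:
`2μ ∫₀ᵗ∫ |∇u|² + λ ∫₀ᵗ∫ |div u|²`. -/
def dissipation {N : ℕ} (μ lam : ℝ) (Du : ℝ → Torus N → Mat N) (t : ℝ) : ℝ :=
  2 * μ * (∫ s in Ioo 0 t, ∫ x, ‖Du s x‖ ^ 2) + lam * ∫ s in Ioo 0 t, ∫ x, tr (Du s x) ^ 2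

/-- Initial data of finite energy, with the convention that the velocity vanishes on the
vacuum set. -/
structure IsInitialData {N : ℕ} (γ : ℝ) (ρ₀ : Torus N → ℝ) (u₀ : Torus N → Vec N) : Prop where
  nonneg : ∀ᵐ x, 0 ≤ ρ₀ x
  density : MemLp ρ₀ (ENNReal.ofReal γ) volume
  velocity : AEStronglyMeasurable u₀ volume
  vacuum : ∀ᵐ x, ρ₀ x = 0 → u₀ x = 0
  kinetic : Integrable (fun x => ρ₀ x * ‖u₀ x‖ ^ 2)

/-- Renormalized finite energy weak solutions `(ρ, u)` on `[0,T] × 𝕋ᴺ` of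
`ρ_t + div(ρu) = 0`, `(ρu)_t + div(ρu ⊗ u) + ∇ρ^γ - 2μΔu - λ∇div u = 0`,
with data `ρ = ρ₀`, `ρu = ρ₀u₀` at time `0`; `Du` is the weak spatial gradient of `u`.
The functions `ρ` and `ρu` are the weakly continuous representatives. -/
structure IsWeakSolution {N : ℕ} (T γ μ lam : ℝ) (ρ₀ : Torus N → ℝ) (u₀ : Torus N → Vec N)
    (ρ : ℝ → Torus N → ℝ) (u : ℝ → Torus N → Vec N) (Du : ℝ → Torus N → Mat N) : Prop where
  /-- admissible initial data -/
  data : IsInitialData γ ρ₀ u₀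
  /-- `ρ ≥ 0` -/
  nonneg : ∀ᵐ z ∂((volume.restrict (Ioo 0 T)).prod (volume : Measure (Torus N))), 0 ≤ ρ z.1 z.2
  /-- `ρ ∈ L^∞(0,T; L^γ)` -/
  density : MemLpLq T ρ ⊤ (ENNReal.ofReal γ)
  /-- `√ρ u ∈ L^∞(0,T; L²)` -/
  momentum_bound : MemLpLq T (fun t x => Real.sqrt (ρ t x) • u t x) ⊤ 2
  /-- `u ∈ L²(0,T; H¹)` -/
  velocity : MemLpLq T u 2 2
  velocity_grad : MemLpLq T Du 2 2
  weak_grad : ∀ᵐ t ∂(volume.restrict (Ioo 0 T)), ∀ i j : Fin N,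
    HasWeakPartial j (fun x => u t x i) (fun x => Du t x (i, j))
  /-- `ρ ∈ C([0,T]; L^γ_weak)` -/
  density_cont : WeaklyContinuous T ρ (ENNReal.ofReal γ)
  /-- `ρu ∈ C([0,T]; L^{2γ/(γ+1)}_weak)` -/
  momentum_cont : WeaklyContinuous T (fun t x => ρ t x • u t x)
    (ENNReal.ofReal (2 * γ / (γ + 1)))
  /-- the initial conditions -/
  density_init : ∀ᵐ x, ρ 0 x = ρ₀ x
  momentum_init : ∀ᵐ x, ρ 0 x • u 0 x = ρ₀ x • u₀ x
  /-- the continuity equation in `𝓓'((0,T) × 𝕋ᴺ)` -/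
  continuity : ∀ φ : ℝ → Torus N → ℝ, IsTest T φ →
    ∫ t in Ioo 0 T, ∫ x, (ρ t x * deriv (fun s => φ s x) t
      + ∑ j, ρ t x * u t x j * pderiv j (φ t) x) = 0
  /-- the continuity equation in the renormalized sense -/
  renormalized : ∀ b : ℝ → ℝ, ContDiff ℝ 1 b → (∃ M : ℝ, ∀ z, M ≤ |z| → deriv b z = 0) →
    ∀ φ : ℝ → Torus N → ℝ, IsTest T φ →
    ∫ t in Ioo 0 T, ∫ x, (b (ρ t x) * deriv (fun s => φ s x) t
      + ∑ j, b (ρ t x) * u t x j * pderiv j (φ t) x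
      - (deriv b (ρ t x) * ρ t x - b (ρ t x)) * tr (Du t x) * φ t x) = 0
  /-- the momentum equation in `𝓓'((0,T) × 𝕋ᴺ)` -/
  momentum : ∀ i : Fin N, ∀ φ : ℝ → Torus N → ℝ, IsTest T φ →
    ∫ t in Ioo 0 T, ∫ x, (ρ t x * u t x i * deriv (fun s => φ s x) t
      + ∑ j, ρ t x * u t x i * u t x j * pderiv j (φ t) x
      + ρ t x ^ γ * pderiv i (φ t) x
      - 2 * μ * ∑ j, Du t x (i, j) * pderiv j (φ t) x
      - lam * tr (Du t x) * pderiv i (φ t) x) = 0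
  /-- the energy inequality -/
  energy_ineq : ∀ᵐ t ∂(volume.restrict (Ioo 0 T)),
    energy γ (ρ t) (u t) + dissipation μ lam Du t ≤ energy γ ρ₀ u₀

end CNS

end

section

open Filter Topology

noncomputable section

namespace CNS

section

/-! ### Functions of time: from almost every time to every time, and weak derivatives. -/

section RealLine

/-- A set of full measure is dense in the interval, so continuity carries the inequality to all
times. This is the device behind every statement below that is upgraded to each t in [0,T]. -/
theorem le_on_Icc_of_ae_le {T : ℝ} (hT : 0 < T) {f g : ℝ → ℝ} (hf : ContinuousOn f (Icc 0 T))
    (hg : ContinuousOn g (Icc 0 T)) (h : ∀ᵐ t ∂(volume.restrict (Ioo 0 T)), f t ≤ g t) :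
    ∀ t ∈ Icc 0 T, f t ≤ g t := by
  intro t ht
  rw [ae_restrict_iff' measurableSet_Ioo] at h
  have hd := Measure.dense_of_ae h
  have hcl : t ∈ closure (Ioo 0 T ∩ {t | t ∈ Ioo 0 T → f t ≤ g t}) := by
    refine closure_minimal (hd.open_subset_closure_inter isOpen_Ioo) isClosed_closure ?_
    rwa [closure_Ioo hT.ne]
  refine ContinuousWithinAt.closure_le hcl ((hf t ht).mono ?_) ((hg t ht).mono ?_) ?_
  · exact fun x hx => Ioo_subset_Icc_self hx.1
  · exact fun x hx => Ioo_subset_Icc_self hx.1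
  · exact fun y hy => hy.2 hy.1

theorem eq_on_Icc_of_ae_eq {T : ℝ} (hT : 0 < T) {f g : ℝ → ℝ} (hf : ContinuousOn f (Icc 0 T))
    (hg : ContinuousOn g (Icc 0 T)) (h : ∀ᵐ t ∂(volume.restrict (Ioo 0 T)), f t = g t) :
    ∀ t ∈ Icc 0 T, f t = g t := fun t ht =>
  le_antisymm (le_on_Icc_of_ae_le hT hf hg (h.mono fun _ h => h.le) t ht)
    (le_on_Icc_of_ae_le hT hg hf (h.mono fun _ h => h.ge) t ht)

/-- Smooth functions on the line with compact support in `(0,T)`. -/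
def IsTimeTest (T : ℝ) (χ : ℝ → ℝ) : Prop :=
  ContDiff ℝ ∞ χ ∧ ∃ a b : ℝ, 0 < a ∧ b < T ∧ ∀ t, t ∉ Icc a b → χ t = 0

theorem exists_timeTest_integral_eq_one {T : ℝ} (hT : 0 < T) :
    ∃ κ, IsTimeTest T κ ∧ ∫ x in (0 : ℝ)..T, κ x = 1 := by
  let b : ContDiffBump (T / 2) := ⟨T / 8, T / 4, by positivity, by linarith⟩
  have h0 : ∀ t, t ∉ Icc (T / 4) (3 * T / 4) → b.normed volume t = 0 := by
    intro t ht
    by_contra hne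
    apply ht
    have : t ∈ Function.support (b.normed volume) := hne
    rw [b.support_normed_eq, Real.ball_eq_Ioo] at this
    constructor <;> simp only [mem_Ioo, b] at this <;> linarith [this.1, this.2]
  refine ⟨b.normed volume, ⟨b.contDiff_normed, T / 4, 3 * T / 4, by positivity, by linarith, h0⟩, ?_⟩
  rw [intervalIntegral.integral_of_le hT.le, setIntegral_eq_integral_of_forall_compl_eq_zero,
    b.integral_normed]
  intro x hx
  apply h0
  intro hx'
  exact hx ⟨by linarith [hx'.1], by linarith [hx'.2]⟩

theorem IsTimeTest.primitive {T : ℝ} {φ : ℝ → ℝ} (hφ : IsTimeTest T φ)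
    (h0 : ∫ x in (0 : ℝ)..T, φ x = 0) :
    IsTimeTest T (fun t => ∫ x in (0 : ℝ)..t, φ x) ∧
      deriv (fun t => ∫ x in (0 : ℝ)..t, φ x) = φ := by
  obtain ⟨hs, a, b, ha, hb, hab⟩ := hφ
  have hc := hs.continuous
  have hd : deriv (fun t => ∫ x in (0 : ℝ)..t, φ x) = φ := by
    funext t; exact hc.deriv_integral φ 0 t
  refine ⟨⟨?_, a, b, ha, hb, ?_⟩, hd⟩
  · rw [contDiff_infty_iff_deriv, hd]
    exact ⟨fun t => (intervalIntegral.integral_hasDerivAt_right (hc.intervalIntegrable _ _)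
      (hc.stronglyMeasurableAtFilter _ _) hc.continuousAt).differentiableAt, hs⟩
  · intro t ht
    rw [mem_Icc, not_and_or, not_le, not_le] at ht
    rcases ht with ht | ht
    · refine intervalIntegral.integral_zero_ae (ae_of_all _ fun x hx => hab x fun hx' => ?_)
      have := hx.2
      rcases le_total 0 t with h | h
      · rw [max_eq_right h] at this; linarith [hx'.1]
      · rw [max_eq_left h] at this; linarith [hx'.1]
    · have h2 : ∫ x in t..T, φ x = 0 := by
        refine intervalIntegral.integral_zero_ae (ae_of_all _ fun x hx => hab x fun hx' => ?_)
        have := hx.1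
        have : min t T > b := lt_min ht hb
        linarith [hx'.2]
      have := intervalIntegral.integral_add_adjacent_intervals (hc.intervalIntegrable 0 t)
        (hc.intervalIntegrable (μ := volume) t T)
      rw [h2, h0] at this
      simpa using this

/-- A continuous function whose distributional derivative on `(0,T)` is integrable is a
primitive of it. -/
theorem sub_eq_integral_of_weak_deriv {T : ℝ} (hT : 0 < T) {g f : ℝ → ℝ}
    (hg : ContinuousOn g (Icc 0 T)) (hf : IntegrableOn f (Ioo 0 T))
    (h : ∀ χ, IsTimeTest T χ → ∫ t in Ioo 0 T, (g t * deriv χ t + f t * χ t) = 0) :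
    ∀ s t, 0 ≤ s → s ≤ t → t ≤ T → g t - g s = ∫ τ in Ioo s t, f τ := by
  have hfi : IntervalIntegrable f volume 0 T := by
    rw [intervalIntegrable_iff_integrableOn_Ioo_of_le hT.le]; exact hf
  set F : ℝ → ℝ := fun t => ∫ x in (0 : ℝ)..t, f x with hF
  have hFac : AbsolutelyContinuousOnInterval F 0 T :=
    hfi.absolutelyContinuousOnInterval_intervalIntegral (by simp)
  have hFc : ContinuousOn F (Icc 0 T) := by
    have := hFac.continuousOn; rwa [uIcc_of_le hT.le] at this
  set G : ℝ → ℝ := fun t => g t - F t with hG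
  have hGc : ContinuousOn G (Icc 0 T) := hg.sub hFc
  have hA : ∀ χ, IsTimeTest T χ → ∫ x in (0 : ℝ)..T, G x * deriv χ x = 0 := by
    intro χ hχ
    have hχ' := h χ hχ
    obtain ⟨hs, a, b, ha, hb, hab⟩ := hχ
    have hχc : Continuous (deriv χ) := hs.continuous_deriv (by simp)
    have hχac : AbsolutelyContinuousOnInterval χ 0 T :=
      ContDiffOn.absolutelyContinuousOnInterval (hs.of_le (by simp)).contDiffOn
    have e1 := hFac.integral_mul_deriv_eq_deriv_mul hχac
    have z0 : χ 0 = 0 := hab 0 fun h => by linarith [h.1]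
    have zT : χ T = 0 := hab T fun h => by linarith [h.2]
    have e2 : ∫ x in (0 : ℝ)..T, deriv F x * χ x = ∫ x in (0 : ℝ)..T, f x * χ x := by
      apply intervalIntegral.integral_congr_ae
      filter_upwards [hfi.ae_hasDerivAt_integral] with x hx hx'
      rw [(hx (uIoc_subset_uIcc hx') 0 (by simp)).deriv]
    rw [z0, zT, e2] at e1
    rw [← integral_Ioc_eq_integral_Ioo, ← intervalIntegral.integral_of_le hT.le,
      intervalIntegral.integral_add] at hχ'
    · simp only [hG, sub_mul]
      rw [intervalIntegral.integral_sub, e1]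
      · linarith
      · exact (ContinuousOn.mul (by rwa [uIcc_of_le hT.le])
          hχc.continuousOn).intervalIntegrable
      · exact (ContinuousOn.mul (by rwa [uIcc_of_le hT.le])
          hχc.continuousOn).intervalIntegrable
    · exact (ContinuousOn.mul (by rwa [uIcc_of_le hT.le])
          hχc.continuousOn).intervalIntegrable
    · exact hfi.mul_continuousOn hs.continuous.continuousOn
  -- The du Bois-Reymond argument: for a test function φ, the difference φ - (∫φ)κ has zero
  -- integral, hence is the derivative of a test function and is annihilated by `G`. So `G` acts on
  -- φ as the constant `c`.
  obtain ⟨κ, hκ, hκ1⟩ := exists_timeTest_integral_eq_one hT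
  set c := ∫ x in (0 : ℝ)..T, G x * κ x with hc
  have hGi : ∀ φ : ℝ → ℝ, Continuous φ →
      IntervalIntegrable (fun x => G x * φ x) volume 0 T := fun φ hφ =>
    (ContinuousOn.mul (by rwa [uIcc_of_le hT.le]) hφ.continuousOn).intervalIntegrable
  have hB : ∀ φ, IsTimeTest T φ → ∫ x in (0 : ℝ)..T, φ x * (G x - c) = 0 := by
    intro φ hφ
    set I := ∫ x in (0 : ℝ)..T, φ x with hI
    have ht : IsTimeTest T (fun x => φ x - I * κ x) := by
      obtain ⟨hs, a, b, ha, hb, hab⟩ := hφ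
      obtain ⟨hs', a', b', ha', hb', hab'⟩ := hκ
      refine ⟨hs.sub (contDiff_const.mul hs'), min a a', max b b', lt_min ha ha',
        max_lt hb hb', fun t ht => ?_⟩
      show φ t - I * κ t = 0
      rw [hab, hab']
      · simp
      · exact fun h => ht ⟨(min_le_right _ _).trans h.1, h.2.trans (le_max_right _ _)⟩
      · exact fun h => ht ⟨(min_le_left _ _).trans h.1, h.2.trans (le_max_left _ _)⟩
    have cφ := hφ.1.continuous
    have cκ := hκ.1.continuous
    have z : ∫ x in (0 : ℝ)..T, (φ x - I * κ x) = 0 := by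
      rw [intervalIntegral.integral_sub (cφ.intervalIntegrable _ _)
        ((cκ.const_mul I).intervalIntegrable _ _), intervalIntegral.integral_const_mul,
        hκ1]; simp [hI]
    obtain ⟨h1, h2⟩ := ht.primitive z
    have h3 := hA _ h1
    rw [h2] at h3
    have e : ∀ x, φ x * (G x - c) = G x * (φ x - I * κ x) + (I * (G x * κ x) - c * φ x) := by
      intro x; ring
    simp_rw [e]
    rw [intervalIntegral.integral_add, h3, intervalIntegral.integral_sub,
      intervalIntegral.integral_const_mul, intervalIntegral.integral_const_mul]
    · simp only [← hc, ← hI]; ring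
    · exact (hGi κ cκ).const_mul _
    · exact (cφ.intervalIntegrable _ _).const_mul _
    · exact hGi _ (cφ.sub (continuous_const.mul cκ))
    · exact ((hGi κ cκ).const_mul _).sub ((cφ.intervalIntegrable _ _).const_mul _)
  have hconst : ∀ t ∈ Icc 0 T, G t = c := by
    refine eq_on_Icc_of_ae_eq hT hGc continuousOn_const ?_
    rw [ae_restrict_iff' measurableSet_Ioo]
    have := isOpen_Ioo.ae_eq_zero_of_integral_contDiff_smul_eq_zero (μ := volume)
      (f := fun x => G x - c) (U := Ioo 0 T) ?_ ?_
    · filter_upwards [this] with t h1 h2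
      linarith [h1 h2]
    · exact ((hGc.sub continuousOn_const).mono Ioo_subset_Icc_self).locallyIntegrableOn
        measurableSet_Ioo
    · intro φ hφ hcs hsub
      have hφ0 : ∀ x, x ∉ Ioo 0 T → φ x = 0 := fun x hx =>
        image_eq_zero_of_notMem_tsupport fun h => hx (hsub h)
      have hφt : IsTimeTest T φ := by
        rcases (tsupport φ).eq_empty_or_nonempty with he | hne
        · refine ⟨hφ, T / 2, T / 2, by positivity, by linarith, fun t _ => ?_⟩
          exact image_eq_zero_of_notMem_tsupport (by rw [he]; simp)
        · have hK : IsCompact (tsupport φ) := hcs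
          refine ⟨hφ, sInf (tsupport φ), sSup (tsupport φ), (hsub (hK.sInf_mem hne)).1,
            (hsub (hK.sSup_mem hne)).2, fun t ht => ?_⟩
          exact image_eq_zero_of_notMem_tsupport fun h =>
            ht ⟨csInf_le hK.bddBelow h, le_csSup hK.bddAbove h⟩
      rw [← hB φ hφt, intervalIntegral.integral_of_le hT.le, integral_Ioc_eq_integral_Ioo,
        setIntegral_eq_integral_of_forall_compl_eq_zero]
      · simp
      · intro x hx; simp [hφ0 x hx]
  intro s t hs hst ht
  have h1 := hconst s ⟨hs, hst.trans ht⟩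
  have h2 := hconst t ⟨hs.trans hst, ht⟩
  rw [← integral_Ioc_eq_integral_Ioo, ← intervalIntegral.integral_of_le hst,
    ← intervalIntegral.integral_interval_sub_left (a := 0)]
  · simp only [hG, hF] at h1 h2 ⊢; linarith
  · exact hfi.mono_set (uIcc_subset_uIcc_left (by rw [uIcc_of_le hT.le]; exact ⟨hs.trans hst, ht⟩))
  · exact hfi.mono_set (uIcc_subset_uIcc_left (by rw [uIcc_of_le hT.le]; exact ⟨hs, hst.trans ht⟩))

end RealLine

/-! ### Continuity of translations and of products in Lebesgue spaces. -/

section Lp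

theorem tendsto_eLpNorm_translation {G : Type*} [AddCommGroup G] [TopologicalSpace G]
    [ContinuousAdd G] [R1Space G] [MeasurableSpace G] [BorelSpace G] {μ : Measure G}
    [IsLocallyFiniteMeasure μ] [μ.InnerRegularCompactLTTop] [μ.IsAddLeftInvariant]
    {p : ℝ≥0∞} (h1 : 1 ≤ p) (hp : p ≠ ⊤) {f : G → ℝ} (hf : MemLp f p μ) :
    Tendsto (fun c : G => eLpNorm (fun x => f (c + x) - f x) p μ) (𝓝 0) (𝓝 0) := by
  have : Fact (1 ≤ p) := ⟨h1⟩
  let g : G → C(G, G) := fun c => ⟨fun x => c + x, by fun_prop⟩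
  have hgc : Continuous g :=
    ((ContinuousMap.mk (fun a : G × G ↦ a.1 + a.2) continuous_add).curry).continuous
  have hgm : ∀ c, MeasurePreserving (g c) μ μ := fun c => measurePreserving_add_left μ c
  have key := (continuous_const (y := hf.toLp f)).compMeasurePreservingLp hgc hgm hp
  have k0 := (key.sub (continuous_const (y := hf.toLp f))).enorm.tendsto 0
  have e : ∀ c, ‖Lp.compMeasurePreserving (g c) (hgm c) (hf.toLp f) - hf.toLp f‖ₑ
      = eLpNorm (fun x => f (c + x) - f x) p μ := by
    intro c
    rw [Lp.enorm_def]
    apply eLpNorm_congr_ae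
    filter_upwards [Lp.coeFn_sub (Lp.compMeasurePreserving (g c) (hgm c) (hf.toLp f)) (hf.toLp f),
      Lp.coeFn_compMeasurePreserving (hf.toLp f) (hgm c), hf.coeFn_toLp,
      (hgm c).quasiMeasurePreserving.ae hf.coeFn_toLp] with x h1 h2 h3 h4
    rw [h1, Pi.sub_apply, h2, h3, Function.comp_apply, h4]; rfl
  rw [show (0 : ℝ≥0∞) = eLpNorm (fun x => f (0 + x) - f x) p μ by simp]
  rw [← e 0]
  exact k0.congr e

theorem tendsto_integral_mul_of_tendsto_L2 {α ι : Type*} [MeasurableSpace α] {μ : Measure α}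
    {l : Filter ι} {f g : α → ℝ} {F G : ι → α → ℝ} (hf : MemLp f 2 μ) (hg : MemLp g 2 μ)
    (hF : ∀ n, MemLp (F n) 2 μ) (hG : ∀ n, MemLp (G n) 2 μ)
    (hFf : Tendsto (fun n => eLpNorm (F n - f) 2 μ) l (𝓝 0))
    (hGg : Tendsto (fun n => eLpNorm (G n - g) 2 μ) l (𝓝 0)) :
    Tendsto (fun n => ∫ x, F n x * G n x ∂μ) l (𝓝 (∫ x, f x * g x ∂μ)) := by
  have h1 : Tendsto (fun n => (hF n).toLp (F n)) l (𝓝 (hf.toLp f)) :=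
    (Lp.tendsto_Lp_iff_tendsto_eLpNorm'' F hF f hf).2 hFf
  have h2 : Tendsto (fun n => (hG n).toLp (G n)) l (𝓝 (hg.toLp g)) :=
    (Lp.tendsto_Lp_iff_tendsto_eLpNorm'' G hG g hg).2 hGg
  have h3 := h1.inner (𝕜 := ℝ) h2
  have e : ∀ {a b : α → ℝ} (ha : MemLp a 2 μ) (hb : MemLp b 2 μ),
      inner ℝ (ha.toLp a) (hb.toLp b) = ∫ x, a x * b x ∂μ := by
    intro a b ha hb
    rw [L2.inner_def]
    apply integral_congr_ae
    filter_upwards [ha.coeFn_toLp, hb.coeFn_toLp] with x h1 h2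
    rw [h1, h2]; simp [mul_comm]
  simpa only [e] using h3

end Lp

end

section

/-! ### Calculus and convolution on the torus, through the covering by ℝᴺ. -/

section Torus

variable {N : ℕ}

instance : IsProbabilityMeasure (volume : Measure UnitAddCircle) :=
  ⟨by simp⟩

instance : IsProbabilityMeasure (volume : Measure (Torus N)) := by
  rw [volume_pi]; infer_instance

instance : Measure.IsNegInvariant (volume : Measure (Torus N)) :=
  Measure.IsAddHaarMeasure.isNegInvariant_of_regular _

theorem isOpenQuotientMap_toTorus : IsOpenQuotientMap (toTorus : (Fin N → ℝ) → Torus N) :=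
  IsOpenQuotientMap.piMap fun _ => QuotientAddGroup.isOpenQuotientMap_mk

theorem toTorus_surjective : Function.Surjective (toTorus : (Fin N → ℝ) → Torus N) :=
  isOpenQuotientMap_toTorus.surjective

theorem toTorus_sub (y z : Fin N → ℝ) : toTorus (y - z) = toTorus y - toTorus z := rfl

theorem toTorus_add (y z : Fin N → ℝ) : toTorus (y + z) = toTorus y + toTorus z := rfl

theorem toTorus_single (j : Fin N) (s : ℝ) :
    toTorus (Pi.single j s) = Pi.single j (s : UnitAddCircle) := by
  funext i
  by_cases h : i = j
  · subst h; simp [toTorus]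
  · simp [toTorus, h]

theorem IsSmooth.continuous {φ : Torus N → ℝ} (h : IsSmooth φ) : Continuous φ :=
  isOpenQuotientMap_toTorus.isQuotientMap.continuous_iff.2 (ContDiff.continuous h)

theorem IsSmooth.hasFDerivAt {φ : Torus N → ℝ} (h : IsSmooth φ) (y : Fin N → ℝ) :
    HasFDerivAt (fun y => φ (toTorus y)) (fderiv ℝ (fun y => φ (toTorus y)) y) y :=
  ((ContDiff.differentiable h (by simp)) y).hasFDerivAt

theorem IsSmooth.hasDerivAt_toTorus {φ : Torus N → ℝ} (h : IsSmooth φ) (j : Fin N)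
    (y : Fin N → ℝ) :
    HasDerivAt (fun s : ℝ => φ (toTorus y + Pi.single j (s : UnitAddCircle)))
      (fderiv ℝ (fun y => φ (toTorus y)) y (Pi.single j 1)) 0 := by
  have h1 : HasDerivAt (fun s : ℝ => y + Pi.single j s) (Pi.single j (1 : ℝ)) 0 := by
    refine HasDerivAt.const_add y (hasDerivAt_pi.2 fun i => ?_)
    by_cases hi : i = j
    · subst hi; simpa using hasDerivAt_id' (0 : ℝ)
    · simpa [hi] using hasDerivAt_const (0 : ℝ) (0 : ℝ)
  have h2 : HasFDerivAt (fun y => φ (toTorus y)) (fderiv ℝ (fun y => φ (toTorus y)) y)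
      (y + Pi.single j (0 : ℝ)) := by simpa using h.hasFDerivAt y
  have := h2.comp_hasDerivAt (0 : ℝ) h1
  simpa [Function.comp_def, toTorus_add, toTorus_single] using this

theorem IsSmooth.pderiv_toTorus {φ : Torus N → ℝ} (h : IsSmooth φ) (j : Fin N) (y : Fin N → ℝ) :
    pderiv j φ (toTorus y) = fderiv ℝ (fun y => φ (toTorus y)) y (Pi.single j 1) :=
  (h.hasDerivAt_toTorus j y).deriv

theorem IsSmooth.hasDerivAt {φ : Torus N → ℝ} (h : IsSmooth φ) (j : Fin N) (x : Torus N) :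
    HasDerivAt (fun s : ℝ => φ (x + Pi.single j (s : UnitAddCircle))) (pderiv j φ x) 0 := by
  obtain ⟨y, rfl⟩ := toTorus_surjective x
  rw [h.pderiv_toTorus]
  exact h.hasDerivAt_toTorus j y

theorem IsSmooth.pderiv {φ : Torus N → ℝ} (h : IsSmooth φ) (j : Fin N) :
    IsSmooth (pderiv j φ) := by
  unfold IsSmooth
  simp_rw [h.pderiv_toTorus]
  exact (ContDiff.fderiv_right (m := ∞) h (by simp)).clm_apply contDiff_const

theorem isSmooth_const (c : ℝ) : IsSmooth (fun _ : Torus N => c) := contDiff_const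

theorem IsSmooth.sub {φ ψ : Torus N → ℝ} (h : IsSmooth φ) (h' : IsSmooth ψ) :
    IsSmooth (fun x => φ x - ψ x) := ContDiff.sub h h'

theorem IsSmooth.mul {φ ψ : Torus N → ℝ} (h : IsSmooth φ) (h' : IsSmooth ψ) :
    IsSmooth (fun x => φ x * ψ x) := ContDiff.mul h h'

theorem IsSmooth.pow {φ : Torus N → ℝ} (h : IsSmooth φ) (n : ℕ) :
    IsSmooth (fun x => φ x ^ n) := ContDiff.pow h n

theorem pderiv_sub {φ ψ : Torus N → ℝ} (h : IsSmooth φ) (h' : IsSmooth ψ) (j : Fin N)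
    (x : Torus N) : pderiv j (fun x => φ x - ψ x) x = pderiv j φ x - pderiv j ψ x :=
  ((h.hasDerivAt j x).sub (h'.hasDerivAt j x)).deriv

theorem pderiv_sq {φ : Torus N → ℝ} (h : IsSmooth φ) (j : Fin N) (x : Torus N) :
    pderiv j (fun x => φ x ^ 2) x = 2 * φ x * pderiv j φ x := by
  have := ((h.hasDerivAt j x).fun_pow 2).deriv
  simpa [pderiv] using this

theorem pderiv_const_mul (c : ℝ) (φ : Torus N → ℝ) (j : Fin N) (x : Torus N) :
    pderiv j (fun x => c * φ x) x = c * pderiv j φ x := by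
  simp [pderiv]

theorem IsSmooth.comp_sub_left {κ : Torus N → ℝ} (h : IsSmooth κ) (x : Torus N) :
    IsSmooth (fun y => κ (x - y)) := by
  obtain ⟨y, rfl⟩ := toTorus_surjective x
  exact ContDiff.comp (g := fun y => κ (toTorus y)) h (contDiff_const (c := y) |>.sub contDiff_id)

theorem pderiv_comp_sub_left {κ : Torus N → ℝ} (h : IsSmooth κ) (x : Torus N) (j : Fin N)
    (y : Torus N) : pderiv j (fun y => κ (x - y)) y = -pderiv j κ (x - y) := by
  have h1 := (h.hasDerivAt j (x - y))
  have h2 : HasDerivAt (fun s : ℝ => -s) (-1) 0 := hasDerivAt_neg 0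
  have h3 := HasDerivAt.comp (h₂ := fun s : ℝ => κ (x - y + Pi.single j (s : UnitAddCircle)))
    (0 : ℝ) (by simpa using h1) h2
  have e : (fun s : ℝ => κ (x - (y + Pi.single j (s : UnitAddCircle)))) =
      (fun s : ℝ => κ (x - y + Pi.single j (s : UnitAddCircle))) ∘ (fun s : ℝ => -s) := by
    funext s
    simp only [Function.comp, AddCircle.coe_neg, Pi.single_neg]
    congr 1; abel
  rw [pderiv, e, h3.deriv]; ring

theorem IsSmooth.exists_bound {φ : Torus N → ℝ} (h : IsSmooth φ) : ∃ C, ∀ x, ‖φ x‖ ≤ C := by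
  obtain ⟨C, hC⟩ := isCompact_univ.exists_bound_of_continuousOn h.continuous.continuousOn
  exact ⟨C, fun x => hC x (mem_univ x)⟩

/-- The convolution of a kernel with a function on the torus. -/
def conv (κ f : Torus N → ℝ) (x : Torus N) : ℝ := ∫ y, κ (x - y) * f y

theorem integrable_conv {κ f : Torus N → ℝ} (h : Continuous κ) (hf : Integrable f) (x : Torus N) :
    Integrable (fun y => κ (x - y) * f y) := by
  obtain ⟨C, hC⟩ := isCompact_univ.exists_bound_of_continuousOn h.continuousOn
  refine hf.bdd_mul (c := C) ?_ (ae_of_all _ fun y => hC _ (mem_univ _))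
  exact (h.comp (by fun_prop)).aestronglyMeasurable

/-- The derivative falls on the kernel, whose partial derivatives are bounded by compactness; a
multiple of |f| therefore dominates. -/
theorem conv_hasFDerivAt {κ f : Torus N → ℝ} (h : IsSmooth κ) (hf : Integrable f)
    (y : Fin N → ℝ) :
    HasFDerivAt (fun y => conv κ f (toTorus y))
      (∑ j, conv (pderiv j κ) f (toTorus y) •
        (ContinuousLinearMap.proj j : (Fin N → ℝ) →L[ℝ] ℝ)) y := by
  have hD : ∀ z : Torus N, ∀ y, HasFDerivAt (fun y => κ (toTorus y - z))
      (∑ j, pderiv j κ (toTorus y - z) • (ContinuousLinearMap.proj j : (Fin N → ℝ) →L[ℝ] ℝ)) y := by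
    intro z y
    obtain ⟨z, rfl⟩ := toTorus_surjective z
    have h1 := (h.hasFDerivAt (y - z)).comp y ((hasFDerivAt_id y).sub_const z)
    refine HasFDerivAt.congr_fderiv h1 ?_
    refine ContinuousLinearMap.ext fun v => ?_
    have := LinearMap.pi_apply_eq_sum_univ
      (fderiv ℝ (fun y => κ (toTorus y)) (y - z)).toLinearMap v
    have e : ∀ i : Fin N, (fun j => if i = j then (1 : ℝ) else 0) = Pi.single i 1 := by
      intro i; funext j; simp [Pi.single_apply, eq_comm]
    simp only [e] at this
    simpa [← toTorus_sub, h.pderiv_toTorus, mul_comm] using this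
  choose C hC using fun j => (h.pderiv j).exists_bound
  have := hasFDerivAt_integral_of_dominated_of_fderiv_le (𝕜 := ℝ) (μ := (volume : Measure (Torus N)))
    (F := fun y z => κ (toTorus y - z) * f z) (x₀ := y) (s := univ)
    (F' := fun y z => f z • ∑ j, pderiv j κ (toTorus y - z) •
      (ContinuousLinearMap.proj j : (Fin N → ℝ) →L[ℝ] ℝ))
    (bound := fun z => ‖f z‖ * ∑ j, C j * ‖(ContinuousLinearMap.proj j : (Fin N → ℝ) →L[ℝ] ℝ)‖)
    univ_mem ?_ ?_ ?_ ?_ ?_ ?_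
  · refine this.congr_fderiv ?_
    have e : ∀ z, f z • ∑ j, pderiv j κ (toTorus y - z) •
      (ContinuousLinearMap.proj j : (Fin N → ℝ) →L[ℝ] ℝ) = ∑ j, (pderiv j κ (toTorus y - z) * f z) •
      (ContinuousLinearMap.proj j : (Fin N → ℝ) →L[ℝ] ℝ) := by
      intro z; rw [Finset.smul_sum]; simp_rw [smul_smul, mul_comm (f z)]
    refine (integral_congr_ae (ae_of_all _ e)).trans ?_
    rw [integral_finsetSum]
    · simp_rw [integral_smul_const]; rfl
    · intro j _
      exact (integrable_conv (h.pderiv j).continuous hf _).smul_const _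
  · exact Eventually.of_forall fun y =>
      (integrable_conv h.continuous hf _).aestronglyMeasurable
  · exact integrable_conv h.continuous hf _
  · refine hf.aestronglyMeasurable.smul (Continuous.aestronglyMeasurable ?_)
    have := fun j => (h.pderiv j).continuous
    fun_prop
  · refine ae_of_all _ fun z y _ => ?_
    rw [norm_smul]
    gcongr
    refine (norm_sum_le _ _).trans (Finset.sum_le_sum fun j _ => ?_)
    rw [norm_smul]
    gcongr
    exact hC j _
  · exact hf.norm.mul_const _
  · refine ae_of_all _ fun z y _ => ?_
    simpa [mul_comm] using (hD z y).const_mul (f z)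

theorem isSmooth_conv {κ f : Torus N → ℝ} (h : IsSmooth κ) (hf : Integrable f) :
    IsSmooth (conv κ f) := by
  have : ∀ (n : ℕ) (κ : Torus N → ℝ), IsSmooth κ →
      ContDiff ℝ n (fun y => conv κ f (toTorus y)) := by
    intro n
    induction n with
    | zero =>
      intro κ h
      rw [Nat.cast_zero, contDiff_zero]
      exact continuous_iff_continuousAt.2 fun y => (conv_hasFDerivAt h hf y).continuousAt
    | succ n ih =>
      intro κ h
      rw [Nat.cast_add, Nat.cast_one, contDiff_succ_iff_hasFDerivAt]
      exact ⟨_, ContDiff.sum fun j _ => (ih _ (h.pderiv j)).smul contDiff_const,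
        fun y => conv_hasFDerivAt h hf y⟩
  exact contDiff_infty.2 fun n => this n κ h

theorem pderiv_conv {κ f : Torus N → ℝ} (h : IsSmooth κ) (hf : Integrable f) (j : Fin N)
    (x : Torus N) : pderiv j (conv κ f) x = conv (pderiv j κ) f x := by
  obtain ⟨y, rfl⟩ := toTorus_surjective x
  rw [(isSmooth_conv h hf).pderiv_toTorus, (conv_hasFDerivAt h hf y).fderiv]
  simp [Pi.single_apply]

/-- The function y ↦ κ(x - y) is an admissible test function; the sign from reflecting it cancels
the sign in the definition of the weak derivative. -/
theorem pderiv_conv_of_weak {κ f g : Torus N → ℝ} {j : Fin N} (h : IsSmooth κ)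
    (hfg : HasWeakPartial j f g) : pderiv j (conv κ f) = conv κ g := by
  funext x
  rw [pderiv_conv h hfg.1]
  have := hfg.2.2 _ (h.comp_sub_left x)
  simp_rw [pderiv_comp_sub_left h] at this
  simp only [mul_neg, integral_neg, neg_inj] at this
  simpa only [conv, mul_comm] using this

theorem conv_eq (κ f : Torus N → ℝ) (x : Torus N) : conv κ f x = ∫ y, κ y * f (x - y) := by
  rw [conv, ← integral_sub_left_eq_self _ volume x]; simp

theorem abs_conv_le {κ f : Torus N → ℝ} {C : ℝ} (hκ : Continuous κ) (h0 : ∀ x, 0 ≤ κ x)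
    (h1 : ∫ x, κ x = 1) (hf : ∀ᵐ x, |f x| ≤ C) (x : Torus N) : |conv κ f x| ≤ C := by
  rw [conv]
  have e : ∫ y, κ (x - y) = 1 := by rw [integral_sub_left_eq_self κ volume x, h1]
  refine (abs_integral_le_integral_abs).trans ?_
  calc ∫ y, |κ (x - y) * f y| ≤ ∫ y, κ (x - y) * C := by
        refine integral_mono_of_nonneg (ae_of_all _ fun y => abs_nonneg _) ?_ ?_
        · exact ((hκ.comp (by fun_prop)).integrable_of_hasCompactSupport
            (HasCompactSupport.of_compactSpace _)).mul_const C
        · filter_upwards [hf] with y hy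
          rw [abs_mul, abs_of_nonneg (h0 _)]
          exact mul_le_mul_of_nonneg_left hy (h0 _)
    _ = C := by rw [integral_mul_const, e, one_mul]

end Torus

end

section

/-! ### An approximate identity made of powers of a trigonometric polynomial peaked at the origin.
-/

section Mollifier

variable {N : ℕ}

/-- A positive smooth function on the torus with a strict maximum at the origin. -/
def peak (x : Torus N) : ℝ := 1 + ∑ j, (1 + (fourier 1 (x j) : ℂ).re)

theorem peak_toTorus (y : Fin N → ℝ) :
    peak (toTorus y) = 1 + ∑ j, (1 + Real.cos (2 * Real.pi * y j)) := by
  unfold peak toTorus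
  congr 1
  refine Finset.sum_congr rfl fun j _ => ?_
  rw [fourier_coe_apply, ← Complex.exp_ofReal_mul_I_re]
  congr 3
  push_cast
  ring

theorem isSmooth_peak : IsSmooth (peak : Torus N → ℝ) := by
  unfold IsSmooth
  simp_rw [peak_toTorus]
  fun_prop

theorem one_le_peak (x : Torus N) : 1 ≤ peak x := by
  obtain ⟨y, rfl⟩ := toTorus_surjective x
  rw [peak_toTorus]
  have : 0 ≤ ∑ j, (1 + Real.cos (2 * Real.pi * y j)) :=
    Finset.sum_nonneg fun j _ => by linarith [Real.neg_one_le_cos (2 * Real.pi * y j)]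
  linarith

theorem peak_lt (x : Torus N) (hx : x ≠ 0) : peak x < peak (0 : Torus N) := by
  obtain ⟨y, rfl⟩ := toTorus_surjective x
  have h0 : (0 : Torus N) = toTorus 0 := by funext i; simp [toTorus]
  rw [h0, peak_toTorus, peak_toTorus]
  obtain ⟨i, hi⟩ : ∃ i, (y i : UnitAddCircle) ≠ 0 := by
    by_contra! h; exact hx (funext h)
  have : ∑ j, (1 + Real.cos (2 * Real.pi * y j)) <
      ∑ j : Fin N, (1 + Real.cos (2 * Real.pi * (0 : Fin N → ℝ) j)) := by
    refine Finset.sum_lt_sum (fun j _ => ?_) ⟨i, Finset.mem_univ i, ?_⟩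
    · simp [Real.cos_le_one]
    · simp only [Pi.zero_apply, mul_zero, Real.cos_zero]
      have hne : Real.cos (2 * Real.pi * y i) ≠ 1 := by
        intro h
        obtain ⟨n, hn⟩ := (Real.cos_eq_one_iff _).1 h
        apply hi
        rw [AddCircle.coe_eq_zero_iff]
        refine ⟨n, ?_⟩
        have := Real.pi_pos
        simp only [zsmul_eq_mul, mul_one]
        have h2 : 2 * Real.pi * ((n : ℝ) - y i) = 0 := by linarith
        rcases mul_eq_zero.1 h2 with h | h
        · linarith
        · linarith
      have := lt_of_le_of_ne (Real.cos_le_one _) hne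
      linarith
  linarith

/-- Normalized powers of `peak`: an approximate identity of smooth kernels. -/
def kernel (n : ℕ) (x : Torus N) : ℝ := (∫ y : Torus N, peak y ^ n)⁻¹ * peak x ^ n

theorem isSmooth_kernel (n : ℕ) : IsSmooth (kernel n : Torus N → ℝ) :=
  (isSmooth_const _).mul (isSmooth_peak.pow n)

theorem integrable_of_isSmooth {φ : Torus N → ℝ} (h : IsSmooth φ) : Integrable φ :=
  h.continuous.integrable_of_hasCompactSupport (HasCompactSupport.of_compactSpace _)

theorem integral_peak_pow_pos (n : ℕ) : 0 < ∫ y : Torus N, peak y ^ n := by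
  have : (1 : ℝ) ≤ ∫ y : Torus N, peak y ^ n := by
    have h := integral_mono (μ := (volume : Measure (Torus N))) (integrable_const (1 : ℝ))
      (integrable_of_isSmooth (isSmooth_peak.pow n)) (fun x => one_le_pow₀ (one_le_peak x))
    simpa using h
  linarith

theorem kernel_nonneg (n : ℕ) (x : Torus N) : 0 ≤ kernel n x :=
  mul_nonneg (inv_nonneg.2 (integral_peak_pow_pos n).le)
    (pow_nonneg (zero_le_one.trans (one_le_peak x)) n)

theorem integral_kernel (n : ℕ) : ∫ x : Torus N, kernel n x = 1 := by
  simp only [kernel]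
  rw [integral_const_mul, inv_mul_cancel₀ (integral_peak_pow_pos n).ne']

theorem tendsto_integral_kernel_mul {g : Torus N → ℝ} (hg : Integrable g)
    (hc : ContinuousAt g 0) :
    Tendsto (fun n => ∫ x, kernel n x * g x) atTop (𝓝 (g 0)) := by
  have := tendsto_setIntegral_pow_smul_of_unique_maximum_of_isCompact_of_integrableOn
    (μ := (volume : Measure (Torus N))) isCompact_univ isSmooth_peak.continuous.continuousOn
    (fun y _ hy => peak_lt y hy) (fun x _ => zero_le_one.trans (one_le_peak x))
    (zero_lt_one.trans_le (one_le_peak 0)) (by simp) hg.integrableOn hc.continuousWithinAt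
  refine this.congr fun n => ?_
  simp only [kernel, Measure.restrict_univ, smul_eq_mul, mul_assoc]
  rw [integral_const_mul]

/-- Jensen's inequality for the powers of an average. -/
theorem rpow_lintegral_mul_le {α : Type*} [MeasurableSpace α] {μ : Measure α} {κ h : α → ℝ≥0∞}
    (hκ : Measurable κ) (h1 : ∫⁻ x, κ x ∂μ = 1) (hh : AEMeasurable h μ) {q : ℝ} (hq : 1 ≤ q) :
    (∫⁻ x, κ x * h x ∂μ) ^ q ≤ ∫⁻ x, κ x * h x ^ q ∂μ := by
  have hP : IsProbabilityMeasure (μ.withDensity κ) :=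
    ⟨by rw [withDensity_apply _ MeasurableSet.univ, Measure.restrict_univ, h1]⟩
  have hh' : AEMeasurable h (μ.withDensity κ) := hh.mono_ac (withDensity_absolutelyContinuous _ _)
  have := eLpNorm'_le_eLpNorm'_of_exponent_le (μ := μ.withDensity κ) (f := h) zero_lt_one hq
    hh'.aestronglyMeasurable
  simp only [eLpNorm', enorm_eq_self, ENNReal.rpow_one, div_one] at this
  rw [lintegral_withDensity_eq_lintegral_mul₀ hκ.aemeasurable hh,
    lintegral_withDensity_eq_lintegral_mul₀ hκ.aemeasurable (hh.pow_const q)] at this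
  have h2 := ENNReal.rpow_le_rpow this (zero_le_one.trans hq)
  rwa [← ENNReal.rpow_mul, one_div_mul_cancel (by linarith), ENNReal.rpow_one] at h2

/-- By Jensen's inequality and Tonelli's theorem, the q-th power of the error is at most the kernel
average of W(y) = ‖f(· - y) - f‖^q. This W is bounded, continuous at 0 and zero there, and the
kernels concentrate at 0. -/
theorem tendsto_eLpNorm_conv_kernel_sub {q : ℝ} (hq : 1 ≤ q) {f : Torus N → ℝ}
    (hf : MemLp f (ENNReal.ofReal q) volume) :
    Tendsto (fun n => eLpNorm (conv (kernel n) f - f) (ENNReal.ofReal q) volume) atTop (𝓝 0) := by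
  have hq0 : 0 < q := by linarith
  have hqt : (ENNReal.ofReal q).toReal = q := ENNReal.toReal_ofReal hq0.le
  have hq1 : 1 ≤ ENNReal.ofReal q := by
    rw [← ENNReal.ofReal_one]; exact ENNReal.ofReal_le_ofReal hq
  have hfi : Integrable f := hf.integrable hq1
  set W : Torus N → ℝ≥0∞ := fun y => ∫⁻ x, ‖f (x - y) - f x‖ₑ ^ q with hW
  have hm : AEStronglyMeasurable (fun z : Torus N × Torus N => f (z.2 - z.1) - f z.2)
      (volume.prod volume) := by
    refine AEStronglyMeasurable.sub ?_ ?_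
    · exact hf.1.comp_quasiMeasurePreserving (f := fun z : Torus N × Torus N => z.2 - z.1)
        ((quasiMeasurePreserving_sub volume volume).comp Measure.measurePreserving_swap.quasiMeasurePreserving)
    · exact hf.1.comp_snd
  have hWe : ∀ y, W y = eLpNorm (fun x => f (x - y) - f x) (ENNReal.ofReal q) volume ^ q := by
    intro y
    rw [eLpNorm_eq_lintegral_rpow_enorm_toReal (by simpa using hq0) (by simp), hqt,
      ← ENNReal.rpow_mul, one_div_mul_cancel hq0.ne', ENNReal.rpow_one]
  have hW0 : Tendsto W (𝓝 0) (𝓝 0) := by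
    have h1 := tendsto_eLpNorm_translation hq1 (by simp) hf
    have h2 : Tendsto (fun y : Torus N => -y) (𝓝 0) (𝓝 0) := by
      simpa using (continuous_neg (G := Torus N)).tendsto 0
    have h3 := ((ENNReal.continuous_rpow_const (y := q)).tendsto 0).comp (h1.comp h2)
    rw [ENNReal.zero_rpow_of_pos hq0] at h3
    refine h3.congr fun y => ?_
    rw [hWe]; simp [sub_eq_add_neg, add_comm]
  have hWb : ∀ y, W y ≤ (2 * eLpNorm f (ENNReal.ofReal q) volume) ^ q := by
    intro y
    rw [hWe]
    refine ENNReal.rpow_le_rpow ?_ hq0.le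
    have hmp := measurePreserving_sub_right (volume : Measure (Torus N)) y
    refine (eLpNorm_sub_le (f := fun x => f (x - y)) (hf.1.comp_measurePreserving hmp) hf.1
      hq1).trans ?_
    have := eLpNorm_comp_measurePreserving hf.1 hmp (p := ENNReal.ofReal q)
    rw [Function.comp_def] at this
    rw [this, two_mul]
  have hC : (2 * eLpNorm f (ENNReal.ofReal q) volume) ^ q ≠ ⊤ :=
    ENNReal.rpow_ne_top_of_nonneg hq0.le (ENNReal.mul_ne_top (by simp) hf.2.ne)
  have hWm : AEMeasurable W volume :=
    (hm.enorm.pow_const q).lintegral_prod_right'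
  have hWt : ∀ y, W y ≠ ⊤ := fun y => ne_top_of_le_ne_top hC (hWb y)
  have hgi : Integrable (fun y => (W y).toReal) := by
    refine Integrable.of_bound (C := ((2 * eLpNorm f (ENNReal.ofReal q) volume) ^ q).toReal)
      hWm.ennreal_toReal.aestronglyMeasurable (ae_of_all _ fun y => ?_)
    rw [Real.norm_of_nonneg ENNReal.toReal_nonneg]
    exact ENNReal.toReal_mono hC (hWb y)
  have hW00 : W 0 = 0 := by simp [hW, hq0]
  have hgc : ContinuousAt (fun y => (W y).toReal) 0 := by
    have := (ENNReal.tendsto_toReal ENNReal.zero_ne_top).comp hW0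
    simpa [ContinuousAt, hW00, Function.comp_def] using this
  have key := tendsto_integral_kernel_mul hgi hgc
  simp only [hW00, ENNReal.toReal_zero] at key
  have hle : ∀ n, eLpNorm (conv (kernel n) f - f) (ENNReal.ofReal q) volume ≤
      ENNReal.ofReal (∫ x, kernel n x * (W x).toReal) ^ (1 / q) := by
    intro n
    rw [eLpNorm_eq_lintegral_rpow_enorm_toReal (by simpa using hq0) (by simp), hqt]
    refine ENNReal.rpow_le_rpow ?_ (by positivity)
    set κ : Torus N → ℝ≥0∞ := fun y => ENNReal.ofReal (kernel n y) with hκ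
    have hkc : Continuous (kernel n : Torus N → ℝ) := (isSmooth_kernel n).continuous
    have hκm : Measurable κ := (ENNReal.continuous_ofReal.comp hkc).measurable
    have hκ1 : ∫⁻ y, κ y = 1 := by
      rw [← ofReal_integral_eq_lintegral_ofReal (integrable_of_isSmooth (isSmooth_kernel n))
        (ae_of_all _ (kernel_nonneg n)), integral_kernel, ENNReal.ofReal_one]
    have step : ∀ᵐ x : Torus N, ‖(conv (kernel n) f - f) x‖ₑ ^ q ≤
        ∫⁻ y, κ y * ‖f (x - y) - f x‖ₑ ^ q := by
      have hm2 : ∀ᵐ x : Torus N, AEMeasurable (fun y => ‖f (x - y) - f x‖ₑ) volume :=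
        (hm.prod_swap.prodMk_left).mono fun x hx => hx.enorm
      filter_upwards [hm2] with x hx
      refine le_trans (ENNReal.rpow_le_rpow ?_ hq0.le)
        (rpow_lintegral_mul_le hκm hκ1 hx hq)
      have hi : Integrable (fun y => kernel n y * f (x - y)) := by
        have h0 := (integrable_conv hkc hfi x).comp_sub_left x
        simpa using h0
      have e : (conv (kernel n) f - f) x = ∫ y, kernel n y * (f (x - y) - f x) := by
        simp_rw [mul_sub]
        rw [integral_sub hi ((integrable_of_isSmooth (isSmooth_kernel n)).mul_const _),
          integral_mul_const, integral_kernel, one_mul, Pi.sub_apply, conv_eq]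
      rw [e]
      refine (enorm_integral_le_lintegral_enorm _).trans (lintegral_mono fun y => ?_)
      rw [enorm_mul, Real.enorm_of_nonneg (kernel_nonneg n y)]
    refine (lintegral_mono_ae step).trans ?_
    rw [lintegral_lintegral_swap]
    · rw [ofReal_integral_eq_lintegral_ofReal]
      · refine lintegral_mono fun y => ?_
        rw [lintegral_const_mul' _ _ ENNReal.ofReal_ne_top,
          ENNReal.ofReal_mul (kernel_nonneg n y), ENNReal.ofReal_toReal (hWt y)]
      · exact hgi.bdd_mul hkc.aestronglyMeasurable
          (ae_of_all _ (isSmooth_kernel n).exists_bound.choose_spec)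
      · exact ae_of_all _ fun y => mul_nonneg (kernel_nonneg n y) ENNReal.toReal_nonneg
    · exact (hκm.comp measurable_snd).aemeasurable.mul (hm.prod_swap.enorm.pow_const q)
  refine tendsto_of_tendsto_of_tendsto_of_le_of_le tendsto_const_nhds ?_ (fun _ => zero_le) hle
  have h5 := ((ENNReal.continuous_rpow_const (y := 1 / q)).tendsto 0).comp
    (ENNReal.tendsto_ofReal key |>.trans (by simp))
  rwa [ENNReal.zero_rpow_of_pos (by positivity)] at h5

end Mollifier

end

section

/-! ### Hölder and interpolation inequalities in mixed space-time norms. -/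

section MixedNorms

variable {α β : Type*} [MeasurableSpace α] [MeasurableSpace β] {μ : Measure α} {ν : Measure β}
  [SFinite μ] [SFinite ν]

omit [SFinite μ] in
-- Hölder with exponents p/2, q/2 in the second variable and q/2, p/2 in the first. The two factors
-- are decoupled on the right, so when the first variable is time the bound does not change under a
-- time shift of `A`.
theorem lintegral_mul_sq_le_mixed {p q : ℝ} (hp : 2 < p) (hq : 2 < q) (hpq : 1 / p + 1 / q = 1 / 2)
    {A B : α × β → ℝ≥0∞} (hA : AEMeasurable A (μ.prod ν)) (hB : AEMeasurable B (μ.prod ν)) :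
    ∫⁻ z, (A z * B z) ^ (2 : ℝ) ∂(μ.prod ν) ≤
      (∫⁻ s, (∫⁻ x, A (s, x) ^ p ∂ν) ^ (q / p) ∂μ) ^ (2 / q) *
        (∫⁻ s, (∫⁻ x, B (s, x) ^ q ∂ν) ^ (p / q) ∂μ) ^ (2 / p) := by
  have hp0 : 0 < p := by linarith
  have hq0 : 0 < q := by linarith
  have hsum : 2 / p + 2 / q = 1 := by
    have : 2 / p + 2 / q = 2 * (1 / p + 1 / q) := by ring
    rw [this, hpq]; norm_num
  have hAB : AEMeasurable (fun z => A z * B z) (μ.prod ν) := hA.mul hB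
  rw [lintegral_prod _ (hAB.pow_const _)]
  have hAa : ∀ᵐ s ∂μ, AEMeasurable (fun x => A (s, x)) ν :=
    hA.aestronglyMeasurable.prodMk_left.mono fun _ h => h.aemeasurable
  have hBa : ∀ᵐ s ∂μ, AEMeasurable (fun x => B (s, x)) ν :=
    hB.aestronglyMeasurable.prodMk_left.mono fun _ h => h.aemeasurable
  have inner : ∀ᵐ s ∂μ, ∫⁻ x, (A (s, x) * B (s, x)) ^ (2 : ℝ) ∂ν ≤
      (∫⁻ x, A (s, x) ^ p ∂ν) ^ (2 / p) * (∫⁻ x, B (s, x) ^ q ∂ν) ^ (2 / q) := by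
    filter_upwards [hAa, hBa] with s h1 h2
    have := ENNReal.lintegral_mul_norm_pow_le (μ := ν) (h1.pow_const p) (h2.pow_const q)
      (by positivity : (0 : ℝ) ≤ 2 / p) (by positivity : (0 : ℝ) ≤ 2 / q) hsum
    refine le_trans (lintegral_mono fun x => ?_) this
    rw [← ENNReal.rpow_mul, ← ENNReal.rpow_mul, mul_div_cancel₀ _ hp0.ne',
      mul_div_cancel₀ _ hq0.ne', ENNReal.mul_rpow_of_nonneg _ _ (by norm_num)]
  refine (lintegral_mono_ae inner).trans ?_
  have hAm : AEMeasurable (fun s => ∫⁻ x, A (s, x) ^ p ∂ν) μ :=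
    (hA.pow_const p).lintegral_prod_right'
  have hBm : AEMeasurable (fun s => ∫⁻ x, B (s, x) ^ q ∂ν) μ :=
    (hB.pow_const q).lintegral_prod_right'
  have := ENNReal.lintegral_mul_norm_pow_le (μ := μ) (hAm.pow_const (q / p)) (hBm.pow_const (p / q))
      (by positivity : (0 : ℝ) ≤ 2 / q) (by positivity : (0 : ℝ) ≤ 2 / p) (by linarith)
  refine le_trans (lintegral_mono fun x => ?_) this
  rw [← ENNReal.rpow_mul, ← ENNReal.rpow_mul]
  apply le_of_eq
  congr 2 <;> field_simp

omit [SFinite ν] in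
theorem lintegral_rpow_interpolation {p q : ℝ} (hp : 2 < p) (hq : 2 < q)
    (hpq : 1 / p + 1 / q = 1 / 2) (hle : p ≤ q) {A : β → ℝ≥0∞} (hA : AEMeasurable A ν) :
    (∫⁻ x, A x ^ p ∂ν) ^ (q / p) ≤
      (∫⁻ x, A x ^ (2 : ℝ) ∂ν) ^ ((1 - (p / q) ^ 2) * (q / p)) * (∫⁻ x, A x ^ q ∂ν) ^ (p / q) := by
  have hp0 : 0 < p := by linarith
  have hq0 : 0 < q := by linarith
  have hy1 : (p / q) ^ 2 ≤ 1 := pow_le_one₀ (by positivity) ((div_le_one hq0).2 hle)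
  have h := ENNReal.lintegral_mul_norm_pow_le (μ := ν) (hA.pow_const (2 : ℝ)) (hA.pow_const q)
      (by linarith : (0 : ℝ) ≤ 1 - (p / q) ^ 2) (by positivity : (0 : ℝ) ≤ (p / q) ^ 2) (by ring)
  have hrel : 2 * q + 2 * p = p * q := by field_simp at hpq; linarith
  have he : ∫⁻ x, A x ^ p ∂ν ≤
      (∫⁻ x, A x ^ (2 : ℝ) ∂ν) ^ (1 - (p / q) ^ 2) * (∫⁻ x, A x ^ q ∂ν) ^ ((p / q) ^ 2) := by
    refine le_trans (lintegral_mono fun x => ?_) h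
    rw [← ENNReal.rpow_mul, ← ENNReal.rpow_mul, ← ENNReal.rpow_add_of_nonneg]
    · apply le_of_eq
      congr 1
      field_simp
      nlinarith
    · have : 0 ≤ 1 - (p / q) ^ 2 := by linarith
      positivity
    · positivity
  refine (ENNReal.rpow_le_rpow he (by positivity)).trans ?_
  rw [ENNReal.mul_rpow_of_nonneg _ _ (by positivity), ← ENNReal.rpow_mul, ← ENNReal.rpow_mul]
  apply le_of_eq
  congr 2
  field_simp

end MixedNorms

/-! ### Limits of products with one factor shifted in time. -/

section TimeShift

variable {X : Type*} [MeasurableSpace X] {μ : Measure X} [SFinite μ]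

theorem measurePreserving_timeShift (r : ℝ) :
    MeasurePreserving (fun z : ℝ × X => (z.1 + r, z.2)) (volume.prod μ) (volume.prod μ) :=
  (measurePreserving_add_right volume r).prod (MeasurePreserving.id μ)

/-- Uniform control of the products of all time shifts of `f` with `g` by a square integrable
function. -/
structure ShiftBound (f g : ℝ × X → ℝ) (μ : Measure X) : Prop where
  left : Integrable f (volume.prod μ)
  right : AEStronglyMeasurable g (volume.prod μ)
  bound : ∃ G : ℝ × X → ℝ, MemLp G 2 (volume.prod μ) ∧ ∃ C : ℝ≥0∞, C ≠ ⊤ ∧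
    ∀ (r : ℝ) (E : Set (ℝ × X)), MeasurableSet E →
      ∫⁻ z in E, ‖f (z.1 + r, z.2)‖ₑ * ‖g z‖ₑ ∂(volume.prod μ) ≤
        C * (∫⁻ z in E, ‖G z‖ₑ ^ (2 : ℝ) ∂(volume.prod μ)) ^ (1 / 2 : ℝ)

theorem lintegral_sq_ne_top {α : Type*} [MeasurableSpace α] {μ : Measure α} {G : α → ℝ}
    (hG : MemLp G 2 μ) : ∫⁻ z, ‖G z‖ₑ ^ (2 : ℝ) ∂μ ≠ ⊤ := by
  have := lintegral_rpow_enorm_lt_top_of_eLpNorm_lt_top (p := 2) (by simp) (by simp) hG.2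
  simpa using this.ne

theorem ShiftBound.integrable {f g : ℝ × X → ℝ} (h : ShiftBound f g μ) (r : ℝ) :
    Integrable (fun z => f (z.1 + r, z.2) * g z) (volume.prod μ) := by
  obtain ⟨G, hG, C, hC, hb⟩ := h.bound
  refine ⟨(h.left.1.comp_measurePreserving (measurePreserving_timeShift r)).mul h.right, ?_⟩
  have := hb r univ MeasurableSet.univ
  rw [Measure.restrict_univ] at this
  simp only [HasFiniteIntegral, enorm_mul]
  exact this.trans_lt (ENNReal.mul_lt_top hC.lt_top (ENNReal.rpow_lt_top_of_nonneg (by norm_num)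
    (lintegral_sq_ne_top hG)))

/-- Where |g| ≤ n, continuity of translations in L¹ applied to f suffices. Where |g| > n, the bound
is uniform in the shift and small with ∫|G|² over that set, which tends to 0 as n grows. -/
theorem ShiftBound.tendsto [TopologicalSpace X] [AddCommGroup X] [ContinuousAdd X] [R1Space X]
    [BorelSpace X] [BorelSpace (ℝ × X)] [IsLocallyFiniteMeasure (volume.prod μ : Measure (ℝ × X))]
    [(volume.prod μ : Measure (ℝ × X)).InnerRegularCompactLTTop]
    [(volume.prod μ : Measure (ℝ × X)).IsAddLeftInvariant]
    {f g : ℝ × X → ℝ} (h : ShiftBound f g μ) :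
    Tendsto (fun r : ℝ => ∫ z, f (z.1 + r, z.2) * g z ∂(volume.prod μ)) (𝓝 0)
      (𝓝 (∫ z, f z * g z ∂(volume.prod μ))) := by
  obtain ⟨G, hG, C, hC, hb⟩ := h.bound
  set P := (volume.prod μ : Measure (ℝ × X)) with hP
  set g' := h.right.mk g with hg'
  have hgm : Measurable g' := h.right.stronglyMeasurable_mk.measurable
  have hgg : g =ᵐ[P] g' := h.right.ae_eq_mk
  set E : ℕ → Set (ℝ × X) := fun n => {z | (n : ℝ) < ‖g' z‖} with hE
  have hEm : ∀ n, MeasurableSet (E n) := fun n => measurableSet_lt measurable_const hgm.norm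
  set δ : ℕ → ℝ≥0∞ := fun n => ∫⁻ z in E n, ‖G z‖ₑ ^ (2 : ℝ) ∂P with hδ
  have hδ0 : Tendsto δ atTop (𝓝 0) := by
    have := tendsto_lintegral_of_dominated_convergence' (μ := P)
      (F := fun n => (E n).indicator fun z => ‖G z‖ₑ ^ (2 : ℝ)) (f := fun _ => 0)
      (fun z => ‖G z‖ₑ ^ (2 : ℝ)) (fun n => (hG.1.enorm.pow_const 2).indicator (hEm n))
      (fun n => ae_of_all _ fun z => indicator_le_self _ _ _) (lintegral_sq_ne_top hG)
      (ae_of_all _ fun z => ?_)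
    · simpa only [lintegral_indicator (hEm _), lintegral_zero] using this
    · obtain ⟨n, hn⟩ := exists_nat_ge ‖g' z‖
      refine tendsto_const_nhds.congr' ?_
      filter_upwards [eventually_ge_atTop n] with m hm
      rw [indicator_of_notMem]
      simp only [hE, mem_ofPred_eq, not_lt]
      exact hn.trans (by exact_mod_cast hm)
  have hδ1 : Tendsto (fun n => 2 * (C * δ n ^ (1 / 2 : ℝ))) atTop (𝓝 0) := by
    have h1 := ((ENNReal.continuous_rpow_const (y := 1 / 2)).tendsto 0).comp hδ0
    rw [ENNReal.zero_rpow_of_pos (by norm_num)] at h1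
    have h2 := ENNReal.Tendsto.const_mul (a := C) h1 (Or.inr hC)
    have h3 := ENNReal.Tendsto.const_mul (a := 2) h2 (Or.inr (by simp))
    simpa using h3
  have htr : Tendsto (fun r : ℝ => eLpNorm (fun z : ℝ × X => f (z.1 + r, z.2) - f z) 1 P) (𝓝 0)
      (𝓝 0) := by
    have h1 := tendsto_eLpNorm_translation (μ := P) le_rfl (by simp)
      (memLp_one_iff_integrable.2 h.left)
    have h2 : Tendsto (fun r : ℝ => (r, (0 : X))) (𝓝 0) (𝓝 0) := by
      have : Continuous (fun r : ℝ => (r, (0 : X))) := by fun_prop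
      exact this.tendsto 0
    refine (h1.comp h2).congr fun r => ?_
    simp only [Function.comp]
    congr 1
    funext z
    rw [show ((r, (0 : X)) + z) = (z.1 + r, z.2) from Prod.ext (add_comm _ _) (zero_add _)]
  have hle : ∀ r n, ‖∫ z, f (z.1 + r, z.2) * g z ∂P - ∫ z, f z * g z ∂P‖ₑ ≤
      n * eLpNorm (fun z : ℝ × X => f (z.1 + r, z.2) - f z) 1 P + 2 * (C * δ n ^ (1 / 2 : ℝ)) := by
    intro r n
    have hi0 : Integrable (fun z => f z * g z) P := by simpa using h.integrable 0
    rw [← integral_sub (h.integrable r) hi0]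
    refine (enorm_integral_le_lintegral_enorm _).trans ?_
    rw [← lintegral_add_compl _ (hEm n), add_comm]
    gcongr
    · rw [eLpNorm_one_eq_lintegral_enorm, ← lintegral_const_mul' _ _ (by simp)]
      refine le_trans ?_ (setLIntegral_le_lintegral (E n)ᶜ _)
      refine lintegral_mono_ae ?_
      filter_upwards [ae_restrict_mem (hEm n).compl, ae_restrict_of_ae hgg] with z hz hgz
      rw [← sub_mul, enorm_mul, mul_comm]
      gcongr
      rw [hgz, ← ofReal_norm, ← ENNReal.ofReal_natCast]
      apply ENNReal.ofReal_le_ofReal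
      simpa [hE] using hz
    · rw [two_mul]
      have b1 := hb r (E n) (hEm n)
      have b2 := hb 0 (E n) (hEm n)
      simp only [add_zero, Prod.mk.eta] at b2
      refine le_trans ?_ (add_le_add b1 b2)
      rw [← lintegral_add_right']
      · refine lintegral_mono fun z => ?_
        rw [← enorm_mul, ← enorm_mul]
        exact enorm_sub_le
      · exact (h.left.1.enorm.mul h.right.enorm).restrict
  rw [tendsto_iff_edist_tendsto_0]
  simp_rw [edist_eq_enorm_sub]
  rw [ENNReal.tendsto_nhds_zero]
  intro ε hε
  obtain ⟨n, hn⟩ := ((ENNReal.tendsto_nhds_zero.1 hδ1) (ε / 2) (by simp [hε.ne'])).exists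
  have h4 := ENNReal.Tendsto.const_mul (a := (n : ℝ≥0∞)) htr (Or.inr (by simp))
  rw [mul_zero] at h4
  filter_upwards [(ENNReal.tendsto_nhds_zero.1 h4) (ε / 2) (by simp [hε.ne'])] with r hr
  calc _ ≤ _ := hle r n
    _ ≤ ε / 2 + ε / 2 := add_le_add hr hn
    _ = ε := ENNReal.add_halves ε

theorem tendsto_average_of_tendsto {Φ : ℝ → ℝ} {c : ℝ} (h : Tendsto Φ (𝓝 0) (𝓝 c))
    (hm : ∀ h, IntegrableOn Φ (Ioo 0 h)) :
    Tendsto (fun h => h⁻¹ * ∫ r in Ioo 0 h, Φ r) (𝓝[>] 0) (𝓝 c) := by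
  rw [Metric.tendsto_nhds] at h ⊢
  intro ε hε
  obtain ⟨δ, hδ, hd⟩ := Metric.eventually_nhds_iff.1 (h (ε / 2) (by positivity))
  filter_upwards [Ioo_mem_nhdsGT hδ] with h hh
  have h0 : 0 < h := hh.1
  have e' : (h⁻¹ * ∫ r in Ioo 0 h, Φ r) - c = h⁻¹ * ∫ r in Ioo 0 h, (Φ r - c) := by
    rw [integral_sub (hm h) (by simp), setIntegral_const]
    simp [h0.le]
    field_simp
  have hn : ‖∫ r in Ioo 0 h, (Φ r - c)‖ ≤ ε / 2 * h := by
    have := norm_setIntegral_le_of_norm_le_const (μ := volume) (s := Ioo 0 h)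
      (f := fun r => Φ r - c) (C := ε / 2) (by simp) (fun r hr => ?_)
    · simpa [h0.le] using this
    · rw [← dist_eq_norm]
      refine (hd ?_).le
      rw [Real.dist_eq, sub_zero, abs_of_pos hr.1]
      exact hr.2.trans hh.2
  rw [Real.dist_eq, e', abs_mul, abs_of_pos (inv_pos.2 h0)]
  rw [Real.norm_eq_abs] at hn
  calc h⁻¹ * |∫ r in Ioo 0 h, (Φ r - c)| ≤ h⁻¹ * (ε / 2 * h) := by gcongr
    _ = ε / 2 := by field_simp
    _ < ε := by linarith

theorem ShiftBound.integrable_prod {f g : ℝ × X → ℝ} (hb : ShiftBound f g μ) (h : ℝ) :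
    Integrable (fun w : ℝ × (ℝ × X) => f (w.2.1 + w.1, w.2.2) * g w.2)
      ((volume.restrict (Ioo 0 h)).prod (volume.prod μ)) := by
  have hq : Measure.QuasiMeasurePreserving (fun w : ℝ × (ℝ × X) => (w.2.1 + w.1, w.2.2))
      ((volume.restrict (Ioo 0 h)).prod (volume.prod μ)) (volume.prod μ) :=
    QuasiMeasurePreserving.prod_of_right (by fun_prop)
      (ae_of_all _ fun r => (measurePreserving_timeShift r).quasiMeasurePreserving)
  have hm : AEStronglyMeasurable (fun w : ℝ × (ℝ × X) => f (w.2.1 + w.1, w.2.2) * g w.2)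
      ((volume.restrict (Ioo 0 h)).prod (volume.prod μ)) :=
    (hb.left.1.comp_quasiMeasurePreserving hq).mul hb.right.comp_snd
  obtain ⟨G, hG, C, hC, hbd⟩ := hb.bound
  refine ⟨hm, ?_⟩
  rw [HasFiniteIntegral, lintegral_prod _ hm.enorm]
  have : ∀ r : ℝ, ∫⁻ z, ‖f (z.1 + r, z.2) * g z‖ₑ ∂(volume.prod μ) ≤
      C * (∫⁻ z, ‖G z‖ₑ ^ (2 : ℝ) ∂(volume.prod μ)) ^ (1 / 2 : ℝ) := by
    intro r
    have := hbd r univ MeasurableSet.univ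
    rw [Measure.restrict_univ] at this
    simpa only [enorm_mul] using this
  refine (lintegral_mono this).trans_lt ?_
  rw [lintegral_const]
  refine ENNReal.mul_lt_top (ENNReal.mul_lt_top hC.lt_top (ENNReal.rpow_lt_top_of_nonneg
    (by norm_num) (lintegral_sq_ne_top hG))) (by simp)

/-- The left-hand order, base time outside and shift inside, is the one produced by integrating an
inequality over the base time; the right-hand order is the one in which the limit is known. -/
theorem ShiftBound.fubini {f g : ℝ × X → ℝ} (hb : ShiftBound f g μ) (h : ℝ) :
    Integrable (fun s : ℝ => ∫ r in Ioo 0 h, ∫ x, f (s + r, x) * g (s, x) ∂μ) ∧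
      ∫ s, ∫ r in Ioo 0 h, ∫ x, f (s + r, x) * g (s, x) ∂μ =
        ∫ r in Ioo 0 h, ∫ z, f (z.1 + r, z.2) * g z ∂(volume.prod μ) := by
  have h1 := hb.integrable_prod h
  have h2 : Integrable (fun w : (ℝ × ℝ) × X => f (w.1.2 + w.1.1, w.2) * g (w.1.2, w.2))
      (((volume.restrict (Ioo 0 h)).prod volume).prod μ) :=
    ((measurePreserving_prodAssoc _ _ _).integrable_comp_emb
      MeasurableEquiv.prodAssoc.measurableEmbedding).2 h1
  have h3 := h2.integral_prod_left
  refine ⟨h3.swap.integral_prod_left, ?_⟩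
  rw [← integral_integral_swap (μ := volume.restrict (Ioo 0 h)) (ν := volume) h3]
  refine integral_congr_ae (ae_of_all _ fun r => ?_)
  exact (integral_prod _ (hb.integrable r)).symm

theorem ShiftBound.tendsto_average [TopologicalSpace X] [AddCommGroup X] [ContinuousAdd X]
    [R1Space X] [BorelSpace X] [BorelSpace (ℝ × X)]
    [IsLocallyFiniteMeasure (volume.prod μ : Measure (ℝ × X))]
    [(volume.prod μ : Measure (ℝ × X)).InnerRegularCompactLTTop]
    [(volume.prod μ : Measure (ℝ × X)).IsAddLeftInvariant]
    {f g : ℝ × X → ℝ} (hb : ShiftBound f g μ) :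
    Tendsto (fun h => h⁻¹ * ∫ s, ∫ r in Ioo 0 h, ∫ x, f (s + r, x) * g (s, x) ∂μ) (𝓝[>] 0)
      (𝓝 (∫ z, f z * g z ∂(volume.prod μ))) := by
  simp_rw [fun h => (hb.fubini h).2]
  exact tendsto_average_of_tendsto hb.tendsto fun h => (hb.integrable_prod h).integral_prod_left

end TimeShift

section SpaceTime

variable {N : ℕ}

instance : (volume.prod volume : Measure (ℝ × Torus N)).InnerRegularCompactLTTop := by
  have h : (volume.prod volume : Measure (ℝ × Torus N)).Regular :=
    @Measure.Regular.of_sigmaCompactSpace_of_isLocallyFiniteMeasure _ _ _ _ _ inferInstance _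
      inferInstance
  exact inferInstance

instance : (volume.prod volume : Measure (ℝ × Torus N)).IsAddLeftInvariant :=
  ⟨fun c => ((measurePreserving_add_left (volume : Measure ℝ) c.1).prod
    (measurePreserving_add_left (volume : Measure (Torus N)) c.2)).map_eq⟩

end SpaceTime

end

/-! ### Bochner classes, weak continuity in time, and the kinetic energy as a supremum. -/

section

variable {N : ℕ}

/-- The measure of the space-time cylinder `(0,T) × 𝕋ᴺ`. -/
abbrev cyl (N : ℕ) (T : ℝ) : Measure (ℝ × Torus N) :=
  (volume.restrict (Ioo 0 T)).prod volume

section FunctionSpaces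

variable {E : Type*} [NormedAddCommGroup E] {T : ℝ}

theorem MemLpLq.memLp_two {f : ℝ → Torus N → E} (h : MemLpLq T f 2 2) :
    MemLp (Function.uncurry f) 2 (cyl N T) := by
  refine ⟨h.1, ?_⟩
  have h2 := h.2
  rw [eLpNorm_lt_top_iff_lintegral_rpow_enorm_lt_top (by simp) (by simp)] at h2 ⊢
  rw [lintegral_prod _ (h.1.enorm.pow_const _)]
  refine lt_of_eq_of_lt (lintegral_congr fun t => ?_) h2
  rw [enorm_eq_self, eLpNorm_eq_lintegral_rpow_enorm_toReal (by simp) (by simp), ← ENNReal.rpow_mul]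
  simp [Function.uncurry]

theorem MemLpLq.aemeasurable {f : ℝ → Torus N → E} {p q : ℝ≥0∞} (hq0 : q ≠ 0) (hq : q ≠ ⊤)
    (h : MemLpLq T f p q) :
    AEMeasurable (fun t => eLpNorm (f t) q volume) (volume.restrict (Ioo 0 T)) := by
  simp_rw [eLpNorm_eq_lintegral_rpow_enorm_toReal hq0 hq]
  exact (h.1.enorm.pow_const q.toReal).lintegral_prod_right'.pow_const _

theorem MemLpLq.mono {f : ℝ → Torus N → E} {p q p' q' : ℝ≥0∞} (hp : p' ≤ p) (hq : q' ≤ q)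
    (hq0 : q' ≠ 0) (hq' : q' ≠ ⊤) (h : MemLpLq T f p q) : MemLpLq T f p' q' := by
  have h1 : MemLpLq T f p q' := by
    refine ⟨h.1, lt_of_le_of_lt ?_ h.2⟩
    refine eLpNorm_mono_enorm_ae ?_
    filter_upwards [h.1.prodMk_left] with t ht
    exact eLpNorm_le_eLpNorm_of_exponent_le hq ht
  refine ⟨h.1, ?_⟩
  have hm := h1.aemeasurable hq0 hq'
  exact (MemLp.mono_exponent (ε := ℝ≥0∞) ⟨hm.aestronglyMeasurable, h1.2⟩ hp).2

theorem MemLpLq.ae_memLp {f : ℝ → Torus N → E} {p q : ℝ≥0∞} (hp0 : p ≠ 0) (hp : p ≠ ⊤)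
    (hq0 : q ≠ 0) (hq : q ≠ ⊤) (h : MemLpLq T f p q) :
    ∀ᵐ t ∂(volume.restrict (Ioo 0 T)), MemLp (f t) q volume := by
  have h2 := (eLpNorm_lt_top_iff_lintegral_rpow_enorm_lt_top hp0 hp).1 h.2
  have hm := h.aemeasurable hq0 hq
  have h3 := ae_lt_top' (hm.enorm.pow_const p.toReal) h2.ne
  filter_upwards [h.1.prodMk_left, h3] with t h4 h5
  refine ⟨h4, ?_⟩
  by_contra hne
  rw [not_lt_top_iff] at hne
  rw [enorm_eq_self, hne, ENNReal.top_rpow_of_pos (ENNReal.toReal_pos hp0 hp)] at h5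
  exact lt_irrefl _ h5

theorem MemLpLq.ae_bound {f : ℝ → Torus N → E} {q : ℝ≥0∞} (h : MemLpLq T f ⊤ q) :
    ∃ C : ℝ≥0∞, C ≠ ⊤ ∧ ∀ᵐ t ∂(volume.restrict (Ioo 0 T)), MemLp (f t) q volume ∧
      eLpNorm (f t) q volume ≤ C := by
  refine ⟨_, h.2.ne, ?_⟩
  have h1 := h.1.prodMk_left
  have h2 := ae_le_eLpNormEssSup (f := fun t => eLpNorm (f t) q volume)
    (μ := volume.restrict (Ioo 0 T))
  filter_upwards [h1, h2] with t h3 h4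
  rw [enorm_eq_self, ← eLpNorm_exponent_top] at h4
  exact ⟨⟨h3, h4.trans_lt h.2⟩, h4⟩

theorem WeaklyContinuous.continuousOn [InnerProductSpace ℝ E] {f : ℝ → Torus N → E} {r : ℝ}
    (hr : 1 < r) (h : WeaklyContinuous T f (ENNReal.ofReal r)) {g : Torus N → E}
    (hg : AEStronglyMeasurable g volume) {C : ℝ} (hC : ∀ᵐ x, ‖g x‖ ≤ C) :
    ContinuousOn (fun t => ∫ x, inner ℝ (f t x) (g x)) (Icc 0 T) :=
  h.2 _ (Real.HolderConjugate.conjExponent hr).ennrealOfReal g (MemLp.of_bound hg C hC)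

theorem WeaklyContinuous.integrable [InnerProductSpace ℝ E] {f : ℝ → Torus N → E} {r : ℝ}
    (hr : 1 < r) (h : WeaklyContinuous T f (ENNReal.ofReal r)) {t : ℝ} (ht : t ∈ Icc 0 T) :
    Integrable (f t) :=
  (h.1 t ht).integrable (by rw [← ENNReal.ofReal_one]; exact ENNReal.ofReal_le_ofReal hr.le)

end FunctionSpaces

section Kinetic

theorem inner_sub_le_kinetic {ρ : ℝ} (hρ : 0 ≤ ρ) (u v : Vec N) :
    inner ℝ (ρ • u) v - 1 / 2 * ρ * ‖v‖ ^ 2 ≤ 1 / 2 * ρ * ‖u‖ ^ 2 := by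
  have h := norm_sub_sq_real u v
  rw [inner_smul_left]
  simp only [conj_trivial]
  nlinarith [mul_nonneg hρ (sq_nonneg ‖u - v‖)]

/-- Only ρ and ρu are measurable at a fixed time, not u. Dividing |ρu|² by ρ recovers the function,
and `0⁻¹ = 0` gives the right value on vacuum. -/
theorem aestronglyMeasurable_kinetic {ρ : Torus N → ℝ} {u : Torus N → Vec N}
    (hρ : AEStronglyMeasurable ρ volume) (hm : AEStronglyMeasurable (fun x => ρ x • u x) volume) :
    AEStronglyMeasurable (fun x => ρ x * ‖u x‖ ^ 2) volume := by
  have e : (fun x => ρ x * ‖u x‖ ^ 2) = fun x => ‖ρ x • u x‖ ^ 2 * (ρ x)⁻¹ := by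
    funext x
    rw [norm_smul, mul_pow, Real.norm_eq_abs, sq_abs]
    by_cases h : ρ x = 0
    · simp [h]
    · field_simp
  rw [e]
  exact ((hm.norm.aemeasurable.pow_const 2).mul hρ.aemeasurable.inv).aestronglyMeasurable

/-- The kinetic energy is the supremum of the affine functionals
`(ρ, ρu) ↦ ∫ ρu·v - ½ρ|v|²` over bounded fields `v`. -/
theorem kinetic_le_of_forall_test {ρ : Torus N → ℝ} {u : Torus N → Vec N} {B : ℝ}
    (hρ : Integrable ρ) (hρ0 : ∀ᵐ x, 0 ≤ ρ x) (hm : Integrable (fun x => ρ x • u x))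
    (h : ∀ v : Torus N → Vec N, AEStronglyMeasurable v volume → (∃ C : ℝ, ∀ᵐ x, ‖v x‖ ≤ C) →
      (∫ x, inner ℝ (ρ x • u x) (v x)) - (∫ x, 1 / 2 * ρ x * ‖v x‖ ^ 2) ≤ B) :
    Integrable (fun x => ρ x * ‖u x‖ ^ 2) ∧ ∫ x, 1 / 2 * ρ x * ‖u x‖ ^ 2 ≤ B := by
  have hmeas := aestronglyMeasurable_kinetic hρ.1 hm.1
  let δ : ℕ → ℝ := fun n => 1 / ((n : ℝ) + 1)
  have hδ : ∀ n, 0 < δ n := fun n => by positivity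
  have hδ0 : Tendsto δ atTop (𝓝 0) := tendsto_one_div_add_atTop_nhds_zero_nat
  -- The fields `v n` regularize u = ρu/ρ: they are bounded by δ⁻² and tend to u where ρ > 0. With θ
  -- = `c n x * ρ x` ∈ [0,1] the tested density is ρ|u|²(θ - θ²/2) ≥ 0, so Fatou's lemma applies as
  -- θ → 1.
  let c : ℕ → Torus N → ℝ := fun n x => ((ρ x + δ n) * (1 + δ n * ‖ρ x • u x‖))⁻¹
  let v : ℕ → Torus N → Vec N := fun n x => c n x • (ρ x • u x)
  have hvm : ∀ n, AEStronglyMeasurable (v n) volume := fun n => by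
    have h1 := hρ.1.aemeasurable
    have h2 := hm.1.norm.aemeasurable
    have : AEMeasurable (c n) volume :=
      ((h1.add_const _).mul ((h2.const_mul _).const_add _)).inv
    exact this.aestronglyMeasurable.smul hm.1
  have hθ : ∀ n x, 0 ≤ ρ x → 0 ≤ c n x * ρ x ∧ c n x * ρ x ≤ 1 := by
    intro n x hx
    have h1 : 0 < (ρ x + δ n) * (1 + δ n * ‖ρ x • u x‖) := by
      have := hδ n; positivity
    refine ⟨mul_nonneg (inv_nonneg.2 h1.le) hx, ?_⟩
    rw [inv_mul_le_iff₀ h1, mul_one]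
    have h3 := hδ n
    have h4 : 0 ≤ δ n * ‖ρ x • u x‖ := by positivity
    nlinarith
  have hvb : ∀ n, ∀ᵐ x, ‖v n x‖ ≤ (δ n)⁻¹ * (δ n)⁻¹ := by
    intro n
    filter_upwards [hρ0] with x hx
    have h3 := hδ n
    have h1 : 0 < (ρ x + δ n) * (1 + δ n * ‖ρ x • u x‖) := by positivity
    simp only [v, c]
    rw [norm_smul, Real.norm_of_nonneg (inv_nonneg.2 h1.le), inv_mul_le_iff₀ h1, ← mul_inv,
      ← div_eq_mul_inv, le_div_iff₀ (by positivity)]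
    have : 0 ≤ δ n * ‖ρ x • u x‖ := by positivity
    nlinarith [mul_nonneg hx this]
  have hpt : ∀ n x, inner ℝ (ρ x • u x) (v n x) - 1 / 2 * ρ x * ‖v n x‖ ^ 2 =
      ρ x * ‖u x‖ ^ 2 * (c n x * ρ x - 1 / 2 * (c n x * ρ x) ^ 2) := by
    intro n x
    simp only [v, smul_smul, inner_smul_left, inner_smul_right, norm_smul,
      real_inner_self_eq_norm_sq, conj_trivial, mul_pow, Real.norm_eq_abs, sq_abs]
    ring
  have hi1 : ∀ n, Integrable (fun x => inner ℝ (ρ x • u x) (v n x)) := fun n => by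
    refine (hm.norm.mul_const ((δ n)⁻¹ * (δ n)⁻¹)).mono' (hm.1.inner (hvm n)) ?_
    filter_upwards [hvb n] with x hx
    exact (norm_inner_le_norm _ _).trans (by gcongr)
  have hi2 : ∀ n, Integrable (fun x => 1 / 2 * ρ x * ‖v n x‖ ^ 2) := fun n => by
    refine (hρ.const_mul (1 / 2)).mul_bdd (c := ((δ n)⁻¹ * (δ n)⁻¹) ^ 2) ((hvm n).norm.pow 2) ?_
    filter_upwards [hvb n] with x hx
    rw [norm_pow, norm_norm]
    gcongr
  have hlim : ∀ᵐ x, Tendsto (fun n => inner ℝ (ρ x • u x) (v n x) - 1 / 2 * ρ x * ‖v n x‖ ^ 2)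
      atTop (𝓝 (1 / 2 * (ρ x * ‖u x‖ ^ 2))) := by
    filter_upwards [hρ0] with x hx
    simp_rw [hpt]
    rcases hx.eq_or_lt with h0 | h0
    · simp [← h0]
    · have h1 : Tendsto (fun n => c n x) atTop (𝓝 ((ρ x + 0) * (1 + 0 * ‖ρ x • u x‖))⁻¹) := by
        refine Tendsto.inv₀ ?_ (by simpa using h0.ne')
        exact (hδ0.const_add _).mul ((hδ0.mul_const _).const_add _)
      have h2 := (h1.mul_const (ρ x))
      simp only [add_zero, zero_mul, mul_one, inv_mul_cancel₀ h0.ne'] at h2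
      have h3 := (h2.sub ((h2.pow 2).const_mul (1 / 2))).const_mul (ρ x * ‖u x‖ ^ 2)
      convert h3 using 2
      ring
  have hnn : ∀ n, ∀ᵐ x, 0 ≤ inner ℝ (ρ x • u x) (v n x) - 1 / 2 * ρ x * ‖v n x‖ ^ 2 := by
    intro n
    filter_upwards [hρ0] with x hx
    rw [hpt]
    obtain ⟨h1, h2⟩ := hθ n x hx
    have : 0 ≤ c n x * ρ x - 1 / 2 * (c n x * ρ x) ^ 2 := by nlinarith
    positivity
  have hB : ∀ n, ∫⁻ x, ENNReal.ofReal (inner ℝ (ρ x • u x) (v n x) -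
      1 / 2 * ρ x * ‖v n x‖ ^ 2) ≤ ENNReal.ofReal B := by
    intro n
    have hi : Integrable (fun x => inner ℝ (ρ x • u x) (v n x) - 1 / 2 * ρ x * ‖v n x‖ ^ 2) :=
      (hi1 n).sub (hi2 n)
    rw [← ofReal_integral_eq_lintegral_ofReal hi (hnn n)]
    apply ENNReal.ofReal_le_ofReal
    rw [integral_sub (hi1 n) (hi2 n)]
    exact h _ (hvm n) ⟨_, hvb n⟩
  have hfatou : ∫⁻ x, ENNReal.ofReal (1 / 2 * (ρ x * ‖u x‖ ^ 2)) ≤ ENNReal.ofReal B := by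
    have h1 := lintegral_liminf_le' (μ := (volume : Measure (Torus N))) (u := atTop)
      (f := fun (n : ℕ) x => ENNReal.ofReal (inner ℝ (ρ x • u x) (v n x) -
      1 / 2 * ρ x * ‖v n x‖ ^ 2)) (fun n => ((hi1 n).sub (hi2 n)).1.aemeasurable.ennreal_ofReal)
    refine le_trans (le_of_eq ?_) (h1.trans ?_)
    · refine lintegral_congr_ae ?_
      filter_upwards [hlim] with x hx
      exact (ENNReal.tendsto_ofReal hx).liminf_eq.symm
    · exact liminf_le_of_le (by isBoundedDefault) fun b hb => by
        obtain ⟨n, hn⟩ := hb.exists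
        exact hn.trans (hB n)
  have hint : Integrable (fun x => 1 / 2 * (ρ x * ‖u x‖ ^ 2)) := by
    refine ⟨hmeas.const_mul _, ?_⟩
    rw [hasFiniteIntegral_iff_ofReal]
    · exact hfatou.trans_lt ENNReal.ofReal_lt_top
    · filter_upwards [hρ0] with x hx; show 0 ≤ 1 / 2 * (ρ x * ‖u x‖ ^ 2); positivity
  refine ⟨by simpa using hint.const_mul 2, ?_⟩
  have h0 : 0 ≤ B := by
    have := h 0 aestronglyMeasurable_const ⟨0, by simp⟩
    simpa using this
  simp_rw [mul_assoc]
  rw [integral_eq_lintegral_of_nonneg_ae _ hint.1]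
  · exact ENNReal.toReal_le_of_le_ofReal h0 hfatou
  · filter_upwards [hρ0] with x hx; show 0 ≤ 1 / 2 * (ρ x * ‖u x‖ ^ 2); positivity

/-- This is Young's inequality, i.e. the weighted mean inequality for `a ^ γ` and `b ^ γ` with
weights (γ-1)/γ and 1/γ. -/
theorem rpow_tangent_le {γ a b : ℝ} (hγ : 1 < γ) (ha : 0 ≤ a) (hb : 0 ≤ b) :
    a ^ γ + γ * a ^ (γ - 1) * (b - a) ≤ b ^ γ := by
  have h := Real.geom_mean_le_arith_mean2_weighted (w₁ := (γ - 1) / γ) (w₂ := 1 / γ)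
    (p₁ := a ^ γ) (p₂ := b ^ γ) (div_nonneg (by linarith) (by linarith)) (by positivity)
    (by positivity) (by positivity) (by field_simp; ring)
  rw [← Real.rpow_mul ha, ← Real.rpow_mul hb, mul_div_cancel₀ _ (by positivity),
    mul_one_div_cancel (by positivity), Real.rpow_one] at h
  have e : a ^ (γ - 1) * a = a ^ γ := by
    rw [← Real.rpow_add_one' ha (by linarith)]; congr 1; ring
  have h2 : γ * (a ^ (γ - 1) * b) ≤ (γ - 1) * a ^ γ + b ^ γ := by
    have := mul_le_mul_of_nonneg_left h (by linarith : (0 : ℝ) ≤ γ)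
    calc _ ≤ _ := this
      _ = _ := by field_simp
  nlinarith

end Kinetic

end

/-! ### Properties of the solution at each time, and the energy inequality. -/

section

variable {N : ℕ}

/-- A weak solution with bounded density, `∇√ρ ∈ L^∞(0,T; L²)` and velocity in
`L^p(0,T; L^q)` with finite exponents on the Shinbrot line `1/p + 1/q = 1/2`. -/
structure RegularSolution (T γ μ lam R p q : ℝ) (ρ₀ : Torus N → ℝ) (u₀ : Torus N → Vec N)
    (ρ : ℝ → Torus N → ℝ) (u : ℝ → Torus N → Vec N) (Du : ℝ → Torus N → Mat N)
    (S : ℝ → Torus N → Vec N) : Prop where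
  T_pos : 0 < T
  one_lt : 1 < γ
  sol : IsWeakSolution T γ μ lam ρ₀ u₀ ρ u Du
  bound : ∀ᵐ z ∂(cyl N T), 0 ≤ ρ z.1 z.2 ∧ ρ z.1 z.2 ≤ R
  sqrt_mem : MemLpLq T S ⊤ 2
  sqrt_grad : ∀ᵐ t ∂(volume.restrict (Ioo 0 T)), ∀ j : Fin N,
    HasWeakPartial j (fun x => Real.sqrt (ρ t x)) (fun x => S t x j)
  two_lt : 2 < p
  le : p ≤ q
  line : 1 / p + 1 / q = 1 / 2
  mixed : MemLpLq T u (ENNReal.ofReal p) (ENNReal.ofReal q)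

theorem memLp_coord {α ι : Type*} [Fintype ι] [MeasurableSpace α] {P : Measure α} {r : ℝ≥0∞}
    {f : α → EuclideanSpace ℝ ι} (h : MemLp f r P) (i : ι) : MemLp (fun z => f z i) r P := by
  refine h.of_le ?_ (ae_of_all _ fun z => PiLp.norm_apply_le (f z) i)
  exact (EuclideanSpace.proj (𝕜 := ℝ) i).continuous.comp_aestronglyMeasurable h.1

theorem memLp_tr {α : Type*} [MeasurableSpace α] {P : Measure α} {r : ℝ≥0∞}
    {f : α → Mat N} (h : MemLp f r P) : MemLp (fun z => tr (f z)) r P :=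
  memLp_finsetSum _ fun i _ => memLp_coord h (i, i)

namespace RegularSolution

variable {T γ μ lam R p q : ℝ} {ρ₀ : Torus N → ℝ} {u₀ : Torus N → Vec N}
  {ρ : ℝ → Torus N → ℝ} {u : ℝ → Torus N → Vec N} {Du : ℝ → Torus N → Mat N}
  {S : ℝ → Torus N → Vec N}

section Slices

variable (h : RegularSolution T γ μ lam R p q ρ₀ u₀ ρ u Du S)
include h

theorem momentum_exponent : 1 < 2 * γ / (γ + 1) := by
  have := h.one_lt
  rw [lt_div_iff₀ (by linarith)]; linarith

theorem ae_bound : ∀ᵐ t ∂(volume.restrict (Ioo 0 T)), ∀ᵐ x, 0 ≤ ρ t x ∧ ρ t x ≤ R :=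
  Measure.ae_ae_of_ae_prod h.bound

theorem integrable_density {t : ℝ} (ht : t ∈ Icc 0 T) : Integrable (ρ t) :=
  h.sol.density_cont.integrable h.one_lt ht

theorem integrable_momentum {t : ℝ} (ht : t ∈ Icc 0 T) : Integrable (fun x => ρ t x • u t x) :=
  h.sol.momentum_cont.integrable h.momentum_exponent ht

theorem continuousOn_density {g : Torus N → ℝ} (hg : AEStronglyMeasurable g volume) {C : ℝ}
    (hC : ∀ᵐ x, ‖g x‖ ≤ C) : ContinuousOn (fun t => ∫ x, ρ t x * g x) (Icc 0 T) := by
  have := h.sol.density_cont.continuousOn h.one_lt hg hC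
  simpa [mul_comm] using this

theorem continuousOn_momentum {v : Torus N → Vec N} (hv : AEStronglyMeasurable v volume) {C : ℝ}
    (hC : ∀ᵐ x, ‖v x‖ ≤ C) :
    ContinuousOn (fun t => ∫ x, inner ℝ (ρ t x • u t x) (v x)) (Icc 0 T) :=
  h.sol.momentum_cont.continuousOn h.momentum_exponent hv hC

/-- The integral of ρ(t) over each measurable set is continuous in time, so bounds valid for almost
every time pass to every time. -/
theorem slice_bounds {t : ℝ} (ht : t ∈ Icc 0 T) : ∀ᵐ x, 0 ≤ ρ t x ∧ ρ t x ≤ R := by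
  have hc : ∀ A : Set (Torus N), MeasurableSet A →
      ContinuousOn (fun t => ∫ x in A, ρ t x) (Icc 0 T) := by
    intro A hA
    have := h.continuousOn_density (g := A.indicator fun _ => (1 : ℝ))
      ((stronglyMeasurable_const.indicator hA).aestronglyMeasurable) (C := 1)
      (ae_of_all _ fun x => (norm_indicator_le_norm_self _ _).trans (by simp))
    refine this.congr fun t _ => ?_
    simp only [← integral_indicator hA]
    congr 1
    funext x
    by_cases hx : x ∈ A <;> simp [hx]
  have h1 : (fun _ => (0 : ℝ)) ≤ᵐ[volume] ρ t := by
    refine ae_le_of_forall_setIntegral_le (integrable_zero _ _ _) (h.integrable_density ht)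
      fun A hA _ => ?_
    refine le_on_Icc_of_ae_le h.T_pos continuousOn_const (hc A hA) ?_ t ht
    filter_upwards [h.ae_bound] with s hs
    rw [integral_zero]
    exact integral_nonneg_of_ae ((ae_restrict_of_ae hs).mono fun x hx => hx.1)
  have h2 : ρ t ≤ᵐ[volume] fun _ => R := by
    refine ae_le_of_forall_setIntegral_le (h.integrable_density ht) (integrable_const _)
      fun A hA _ => ?_
    refine le_on_Icc_of_ae_le h.T_pos (hc A hA) continuousOn_const ?_ t ht
    filter_upwards [h.ae_bound, ae_restrict_mem measurableSet_Ioo] with s hs hs'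
    exact integral_mono_ae (h.integrable_density (Ioo_subset_Icc_self hs')).integrableOn
      (integrable_const _) ((ae_restrict_of_ae hs).mono fun x hx => hx.2)
  filter_upwards [h1, h2] with x hx hx' using ⟨hx, hx'⟩

theorem R_nonneg : 0 ≤ R := by
  obtain ⟨x, hx⟩ := (h.slice_bounds (t := 0) ⟨le_rfl, h.T_pos.le⟩).exists
  exact hx.1.trans hx.2

theorem norm_density_le {t : ℝ} (ht : t ∈ Icc 0 T) : ∀ᵐ x, ‖ρ t x‖ ≤ R :=
  (h.slice_bounds ht).mono fun x hx => by rw [Real.norm_of_nonneg hx.1]; exact hx.2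

theorem integrable_rpow {t : ℝ} (ht : t ∈ Icc 0 T) : Integrable (fun x => ρ t x ^ γ) := by
  refine Integrable.of_bound (C := R ^ γ)
    ((h.integrable_density ht).1.aemeasurable.pow_const γ).aestronglyMeasurable ?_
  filter_upwards [h.slice_bounds ht] with x hx
  rw [Real.norm_of_nonneg (Real.rpow_nonneg hx.1 _)]
  exact Real.rpow_le_rpow hx.1 hx.2 (by linarith [h.one_lt])

theorem ae_kinetic : ∃ C : ℝ, ∀ᵐ t ∂(volume.restrict (Ioo 0 T)),
    Integrable (fun x => ρ t x * ‖u t x‖ ^ 2) ∧ ∫ x, ρ t x * ‖u t x‖ ^ 2 ≤ C := by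
  obtain ⟨C, hC, hb⟩ := h.sol.momentum_bound.ae_bound
  refine ⟨C.toReal ^ 2, ?_⟩
  filter_upwards [hb, h.ae_bound] with t ⟨h1, h2⟩ h3
  have e : (fun x => ‖Real.sqrt (ρ t x) • u t x‖ ^ 2) =ᵐ[volume]
      fun x => ρ t x * ‖u t x‖ ^ 2 := by
    filter_upwards [h3] with x hx
    rw [norm_smul, mul_pow, Real.norm_eq_abs, sq_abs, Real.sq_sqrt hx.1]
  have hi := (memLp_two_iff_integrable_sq_norm h1.1).1 h1
  refine ⟨hi.congr e, ?_⟩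
  rw [← integral_congr_ae e]
  have h4 : eLpNorm (fun x => Real.sqrt (ρ t x) • u t x) 2 volume ^ (2 : ℝ) ≤ C ^ (2 : ℝ) :=
    ENNReal.rpow_le_rpow h2 (by norm_num)
  rw [eLpNorm_eq_lintegral_rpow_enorm_toReal (by simp) (by simp), ← ENNReal.rpow_mul] at h4
  simp only [ENNReal.toReal_ofNat, one_div, ne_eq, OfNat.ofNat_ne_zero, not_false_eq_true,
    inv_mul_cancel₀, ENNReal.rpow_one] at h4
  rw [integral_eq_lintegral_of_nonneg_ae (ae_of_all _ fun x => by positivity) hi.1,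
    ← ENNReal.toReal_pow]
  refine ENNReal.toReal_mono (by simp [hC]) ?_
  rw [← ENNReal.rpow_two]
  refine le_trans (le_of_eq (lintegral_congr fun x => ?_)) h4
  rw [← ofReal_norm, ENNReal.ofReal_rpow_of_nonneg (norm_nonneg _) (by norm_num), Real.rpow_two]

theorem memLp_grad : MemLp (Function.uncurry Du) 2 (cyl N T) := h.sol.velocity_grad.memLp_two

theorem integrable_grad_sq : Integrable (fun z : ℝ × Torus N => ‖Du z.1 z.2‖ ^ 2) (cyl N T) :=
  (memLp_two_iff_integrable_sq_norm h.memLp_grad.1).1 h.memLp_grad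

theorem integrable_tr_sq : Integrable (fun z : ℝ × Torus N => tr (Du z.1 z.2) ^ 2) (cyl N T) :=
  (memLp_two_iff_integrable_sq (memLp_tr h.memLp_grad).1).1 (memLp_tr h.memLp_grad)

omit h in
theorem continuousOn_primitive {φ : ℝ → ℝ} (hT : 0 < T) (hφ : IntegrableOn φ (Ioo 0 T)) :
    ContinuousOn (fun t => ∫ s in Ioo 0 t, φ s) (Icc 0 T) := by
  have h1 : IntegrableOn φ (uIcc 0 T) := by
    rw [uIcc_of_le hT.le, integrableOn_Icc_iff_integrableOn_Ioo]; exact hφ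
  have := intervalIntegral.continuousOn_primitive_interval h1
  rw [uIcc_of_le hT.le] at this
  refine this.congr fun t ht => ?_
  simp only [intervalIntegral.integral_of_le ht.1, integral_Ioc_eq_integral_Ioo]

theorem continuousOn_dissipation : ContinuousOn (dissipation μ lam Du) (Icc 0 T) :=
  (continuousOn_const.mul (continuousOn_primitive h.T_pos h.integrable_grad_sq.integral_prod_left)).add
    (continuousOn_const.mul (continuousOn_primitive h.T_pos h.integrable_tr_sq.integral_prod_left))

theorem energy_eq {t : ℝ} (ht : t ∈ Icc 0 T) (hk : Integrable (fun x => ρ t x * ‖u t x‖ ^ 2)) :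
    energy γ (ρ t) (u t) =
      (∫ x, 1 / 2 * ρ t x * ‖u t x‖ ^ 2) + (∫ x, ρ t x ^ γ) / (γ - 1) := by
  rw [energy, integral_add, integral_div]
  · simpa [mul_assoc] using hk.const_mul (1 / 2)
  · exact (h.integrable_rpow ht).div_const _

theorem integrable_test {t : ℝ} (ht : t ∈ Icc 0 T) {v : Torus N → Vec N}
    (hv : AEStronglyMeasurable v volume) {C : ℝ} (hC : ∀ᵐ x, ‖v x‖ ≤ C) :
    Integrable (fun x => inner ℝ (ρ t x • u t x) (v x)) ∧
      Integrable (fun x => 1 / 2 * ρ t x * ‖v x‖ ^ 2) := by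
  constructor
  · refine ((h.integrable_momentum ht).norm.mul_const C).mono'
      ((h.integrable_momentum ht).1.inner hv) ?_
    filter_upwards [hC] with x hx
    exact (norm_inner_le_norm _ _).trans (by gcongr)
  · refine ((h.integrable_density ht).const_mul (1 / 2)).mul_bdd (c := C ^ 2) (hv.norm.pow 2) ?_
    filter_upwards [hC] with x hx
    rw [norm_pow, norm_norm]
    gcongr

theorem test_le_kinetic {t : ℝ} (ht : t ∈ Icc 0 T)
    (hk : Integrable (fun x => ρ t x * ‖u t x‖ ^ 2)) {v : Torus N → Vec N}
    (hv : AEStronglyMeasurable v volume) {C : ℝ} (hC : ∀ᵐ x, ‖v x‖ ≤ C) :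
    (∫ x, inner ℝ (ρ t x • u t x) (v x)) - (∫ x, 1 / 2 * ρ t x * ‖v x‖ ^ 2) ≤
      ∫ x, 1 / 2 * ρ t x * ‖u t x‖ ^ 2 := by
  obtain ⟨h1, h2⟩ := h.integrable_test ht hv hC
  rw [← integral_sub h1 h2]
  refine integral_mono_ae (h1.sub h2) (by simpa [mul_assoc] using hk.const_mul (1 / 2)) ?_
  filter_upwards [h.slice_bounds ht] with x hx
  exact inner_sub_le_kinetic hx.1 _ _

theorem continuousOn_test {v : Torus N → Vec N}
    (hv : AEStronglyMeasurable v volume) {C : ℝ} (hC : ∀ᵐ x, ‖v x‖ ≤ C) :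
    ContinuousOn (fun t => (∫ x, inner ℝ (ρ t x • u t x) (v x)) -
      (∫ x, 1 / 2 * ρ t x * ‖v x‖ ^ 2)) (Icc 0 T) := by
  refine (h.continuousOn_momentum hv hC).sub ?_
  have := h.continuousOn_density (g := fun x => 1 / 2 * ‖v x‖ ^ 2)
    ((hv.norm.pow 2).const_mul (1 / 2)) (C := 1 / 2 * C ^ 2) ?_
  · refine this.congr fun t _ => integral_congr_ae (ae_of_all _ fun x => ?_)
    show 1 / 2 * ρ t x * ‖v x‖ ^ 2 = ρ t x * (1 / 2 * ‖v x‖ ^ 2)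
    ring
  · filter_upwards [hC] with x hx
    rw [Real.norm_of_nonneg (by positivity)]
    gcongr

/-- The energy inequality holds at every time, by weak lower semicontinuity. -/
theorem energy_le {t : ℝ} (ht : t ∈ Icc 0 T) :
    Integrable (fun x => ρ t x * ‖u t x‖ ^ 2) ∧
      energy γ (ρ t) (u t) + dissipation μ lam Du t ≤ energy γ ρ₀ u₀ := by
  have hγ := h.one_lt
  have hγ1 : 0 < γ - 1 := by linarith
  obtain ⟨C, hC⟩ := h.ae_kinetic
  -- The slope of `z^γ` at ρ(t). The tangent bounds ∫ρ(s)^γ below by a functional affine in ρ(s),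
  -- hence continuous in s, with equality at s = t.
  set a : Torus N → ℝ := fun x => γ * ρ t x ^ (γ - 1) with ha
  have ham : AEStronglyMeasurable a volume :=
    (((h.integrable_density ht).1.aemeasurable.pow_const _).const_mul γ).aestronglyMeasurable
  have hab : ∀ᵐ x, ‖a x‖ ≤ γ * R ^ (γ - 1) := by
    filter_upwards [h.slice_bounds ht] with x hx
    have := Real.rpow_nonneg hx.1 (γ - 1)
    rw [Real.norm_of_nonneg (by positivity)]
    exact mul_le_mul_of_nonneg_left (Real.rpow_le_rpow hx.1 hx.2 hγ1.le) (by linarith)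
  have hai : ∀ s ∈ Icc 0 T, Integrable (fun x => ρ s x * a x) := fun s hs =>
    (h.integrable_density hs).mul_bdd ham hab
  have key := kinetic_le_of_forall_test (B := energy γ ρ₀ u₀ - dissipation μ lam Du t -
    (∫ x, ρ t x ^ γ) / (γ - 1)) (h.integrable_density ht)
    ((h.slice_bounds ht).mono fun x hx => hx.1) (h.integrable_momentum ht) ?_
  · refine ⟨key.1, ?_⟩
    rw [h.energy_eq ht key.1]
    linarith [key.2]
  · rintro v hv ⟨B, hB⟩
    have := le_on_Icc_of_ae_le h.T_pos
      (f := fun s => ((∫ x, inner ℝ (ρ s x • u s x) (v x)) - (∫ x, 1 / 2 * ρ s x * ‖v x‖ ^ 2)) +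
        ((∫ x, ρ t x ^ γ) + ((∫ x, ρ s x * a x) - ∫ x, ρ t x * a x)) / (γ - 1))
      (g := fun s => energy γ ρ₀ u₀ - dissipation μ lam Du s)
      ((h.continuousOn_test hv hB).add ((continuousOn_const.add
        ((h.continuousOn_density ham hab).sub continuousOn_const)).div_const _))
      (continuousOn_const.sub h.continuousOn_dissipation) ?_ t ht
    · simp only [sub_self, add_zero] at this
      linarith
    · filter_upwards [hC, h.sol.energy_ineq, ae_restrict_mem measurableSet_Ioo] with s hs he hs'
      have hsI := Ioo_subset_Icc_self hs'
      have h1 := h.test_le_kinetic hsI hs.1 hv hB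
      rw [h.energy_eq hsI hs.1] at he
      have h2 : (∫ x, ρ t x ^ γ) + ((∫ x, ρ s x * a x) - ∫ x, ρ t x * a x) ≤
          ∫ x, ρ s x ^ γ := by
        have hi : Integrable (fun x => ρ s x * a x - ρ t x * a x) := (hai s hsI).sub (hai t ht)
        rw [← integral_sub (hai s hsI) (hai t ht), ← integral_add (h.integrable_rpow ht) hi]
        refine integral_mono_ae ((h.integrable_rpow ht).add hi) (h.integrable_rpow hsI) ?_
        filter_upwards [h.slice_bounds ht, h.slice_bounds hsI] with x hx hx'
        have := rpow_tangent_le hγ hx.1 hx'.1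
        simp only [ha]
        linarith
      have h3 := div_le_div_of_nonneg_right h2 hγ1.le
      linarith

end Slices

end RegularSolution

end

/-! ### Space-time integrability and the equations tested between two times. -/

section

variable {N : ℕ}

/-- The momentum flux `ρu ⊗ u - 2μ∇u + (ρ^γ - λ div u) I`. -/
def stress (γ μ lam : ℝ) (ρ : ℝ → Torus N → ℝ) (u : ℝ → Torus N → Vec N)
    (Du : ℝ → Torus N → Mat N) (i j : Fin N) (z : ℝ × Torus N) : ℝ :=
  ρ z.1 z.2 * u z.1 z.2 i * u z.1 z.2 j - 2 * μ * Du z.1 z.2 (i, j) +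
    if i = j then ρ z.1 z.2 ^ γ - lam * tr (Du z.1 z.2) else 0

theorem IsTimeTest.isTest_mul {T : ℝ} {χ : ℝ → ℝ} (hχ : IsTimeTest T χ) {ψ : Torus N → ℝ}
    (hψ : IsSmooth ψ) : IsTest T (fun t x => χ t * ψ x) := by
  obtain ⟨hs, a, b, ha, hb, hab⟩ := hχ
  refine ⟨?_, a, b, ha, hb, fun t x ht => by simp [hab t ht]⟩
  exact (hs.comp contDiff_fst).mul (ContDiff.comp (g := fun y => ψ (toTorus y)) hψ contDiff_snd)

theorem integrable_mul_smooth {T : ℝ} {f : ℝ × Torus N → ℝ} (hf : Integrable f (cyl N T))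
    {ψ : Torus N → ℝ} (hψ : IsSmooth ψ) : Integrable (fun z => f z * ψ z.2) (cyl N T) := by
  obtain ⟨C, hC⟩ := hψ.exists_bound
  exact hf.mul_bdd (c := C) (hψ.continuous.comp continuous_snd).aestronglyMeasurable
    (ae_of_all _ fun z => hC _)

/-- Separated test functions χ(t)ψ(x) turn the distributional equation into a weak derivative in
time of the continuous function ∫f(t)ψ. -/
theorem sub_eq_integral_of_weak_eq {T : ℝ} (hT : 0 < T) {f F : ℝ → Torus N → ℝ} {ψ : Torus N → ℝ}
    (hψ : IsSmooth ψ) (hc : ContinuousOn (fun t => ∫ x, f t x * ψ x) (Icc 0 T))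
    (hf : Integrable (Function.uncurry f) (cyl N T))
    (hF : Integrable (Function.uncurry F) (cyl N T))
    (h : ∀ χ, IsTimeTest T χ → ∫ t in Ioo 0 T, ∫ x, (f t x * (deriv χ t * ψ x) + F t x * χ t) = 0)
    (s t : ℝ) (hs : 0 ≤ s) (hst : s ≤ t) (ht : t ≤ T) :
    (∫ x, f t x * ψ x) - (∫ x, f s x * ψ x) = ∫ τ in Ioo s t, ∫ x, F τ x := by
  refine sub_eq_integral_of_weak_deriv hT hc hF.integral_prod_left (fun χ hχ => ?_) s t hs hst ht
  refine Eq.trans (integral_congr_ae ?_) (h χ hχ)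
  filter_upwards [(integrable_mul_smooth hf hψ).prod_right_ae, hF.prod_right_ae] with t h1 h2
  have e : ∀ x, f t x * (deriv χ t * ψ x) + F t x * χ t =
      f t x * ψ x * deriv χ t + F t x * χ t := fun x => by ring
  simp only [Function.uncurry] at h1 h2 ⊢
  simp_rw [e]
  rw [integral_add (h1.mul_const _) (h2.mul_const _), integral_mul_const, integral_mul_const]

namespace RegularSolution

variable {T γ μ lam R p q : ℝ} {ρ₀ : Torus N → ℝ} {u₀ : Torus N → Vec N}
  {ρ : ℝ → Torus N → ℝ} {u : ℝ → Torus N → Vec N} {Du : ℝ → Torus N → Mat N}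
  {S : ℝ → Torus N → Vec N}

section SpaceTime

variable (h : RegularSolution T γ μ lam R p q ρ₀ u₀ ρ u Du S)
include h

theorem two_lt' : 2 < q := h.two_lt.trans_le h.le

theorem aesm_density : AEStronglyMeasurable (fun z : ℝ × Torus N => ρ z.1 z.2) (cyl N T) :=
  h.sol.density.1

theorem memLp_velocity : MemLp (fun z : ℝ × Torus N => u z.1 z.2) 2 (cyl N T) :=
  h.sol.velocity.memLp_two

theorem aesm_momentum :
    AEStronglyMeasurable (fun z : ℝ × Torus N => ρ z.1 z.2 • u z.1 z.2) (cyl N T) :=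
  h.aesm_density.smul h.memLp_velocity.1

theorem memLp_momentum : MemLp (fun z : ℝ × Torus N => ρ z.1 z.2 • u z.1 z.2) 2 (cyl N T) := by
  refine (h.memLp_velocity.const_smul R).of_le h.aesm_momentum ?_
  filter_upwards [h.bound] with z hz
  rw [norm_smul, Pi.smul_apply, norm_smul, Real.norm_of_nonneg hz.1, Real.norm_of_nonneg h.R_nonneg]
  exact mul_le_mul_of_nonneg_right hz.2 (norm_nonneg _)

theorem memLp_momentum_coord (j : Fin N) :
    MemLp (fun z : ℝ × Torus N => ρ z.1 z.2 * u z.1 z.2 j) 2 (cyl N T) := by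
  simpa using memLp_coord h.memLp_momentum j

theorem velocity_mixed :
    ∫⁻ s in Ioo 0 T, (∫⁻ x, ‖u s x‖ₑ ^ q) ^ (p / q) ≠ ⊤ := by
  have hp : 0 < p := by linarith [h.two_lt]
  have hq : 0 < q := by linarith [h.two_lt']
  have h1 := h.mixed.2
  rw [eLpNorm_lt_top_iff_lintegral_rpow_enorm_lt_top (by simpa using hp) (by simp)] at h1
  refine ne_of_lt (lt_of_eq_of_lt (lintegral_congr fun s => ?_) h1)
  rw [enorm_eq_self, eLpNorm_eq_lintegral_rpow_enorm_toReal (by simpa using hq) (by simp),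
    ENNReal.toReal_ofReal hq.le, ENNReal.toReal_ofReal hp.le, ← ENNReal.rpow_mul]
  congr 1
  field_simp

/-- Interpolation on almost every slice: ∫|ρu|² ≤ R∫ρ|u|² is bounded in time, and |ρu| ≤ R|u| brings
in the L^p(L^q) norm of u. The exponents of space and time are thereby exchanged. -/
theorem momentum_mixed :
    ∫⁻ s in Ioo 0 T, (∫⁻ x, ‖ρ s x • u s x‖ₑ ^ p) ^ (q / p) ≠ ⊤ := by
  have hp : 0 < p := by linarith [h.two_lt]
  have hq : 0 < q := by linarith [h.two_lt']
  obtain ⟨C, hC⟩ := h.ae_kinetic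
  set e := (1 - (p / q) ^ 2) * (q / p) with he
  have he0 : 0 ≤ e := by
    have : (p / q) ^ 2 ≤ 1 := pow_le_one₀ (by positivity) ((div_le_one hq).2 h.le)
    have : 0 ≤ 1 - (p / q) ^ 2 := by linarith
    positivity
  set K : ℝ≥0∞ := ENNReal.ofReal (R * C) ^ e * ENNReal.ofReal R ^ p with hK
  have hKt : K ≠ ⊤ := ENNReal.mul_ne_top (ENNReal.rpow_ne_top_of_nonneg he0 (by simp))
    (ENNReal.rpow_ne_top_of_nonneg hp.le (by simp))
  have hle : ∀ᵐ s ∂(volume.restrict (Ioo 0 T)), (∫⁻ x, ‖ρ s x • u s x‖ₑ ^ p) ^ (q / p) ≤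
      K * (∫⁻ x, ‖u s x‖ₑ ^ q) ^ (p / q) := by
    filter_upwards [hC, h.ae_bound, h.aesm_momentum.prodMk_left] with s hs hb hm
    refine (lintegral_rpow_interpolation h.two_lt h.two_lt' h.line h.le hm.enorm).trans ?_
    rw [hK, mul_assoc]
    gcongr
    · calc ∫⁻ x, ‖ρ s x • u s x‖ₑ ^ (2 : ℝ)
          ≤ ∫⁻ x, ENNReal.ofReal (R * (ρ s x * ‖u s x‖ ^ 2)) := by
            refine lintegral_mono_ae ?_
            filter_upwards [hb] with x hx
            rw [← ofReal_norm, ENNReal.ofReal_rpow_of_nonneg (norm_nonneg _) (by norm_num)]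
            apply ENNReal.ofReal_le_ofReal
            rw [Real.rpow_two, norm_smul, Real.norm_of_nonneg hx.1, mul_pow, sq, mul_assoc]
            have := hx.1
            gcongr
            exact hx.2
        _ = ENNReal.ofReal (∫ x, R * (ρ s x * ‖u s x‖ ^ 2)) := by
            rw [ofReal_integral_eq_lintegral_ofReal (hs.1.const_mul R)]
            filter_upwards [hb] with x hx
            have := hx.1
            have := h.R_nonneg
            show 0 ≤ R * (ρ s x * ‖u s x‖ ^ 2)
            positivity
        _ ≤ ENNReal.ofReal (R * C) := by
            rw [integral_const_mul]
            exact ENNReal.ofReal_le_ofReal (mul_le_mul_of_nonneg_left hs.2 h.R_nonneg)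
    · have h1 : ∫⁻ x, ‖ρ s x • u s x‖ₑ ^ q ≤ ENNReal.ofReal R ^ q * ∫⁻ x, ‖u s x‖ₑ ^ q := by
        rw [← lintegral_const_mul' _ _ (ENNReal.rpow_ne_top_of_nonneg hq.le (by simp))]
        refine lintegral_mono_ae ?_
        filter_upwards [hb] with x hx
        rw [enorm_smul, ENNReal.mul_rpow_of_nonneg _ _ hq.le, Real.enorm_of_nonneg hx.1]
        gcongr
        exact hx.2
      refine (ENNReal.rpow_le_rpow h1 (by positivity)).trans (le_of_eq ?_)
      rw [ENNReal.mul_rpow_of_nonneg _ _ (by positivity), ← ENNReal.rpow_mul,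
        mul_div_cancel₀ _ hq.ne']
  refine ne_of_lt ((lintegral_mono_ae hle).trans_lt ?_)
  rw [lintegral_const_mul' _ _ hKt]
  exact ENNReal.mul_lt_top hKt.lt_top h.velocity_mixed.lt_top

/-- The mixed Hölder inequality pairs ρu ∈ L^qL^p with u ∈ L^pL^q. Square integrability makes the
product with ∇u integrable. -/
theorem memLp_convection (i j : Fin N) :
    MemLp (fun z : ℝ × Torus N => ρ z.1 z.2 * u z.1 z.2 i * u z.1 z.2 j) 2 (cyl N T) := by
  have hA := h.aesm_momentum.enorm
  have hB := h.memLp_velocity.1.enorm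
  refine ⟨(h.memLp_momentum_coord i).1.mul (memLp_coord h.memLp_velocity j).1, ?_⟩
  rw [eLpNorm_lt_top_iff_lintegral_rpow_enorm_lt_top (by simp) (by simp), ENNReal.toReal_ofNat]
  have := lintegral_mul_sq_le_mixed h.two_lt h.two_lt' h.line hA hB
  refine lt_of_le_of_lt (lintegral_mono fun z => ?_) (this.trans_lt ?_)
  · rw [enorm_mul]
    gcongr
    · rw [enorm_le_iff_norm_le]
      simpa using PiLp.norm_apply_le (ρ z.1 z.2 • u z.1 z.2) i
    · rw [enorm_le_iff_norm_le]
      exact PiLp.norm_apply_le _ _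
  · have hp : 0 < p := by linarith [h.two_lt]
    have hq : 0 < q := by linarith [h.two_lt']
    exact ENNReal.mul_lt_top (ENNReal.rpow_lt_top_of_nonneg (by positivity) h.momentum_mixed)
      (ENNReal.rpow_lt_top_of_nonneg (by positivity) h.velocity_mixed)

theorem memLp_rpow (r : ℝ≥0∞) : MemLp (fun z : ℝ × Torus N => ρ z.1 z.2 ^ γ) r (cyl N T) := by
  refine MemLp.of_bound (h.aesm_density.aemeasurable.pow_const γ).aestronglyMeasurable (R ^ γ) ?_
  filter_upwards [h.bound] with z hz
  rw [Real.norm_of_nonneg (Real.rpow_nonneg hz.1 _)]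
  exact Real.rpow_le_rpow hz.1 hz.2 (by linarith [h.one_lt])

theorem memLp_grad_tr : MemLp (fun z : ℝ × Torus N => tr (Du z.1 z.2)) 2 (cyl N T) :=
  memLp_tr h.memLp_grad

theorem memLp_grad_coord (i j : Fin N) :
    MemLp (fun z : ℝ × Torus N => Du z.1 z.2 (i, j)) 2 (cyl N T) :=
  memLp_coord h.memLp_grad (i, j)

theorem memLp_stress (i j : Fin N) : MemLp (stress γ μ lam ρ u Du i j) 2 (cyl N T) := by
  refine ((h.memLp_convection i j).sub ((h.memLp_grad_coord i j).const_mul (2 * μ))).add ?_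
  by_cases hij : i = j
  · simp only [hij, if_true]
    exact (h.memLp_rpow 2).sub (h.memLp_grad_tr.const_mul lam)
  · simp [hij]

theorem mass_tested {ψ : Torus N → ℝ} (hψ : IsSmooth ψ) {s t : ℝ} (hs : 0 ≤ s) (hst : s ≤ t)
    (ht : t ≤ T) :
    (∫ x, ρ t x * ψ x) - (∫ x, ρ s x * ψ x) =
      ∫ τ in Ioo s t, ∫ x, ∑ j, ρ τ x * u τ x j * pderiv j ψ x := by
  obtain ⟨C, hC⟩ := hψ.exists_bound
  refine sub_eq_integral_of_weak_eq h.T_pos hψ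
    (h.continuousOn_density hψ.continuous.aestronglyMeasurable (ae_of_all _ hC)) ?_ ?_ ?_ s t hs hst ht
  · refine Integrable.of_bound (C := R) h.aesm_density ?_
    filter_upwards [h.bound] with z hz
    simp only [Function.uncurry]
    rw [Real.norm_of_nonneg hz.1]; exact hz.2
  · exact integrable_finsetSum _ fun j _ => integrable_mul_smooth
      ((h.memLp_momentum_coord j).integrable (by norm_num)) (hψ.pderiv j)
  · intro χ hχ
    refine Eq.trans (integral_congr_ae (ae_of_all _ fun t => integral_congr_ae
      (ae_of_all _ fun x => ?_))) (h.sol.continuity _ (hχ.isTest_mul hψ))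
    simp only [deriv_mul_const_field, pderiv_const_mul, Finset.sum_mul]
    congr 1
    exact Finset.sum_congr rfl fun j _ => by ring

theorem momentum_tested (i : Fin N) {ψ : Torus N → ℝ} (hψ : IsSmooth ψ) {s t : ℝ} (hs : 0 ≤ s)
    (hst : s ≤ t) (ht : t ≤ T) :
    (∫ x, ρ t x * u t x i * ψ x) - (∫ x, ρ s x * u s x i * ψ x) =
      ∫ τ in Ioo s t, ∫ x, ∑ j, stress γ μ lam ρ u Du i j (τ, x) * pderiv j ψ x := by
  obtain ⟨C, hC⟩ := hψ.exists_bound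
  refine sub_eq_integral_of_weak_eq (f := fun t x => ρ t x * u t x i) h.T_pos hψ ?_ ?_ ?_ ?_
    s t hs hst ht
  · have := h.continuousOn_momentum (v := fun x => EuclideanSpace.single i (ψ x)) (C := C) ?_ ?_
    · refine this.congr fun t _ => integral_congr_ae (ae_of_all _ fun x => ?_)
      simp [EuclideanSpace.inner_single_right, mul_comm]
    · have : Continuous fun x => EuclideanSpace.single i (ψ x) := by
        have e : (fun x => EuclideanSpace.single i (ψ x)) =
            fun x => ψ x • EuclideanSpace.single i (1 : ℝ) := by
          funext x; ext k; simp
        rw [e]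
        exact hψ.continuous.smul continuous_const
      exact this.aestronglyMeasurable
    · exact ae_of_all _ fun x => by simpa using hC x
  · exact (h.memLp_momentum_coord i).integrable (by norm_num)
  · exact integrable_finsetSum _ fun j _ => integrable_mul_smooth
      ((h.memLp_stress i j).integrable (by norm_num)) (hψ.pderiv j)
  · intro χ hχ
    refine Eq.trans (integral_congr_ae (ae_of_all _ fun t => integral_congr_ae
      (ae_of_all _ fun x => ?_))) (h.sol.momentum i _ (hχ.isTest_mul hψ))
    simp only [deriv_mul_const_field, pderiv_const_mul, Finset.sum_mul, stress, add_mul, sub_mul,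
      Finset.sum_add_distrib, Finset.sum_sub_distrib, ite_mul, zero_mul, Finset.sum_ite_eq,
      Finset.mem_univ, if_true, Finset.mul_sum]
    have e1 : ∀ j, ρ t x * u t x i * u t x j * (χ t * pderiv j ψ x) =
      ρ t x * u t x i * u t x j * pderiv j ψ x * χ t := fun j => by ring
    have e2 : ∀ j, 2 * μ * (Du t x (i, j) * (χ t * pderiv j ψ x)) =
      2 * μ * Du t x (i, j) * pderiv j ψ x * χ t := fun j => by ring
    simp_rw [e1, e2]
    ring

end SpaceTime

end RegularSolution

end

/-! ### Continuity in time of the density and the balance of the internal energy. -/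

section

variable {N : ℕ}

theorem exists_renormalization {γ : ℝ} (hγ : 1 < γ) (R : ℝ) :
    ∃ b : ℝ → ℝ, ContDiff ℝ 1 b ∧ (∃ M : ℝ, ∀ z, M ≤ |z| → deriv b z = 0) ∧
      ∀ z, 0 ≤ z → z ≤ R → b z = z ^ γ ∧ deriv b z * z - b z = (γ - 1) * z ^ γ := by
  -- The derivative of the renormalization: γz^(γ-1) on [0,R], cut off linearly to 0 on [R,R+1], and
  -- 0 for z ≤ 0 since γ - 1 > 0.
  let d : ℝ → ℝ := fun z => γ * (max z 0) ^ (γ - 1) * max 0 (min 1 (R + 1 - z))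
  have hd : Continuous d := by
    have h1 : Continuous fun z : ℝ => (max z 0) ^ (γ - 1) :=
      (continuous_id.max continuous_const).rpow_const fun _ => Or.inr (by linarith)
    fun_prop
  have hd0 : ∀ z, 0 ≤ z → z ≤ R → d z = γ * z ^ (γ - 1) := by
    intro z h0 h1
    simp only [d]
    rw [max_eq_left h0, min_eq_left (by linarith), max_eq_right zero_le_one, mul_one]
  have hderiv : deriv (fun z => ∫ x in (0 : ℝ)..z, d x) = d := by
    funext t; exact hd.deriv_integral d 0 t
  have hb : ∀ z, 0 ≤ z → z ≤ R → ∫ x in (0 : ℝ)..z, d x = z ^ γ := by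
    intro z h0 h1
    have e : ∫ x in (0 : ℝ)..z, d x = ∫ x in (0 : ℝ)..z, γ * x ^ (γ - 1) := by
      refine intervalIntegral.integral_congr fun x hx => ?_
      rw [uIcc_of_le h0] at hx
      exact hd0 x hx.1 (hx.2.trans h1)
    rw [e, intervalIntegral.integral_const_mul, integral_rpow (Or.inl (by linarith)),
      sub_add_cancel, Real.zero_rpow (by linarith), sub_zero]
    field_simp
  refine ⟨fun z => ∫ x in (0 : ℝ)..z, d x, ?_, ⟨R + 1, fun z hz => ?_⟩, fun z h0 h1 => ⟨hb z h0 h1, ?_⟩⟩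
  · rw [contDiff_one_iff_deriv, hderiv]
    exact ⟨fun t => (intervalIntegral.integral_hasDerivAt_right (hd.intervalIntegrable _ _)
      (hd.stronglyMeasurableAtFilter _ _) hd.continuousAt).differentiableAt, hd⟩
  · rw [hderiv]
    simp only [d]
    rcases le_total 0 z with h | h
    · rw [abs_of_nonneg h] at hz
      rw [max_eq_left ((min_le_right _ _).trans (by linarith)), mul_zero]
    · rw [max_eq_right h, Real.zero_rpow (by linarith)]; simp
  · rw [hderiv]
    beta_reduce
    rw [hb z h0 h1, hd0 z h0 h1, mul_assoc, ← Real.rpow_add_one' h0 (by linarith),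
      sub_add_cancel]
    ring

theorem abs_rpow_sub_le {γ R a b : ℝ} (hγ : 1 < γ) (ha : 0 ≤ a) (hb : 0 ≤ b) (haR : a ≤ R)
    (hbR : b ≤ R) : |b ^ γ - a ^ γ| ≤ γ * R ^ (γ - 1) * |b - a| := by
  have h1 := rpow_tangent_le hγ ha hb
  have h2 := rpow_tangent_le hγ hb ha
  have h3 := Real.rpow_le_rpow ha haR (by linarith : 0 ≤ γ - 1)
  have h4 := Real.rpow_le_rpow hb hbR (by linarith : 0 ≤ γ - 1)
  have h5 := Real.rpow_nonneg ha (γ - 1)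
  have h6 := Real.rpow_nonneg hb (γ - 1)
  have b1 : |γ * a ^ (γ - 1) * (b - a)| ≤ γ * R ^ (γ - 1) * |b - a| := by
    rw [abs_mul, abs_of_nonneg (by positivity)]
    gcongr
  have b2 : |γ * b ^ (γ - 1) * (a - b)| ≤ γ * R ^ (γ - 1) * |b - a| := by
    rw [abs_mul, abs_of_nonneg (by positivity), abs_sub_comm a b]
    gcongr
  rw [abs_le] at b1 b2 ⊢
  constructor <;> linarith

theorem tendsto_eLpNorm_bdd_mul {α ι : Type*} [MeasurableSpace α] {μ : Measure α} {l : Filter ι}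
    {d f : α → ℝ} {F : ι → α → ℝ} {C : ℝ} (hd : ∀ᵐ x ∂μ, ‖d x‖ ≤ C) {p : ℝ≥0∞}
    (hF : Tendsto (fun n => eLpNorm (F n - f) p μ) l (𝓝 0)) :
    Tendsto (fun n => eLpNorm ((fun x => d x * F n x) - fun x => d x * f x) p μ) l (𝓝 0) := by
  have h1 := ENNReal.Tendsto.const_mul (a := ENNReal.ofReal C) hF (Or.inr (by simp))
  rw [mul_zero] at h1
  refine tendsto_of_tendsto_of_tendsto_of_le_of_le tendsto_const_nhds h1 (fun _ => zero_le)
    fun n => ?_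
  refine eLpNorm_le_mul_eLpNorm_of_ae_le_mul ?_ p
  filter_upwards [hd] with x hx
  simp only [Pi.sub_apply]
  rw [← mul_sub, norm_mul]
  gcongr

theorem memLp_bdd_mul {α : Type*} [MeasurableSpace α] {μ : Measure α} {d f : α → ℝ} {C : ℝ}
    {p : ℝ≥0∞} (hf : MemLp f p μ) (hd : AEStronglyMeasurable d μ) (hC : ∀ᵐ x ∂μ, ‖d x‖ ≤ C) :
    MemLp (fun x => d x * f x) p μ := by
  refine hf.of_le_mul (c := C) (hd.mul hf.1) ?_
  filter_upwards [hC] with x hx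
  rw [norm_mul]
  gcongr

theorem sq_integral_abs_le {f : Torus N → ℝ} (hf : MemLp f 2 volume) :
    (∫ x, |f x|) ^ 2 ≤ ∫ x, f x ^ 2 := by
  have h1 : Integrable (fun x => |f x|) := (hf.integrable (by norm_num)).abs
  have h2 : Integrable (fun x => f x ^ 2) := (memLp_two_iff_integrable_sq hf.1).1 hf
  set c := ∫ x, |f x| with hc
  have h3 : 0 ≤ ∫ x, (|f x| - c) ^ 2 := integral_nonneg fun x => sq_nonneg _
  have e : ∀ x, (|f x| - c) ^ 2 = f x ^ 2 - 2 * c * |f x| + c ^ 2 := fun x => by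
    rw [sub_sq, sq_abs]; ring
  simp_rw [e] at h3
  have h4 : Integrable (fun x => f x ^ 2 - 2 * c * |f x|) := h2.sub (h1.const_mul _)
  rw [integral_add h4 (integrable_const _), integral_sub h2 (h1.const_mul _), integral_const_mul,
    ← hc] at h3
  simp at h3
  nlinarith

theorem memLp_two_of_isSmooth {φ : Torus N → ℝ} (h : IsSmooth φ) : MemLp φ 2 volume := by
  obtain ⟨C, hC⟩ := h.exists_bound
  exact MemLp.of_bound h.continuous.aestronglyMeasurable C (ae_of_all _ hC)

theorem tendsto_conv_kernel_two {f : Torus N → ℝ} (hf : MemLp f 2 volume) :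
    Tendsto (fun n => eLpNorm (conv (kernel n) f - f) 2 volume) atTop (𝓝 0) := by
  have := tendsto_eLpNorm_conv_kernel_sub (q := 2) (by norm_num) (by simpa using hf)
  simpa using this

namespace RegularSolution

variable {T γ μ lam R p q : ℝ} {ρ₀ : Torus N → ℝ} {u₀ : Torus N → Vec N}
  {ρ : ℝ → Torus N → ℝ} {u : ℝ → Torus N → Vec N} {Du : ℝ → Torus N → Mat N}
  {S : ℝ → Torus N → Vec N}

section Density

variable (h : RegularSolution T γ μ lam R p q ρ₀ u₀ ρ u Du S)
include h

theorem memLp_density_sub {s t : ℝ} (hs : s ∈ Icc 0 T) (ht : t ∈ Icc 0 T) :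
    AEStronglyMeasurable (fun x => ρ t x - ρ s x) volume ∧ ∀ᵐ x, ‖ρ t x - ρ s x‖ ≤ R := by
  refine ⟨(h.integrable_density ht).1.sub (h.integrable_density hs).1, ?_⟩
  filter_upwards [h.slice_bounds hs, h.slice_bounds ht] with x h1 h2
  rw [Real.norm_eq_abs, abs_le]
  constructor <;> linarith [h1.1, h1.2, h2.1, h2.2]

/-- The flux satisfies |ρuⱼ∂ⱼψ| ≤ (ρuⱼ)² + (∂ⱼψ)² with (ρuⱼ)² ≤ Rρ|u|², which has bounded integral
for almost every time. -/
theorem mass_tested_bound : ∃ C : ℝ, 0 ≤ C ∧ ∀ ψ : Torus N → ℝ, IsSmooth ψ → ∀ s t, 0 ≤ s →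
    s ≤ t → t ≤ T → (∫ x, (ρ t x - ρ s x) * ψ x) ≤
      (t - s) * ∑ j, (C + ∫ x, pderiv j ψ x ^ 2) := by
  obtain ⟨C, hC⟩ := h.ae_kinetic
  refine ⟨R * |C|, mul_nonneg h.R_nonneg (abs_nonneg _), fun ψ hψ s t hs hst ht => ?_⟩
  have hsI : s ∈ Icc 0 T := ⟨hs, hst.trans ht⟩
  have htI : t ∈ Icc 0 T := ⟨hs.trans hst, ht⟩
  obtain ⟨B, hB⟩ := hψ.exists_bound
  have hi : ∀ r ∈ Icc 0 T, Integrable (fun x => ρ r x * ψ x) := fun r hr =>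
    (h.integrable_density hr).mul_bdd hψ.continuous.aestronglyMeasurable (ae_of_all _ hB)
  simp_rw [fun x => sub_mul (ρ t x) (ρ s x) (ψ x)]
  rw [integral_sub (hi t htI) (hi s hsI), h.mass_tested hψ hs hst ht]
  refine (le_abs_self _).trans ?_
  have := norm_setIntegral_le_of_norm_le_const_ae' (μ := volume) (s := Ioo s t)
    (f := fun τ => ∫ x, ∑ j, ρ τ x * u τ x j * pderiv j ψ x)
    (C := ∑ j, (R * |C| + ∫ x, pderiv j ψ x ^ 2)) (by simp) ?_
  · rw [mul_comm (t - s)]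
    simpa [hst] using this
  have hsub : Ioo s t ⊆ Ioo 0 T := Ioo_subset_Ioo hs ht
  rw [← ae_restrict_iff' measurableSet_Ioo]
  have hC' := ae_restrict_of_ae_restrict_of_subset hsub hC
  have hb' := ae_restrict_of_ae_restrict_of_subset hsub h.ae_bound
  have hm' := ae_restrict_of_ae_restrict_of_subset hsub
    (h.aesm_momentum.prodMk_left)
  filter_upwards [hC', hb', hm'] with τ hk hb hm
  have hsq : ∀ᵐ x, ‖ρ τ x • u τ x‖ ^ 2 ≤ R * (ρ τ x * ‖u τ x‖ ^ 2) := by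
    filter_upwards [hb] with x hx
    rw [norm_smul, Real.norm_of_nonneg hx.1, mul_pow, sq, mul_assoc]
    have := hx.1
    gcongr
    exact hx.2
  have hL2 : MemLp (fun x => ρ τ x • u τ x) 2 volume := by
    rw [memLp_two_iff_integrable_sq_norm hm]
    refine (hk.1.const_mul R).mono' (hm.norm.pow 2) ?_
    filter_upwards [hsq] with x hx
    rwa [norm_pow, norm_norm]
  have hj : ∀ j, MemLp (fun x => ρ τ x * u τ x j) 2 volume := fun j => by
    simpa using memLp_coord hL2 j
  have hψj : ∀ j, MemLp (pderiv j ψ) 2 volume := fun j => memLp_two_of_isSmooth (hψ.pderiv j)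
  have hprod : ∀ j, Integrable (fun x => ρ τ x * u τ x j * pderiv j ψ x) := fun j =>
    (hj j).integrable_mul (hψj j)
  rw [integral_finsetSum _ fun j _ => hprod j]
  refine (norm_sum_le _ _).trans (Finset.sum_le_sum fun j _ => ?_)
  have i1 := (memLp_two_iff_integrable_sq (hj j).1).1 (hj j)
  have i2 := (memLp_two_iff_integrable_sq (hψj j).1).1 (hψj j)
  refine (norm_integral_le_integral_norm _).trans ?_
  calc ∫ x, ‖ρ τ x * u τ x j * pderiv j ψ x‖
      ≤ ∫ x, ((ρ τ x * u τ x j) ^ 2 + pderiv j ψ x ^ 2) := by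
        refine integral_mono (hprod j).norm (i1.add i2) fun x => ?_
        show ‖ρ τ x * u τ x j * pderiv j ψ x‖ ≤ (ρ τ x * u τ x j) ^ 2 + pderiv j ψ x ^ 2
        rw [Real.norm_eq_abs, abs_le]
        constructor
        · nlinarith [sq_nonneg (ρ τ x * u τ x j + pderiv j ψ x)]
        · nlinarith [sq_nonneg (ρ τ x * u τ x j - pderiv j ψ x)]
    _ = (∫ x, (ρ τ x * u τ x j) ^ 2) + ∫ x, pderiv j ψ x ^ 2 := integral_add i1 i2
    _ ≤ R * |C| + ∫ x, pderiv j ψ x ^ 2 := by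
        gcongr
        calc ∫ x, (ρ τ x * u τ x j) ^ 2 ≤ ∫ x, R * (ρ τ x * ‖u τ x‖ ^ 2) := by
              refine integral_mono_ae i1 (hk.1.const_mul R) ?_
              filter_upwards [hsq] with x hx
              refine le_trans ?_ hx
              have h1 := PiLp.norm_apply_le (ρ τ x • u τ x) j
              have h2 : (ρ τ x * u τ x j) ^ 2 = ‖(ρ τ x • u τ x) j‖ ^ 2 := by
                rw [Real.norm_eq_abs, sq_abs]; simp
              rw [h2]
              gcongr
          _ = R * ∫ x, ρ τ x * ‖u τ x‖ ^ 2 := integral_const_mul _ _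
          _ ≤ R * |C| := mul_le_mul_of_nonneg_left (hk.2.trans (le_abs_self C)) h.R_nonneg

/-- Formally the continuity equation is tested with ρ(t) - ρ(s), whose gradient is in L² because ∇ρ
= 2√ρ∇√ρ. The rigorous test function is the difference of the squares of the mollified roots √ρ(t)
and √ρ(s), so only the weak gradient of √ρ is needed. -/
theorem density_lipschitz_ae : ∃ L : ℝ, 0 ≤ L ∧ ∀ᵐ s ∂(volume.restrict (Ioo 0 T)),
    ∀ᵐ t ∂(volume.restrict (Ioo 0 T)), ∫ x, (ρ t x - ρ s x) ^ 2 ≤ L * |t - s| := by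
  obtain ⟨C, hC0, hC⟩ := h.mass_tested_bound
  obtain ⟨D, hD, hDb⟩ := h.sqrt_mem.ae_bound
  have hR := h.R_nonneg
  have hgood : ∀ᵐ s ∂(volume.restrict (Ioo 0 T)), s ∈ Ioo 0 T ∧ MemLp (S s) 2 volume ∧
      (∀ j, ∫ x, S s x j ^ 2 ≤ D.toReal ^ 2) ∧
      ∀ j : Fin N, HasWeakPartial j (fun x => Real.sqrt (ρ s x)) (fun x => S s x j) := by
    filter_upwards [hDb, h.sqrt_grad, ae_restrict_mem measurableSet_Ioo] with s h1 h2 h3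
    refine ⟨h3, h1.1, fun j => ?_, h2⟩
    have h4 := memLp_coord h1.1 j
    have h5 : eLpNorm (fun x => S s x j) 2 volume ≤ D :=
      (eLpNorm_mono fun x => PiLp.norm_apply_le (S s x) j).trans h1.2
    have h6 := ENNReal.toReal_mono hD h5
    rw [h4.eLpNorm_eq_integral_rpow_norm (by simp) (by simp), ENNReal.toReal_ofReal (by positivity)]
      at h6
    have h7 := pow_le_pow_left₀ (by positivity) h6 2
    rw [← Real.rpow_natCast, ← Real.rpow_mul (by positivity)] at h7
    simpa using h7
  refine ⟨∑ j : Fin N, (C + 8 * R * (D.toReal ^ 2 + D.toReal ^ 2)), Finset.sum_nonneg fun j _ => by positivity, ?_⟩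
  have main : ∀ s t, s ≤ t → (s ∈ Ioo 0 T ∧ MemLp (S s) 2 volume ∧
      (∀ j, ∫ x, S s x j ^ 2 ≤ D.toReal ^ 2) ∧
      ∀ j : Fin N, HasWeakPartial j (fun x => Real.sqrt (ρ s x)) (fun x => S s x j)) →
      (t ∈ Ioo 0 T ∧ MemLp (S t) 2 volume ∧ (∀ j, ∫ x, S t x j ^ 2 ≤ D.toReal ^ 2) ∧
      ∀ j : Fin N, HasWeakPartial j (fun x => Real.sqrt (ρ t x)) (fun x => S t x j)) →
      ∫ x, (ρ t x - ρ s x) ^ 2 ≤ (t - s) * ∑ j : Fin N, (C + 8 * R * (D.toReal ^ 2 + D.toReal ^ 2)) := by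
    rintro s t hst ⟨hs, hSs, hSs2, hws⟩ ⟨ht, hSt, hSt2, hwt⟩
    have hsI := Ioo_subset_Icc_self hs
    have htI := Ioo_subset_Icc_self ht
    obtain ⟨hdm, hdb⟩ := h.memLp_density_sub hsI htI
    have hroot : ∀ r ∈ Icc 0 T, MemLp (fun x => Real.sqrt (ρ r x)) 2 volume ∧
        (∀ᵐ x, |Real.sqrt (ρ r x)| ≤ Real.sqrt R) := by
      intro r hr
      have hb : ∀ᵐ x, |Real.sqrt (ρ r x)| ≤ Real.sqrt R := by
        filter_upwards [h.slice_bounds hr] with x hx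
        rw [abs_of_nonneg (Real.sqrt_nonneg _)]
        exact Real.sqrt_le_sqrt hx.2
      exact ⟨MemLp.of_bound (Real.continuous_sqrt.comp_aestronglyMeasurable
        (h.integrable_density hr).1) _ hb, hb⟩
    have hκ : ∀ n, IsSmooth (kernel n : Torus N → ℝ) := isSmooth_kernel
    let f : ℕ → ℝ → Torus N → ℝ := fun n r => conv (kernel n) (fun x => Real.sqrt (ρ r x))
    have hfs : ∀ n, ∀ r ∈ Icc 0 T, IsSmooth (f n r) := fun n r hr =>
      isSmooth_conv (hκ n) ((hroot r hr).1.integrable (by norm_num))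
    have hfb : ∀ n, ∀ r ∈ Icc 0 T, ∀ x, f n r x ^ 2 ≤ R := fun n r hr x => by
      have := abs_conv_le (hκ n).continuous (kernel_nonneg n) (integral_kernel n) (hroot r hr).2 x
      rw [← sq_abs, ← Real.sq_sqrt hR]
      exact pow_le_pow_left₀ (abs_nonneg _) this 2
    -- convergence of the squares
    have hsq : ∀ r ∈ Icc 0 T, Tendsto (fun n => ∫ x, (ρ t x - ρ s x) * f n r x ^ 2) atTop
        (𝓝 (∫ x, (ρ t x - ρ s x) * ρ r x)) := by
      intro r hr
      have h1 := tendsto_conv_kernel_two (hroot r hr).1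
      have h2 := tendsto_integral_mul_of_tendsto_L2 (μ := (volume : Measure (Torus N)))
        (F := fun n x => (ρ t x - ρ s x) * f n r x) (G := fun n => f n r)
        (memLp_bdd_mul (hroot r hr).1 hdm hdb) (hroot r hr).1
        (fun n => memLp_bdd_mul (memLp_two_of_isSmooth (hfs n r hr)) hdm hdb)
        (fun n => memLp_two_of_isSmooth (hfs n r hr)) (tendsto_eLpNorm_bdd_mul hdb h1) h1
      have e : ∫ x, (ρ t x - ρ s x) * ρ r x =
          ∫ x, (ρ t x - ρ s x) * Real.sqrt (ρ r x) * Real.sqrt (ρ r x) := by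
        refine integral_congr_ae ?_
        filter_upwards [h.slice_bounds hr] with x hx
        rw [mul_assoc, Real.mul_self_sqrt hx.1]
      rw [e]
      refine h2.congr fun n => integral_congr_ae (ae_of_all _ fun x => ?_)
      show (ρ t x - ρ s x) * f n r x * f n r x = (ρ t x - ρ s x) * f n r x ^ 2
      ring
    -- convergence of the gradients
    have hgr : ∀ r, MemLp (S r) 2 volume →
        (∀ j : Fin N, HasWeakPartial j (fun x => Real.sqrt (ρ r x)) (fun x => S r x j)) →
        ∀ j, Tendsto (fun n => ∫ x, pderiv j (f n r) x ^ 2) atTop (𝓝 (∫ x, S r x j ^ 2)) := by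
      intro r hr hw j
      have h1 := memLp_coord hr j
      have h2 := tendsto_conv_kernel_two h1
      have hm : ∀ n, MemLp (conv (kernel n) fun x => S r x j) 2 volume := fun n =>
        memLp_two_of_isSmooth (isSmooth_conv (hκ n) (h1.integrable (by norm_num)))
      have h3 := tendsto_integral_mul_of_tendsto_L2 h1 h1 hm hm h2 h2
      simp only [← sq] at h3
      refine h3.congr fun n => ?_
      rw [show pderiv j (f n r) = _ from pderiv_conv_of_weak (hκ n) (hw j)]
    have hlim1 := (hsq t htI).sub (hsq s hsI)
    have hlim2 : Tendsto (fun n => (t - s) * ∑ j, (C + 8 * R * ((∫ x, pderiv j (f n t) x ^ 2) +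
        ∫ x, pderiv j (f n s) x ^ 2))) atTop (𝓝 ((t - s) * ∑ j, (C + 8 * R * ((∫ x, S t x j ^ 2) +
        ∫ x, S s x j ^ 2)))) :=
      (tendsto_finsetSum _ fun j _ => (((hgr t hSt hwt j).add (hgr s hSs hws j)).const_mul
        (8 * R)).const_add C).const_mul (t - s)
    have hle := le_of_tendsto_of_tendsto' hlim1 hlim2 fun n => ?_
    · have hi : ∀ r ∈ Icc 0 T, Integrable (fun x => (ρ t x - ρ s x) * ρ r x) := fun r hr =>
        (h.integrable_density hr).bdd_mul hdm hdb
      rw [← integral_sub (hi t htI) (hi s hsI)] at hle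
      have e : ∀ x, (ρ t x - ρ s x) ^ 2 = (ρ t x - ρ s x) * ρ t x - (ρ t x - ρ s x) * ρ s x :=
        fun x => by ring
      simp_rw [e]
      refine hle.trans ?_
      have : 0 ≤ t - s := by linarith
      gcongr with j _
      · exact hSt2 j
      · exact hSs2 j
    · have hst' := hfs n t htI
      have hss' := hfs n s hsI
      have hψ : IsSmooth (fun x => f n t x ^ 2 - f n s x ^ 2) := (hst'.pow 2).sub (hss'.pow 2)
      have hb := hC _ hψ s t hs.1.le hst ht.2.le
      have hi : ∀ r ∈ Icc 0 T, Integrable (fun x => (ρ t x - ρ s x) * f n r x ^ 2) := fun r hr =>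
        (integrable_of_isSmooth ((hfs n r hr).pow 2)).bdd_mul hdm hdb
      rw [← integral_sub (hi t htI) (hi s hsI)]
      simp_rw [mul_sub] at hb
      refine hb.trans ?_
      have : 0 ≤ t - s := by linarith
      gcongr with j _
      have i1 : Integrable (fun x => pderiv j (f n t) x ^ 2) :=
        integrable_of_isSmooth ((hst'.pderiv j).pow 2)
      have i2 : Integrable (fun x => pderiv j (f n s) x ^ 2) :=
        integrable_of_isSmooth ((hss'.pderiv j).pow 2)
      rw [← integral_add i1 i2, ← integral_const_mul]
      refine integral_mono (integrable_of_isSmooth ((hψ.pderiv j).pow 2))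
        ((i1.add i2).const_mul _) fun x => ?_
      simp only
      rw [pderiv_sub (hst'.pow 2) (hss'.pow 2), pderiv_sq hst', pderiv_sq hss']
      have b1 := hfb n t htI x
      have b2 := hfb n s hsI x
      have c1 := mul_le_mul_of_nonneg_right b1 (sq_nonneg (pderiv j (f n t) x))
      have c2 := mul_le_mul_of_nonneg_right b2 (sq_nonneg (pderiv j (f n s) x))
      -- The constant 8R: (2a - 2b)² ≤ 8a² + 8b² with a, b of the form f∂ⱼf, and f² ≤ R.
      nlinarith [sq_nonneg (f n t x * pderiv j (f n t) x + f n s x * pderiv j (f n s) x)]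
  filter_upwards [hgood] with s hs
  filter_upwards [hgood] with t ht
  rcases le_total s t with hst | hst
  · rw [abs_of_nonneg (by linarith), mul_comm]
    exact main s t hst hs ht
  · rw [abs_of_nonpos (by linarith), mul_comm, neg_sub]
    refine le_trans (le_of_eq (integral_congr_ae (ae_of_all _ fun x => ?_))) (main t s hst ht hs)
    show (ρ t x - ρ s x) ^ 2 = (ρ s x - ρ t x) ^ 2
    ring

/-- An upper bound for the distance of the densities extends from almost every time to
every time. -/
theorem density_dist_le_of_ae {f : Torus N → ℝ} (hf : AEStronglyMeasurable f volume)
    (hfb : ∀ᵐ x, 0 ≤ f x ∧ f x ≤ R) {c : ℝ → ℝ} (hc : ContinuousOn c (Icc 0 T))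
    (hle : ∀ᵐ s ∂(volume.restrict (Ioo 0 T)), ∫ x, (ρ s x - f x) ^ 2 ≤ c s) :
    ∀ t ∈ Icc 0 T, ∫ x, (ρ t x - f x) ^ 2 ≤ c t := by
  intro t ht
  have hgm : AEStronglyMeasurable (fun x => ρ t x - f x) volume := (h.integrable_density ht).1.sub hf
  have hgb : ∀ r ∈ Icc 0 T, ∀ᵐ x, ‖ρ r x - f x‖ ≤ R := fun r hr => by
    filter_upwards [hfb, h.slice_bounds hr] with x h1 h2
    rw [Real.norm_eq_abs, abs_le]
    constructor <;> linarith [h1.1, h1.2, h2.1, h2.2]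
  have hm : ∀ r ∈ Icc 0 T, MemLp (fun x => ρ r x - f x) 2 volume := fun r hr =>
    MemLp.of_bound ((h.integrable_density hr).1.sub hf) R (hgb r hr)
  have hfi : Integrable (fun x => f x * (ρ t x - f x)) :=
    ((hm t ht).integrable (by norm_num)).bdd_mul (c := R) hf
      (hfb.mono fun x hx => by rw [Real.norm_of_nonneg hx.1]; exact hx.2)
  have hlin : ∀ r ∈ Icc 0 T, ∫ x, (ρ r x - f x) * (ρ t x - f x) =
      (∫ x, ρ r x * (ρ t x - f x)) - ∫ x, f x * (ρ t x - f x) := by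
    intro r hr
    simp_rw [sub_mul]
    have i1 : Integrable (fun x => ρ r x * (ρ t x - f x)) :=
      (h.integrable_density hr).mul_bdd hgm (hgb t ht)
    exact integral_sub i1 hfi
  -- With b = ρ(t) - f fixed and a = ρ(r) - f, the lower bound 2∫ab - ∫b² ≤ ∫a² is affine in ρ(r),
  -- hence continuous in r, and is an equality at r = t.
  have := le_on_Icc_of_ae_le h.T_pos
    (f := fun r => 2 * ((∫ x, ρ r x * (ρ t x - f x)) - ∫ x, f x * (ρ t x - f x)) -
      ∫ x, (ρ t x - f x) ^ 2) (g := c)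
    ((continuousOn_const.mul ((h.continuousOn_density hgm (hgb t ht)).sub
      continuousOn_const)).sub continuousOn_const) hc ?_ t ht
  · simp only [← hlin t ht] at this
    simp only [← sq] at this
    linarith
  · filter_upwards [hle, ae_restrict_mem measurableSet_Ioo] with r hr hr'
    have hrI := Ioo_subset_Icc_self hr'
    rw [← hlin r hrI]
    refine le_trans ?_ hr
    have i1 : Integrable (fun x => (ρ r x - f x) * (ρ t x - f x)) :=
      (hm r hrI).integrable_mul (hm t ht)
    have i2 : Integrable (fun x => (ρ t x - f x) ^ 2) := (memLp_two_iff_integrable_sq hgm).1 (hm t ht)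
    rw [← integral_const_mul, ← integral_sub (i1.const_mul 2) i2]
    refine integral_mono ((i1.const_mul 2).sub i2)
      ((memLp_two_iff_integrable_sq (hm r hrI).1).1 (hm r hrI)) fun x => ?_
    show 2 * ((ρ r x - f x) * (ρ t x - f x)) - (ρ t x - f x) ^ 2 ≤ (ρ r x - f x) ^ 2
    nlinarith [sq_nonneg ((ρ r x - f x) - (ρ t x - f x))]

/-- The extension to every time is applied once in each variable, the other one being held fixed. -/
theorem density_lipschitz : ∃ L : ℝ, 0 ≤ L ∧ ∀ s ∈ Icc 0 T, ∀ t ∈ Icc 0 T,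
    ∫ x, (ρ t x - ρ s x) ^ 2 ≤ L * |t - s| := by
  obtain ⟨L, hL0, hL⟩ := h.density_lipschitz_ae
  refine ⟨L, hL0, fun s hs t ht => ?_⟩
  have sw : ∀ a b, ∫ x, (ρ a x - ρ b x) ^ 2 = ∫ x, (ρ b x - ρ a x) ^ 2 := fun a b =>
    integral_congr_ae (ae_of_all _ fun x => by
      show (ρ a x - ρ b x) ^ 2 = (ρ b x - ρ a x) ^ 2
      ring)
  rw [sw, abs_sub_comm]
  refine h.density_dist_le_of_ae (h.integrable_density ht).1 (h.slice_bounds ht)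
    (c := fun r => L * |r - t|) (by fun_prop) ?_ s hs
  filter_upwards [hL, ae_restrict_mem measurableSet_Ioo] with r hr hr'
  have hrI := Ioo_subset_Icc_self hr'
  rw [sw, abs_sub_comm]
  exact h.density_dist_le_of_ae (h.integrable_density hrI).1 (h.slice_bounds hrI)
    (c := fun t => L * |t - r|) (by fun_prop) hr t ht

/-- The map `z^γ` is Lipschitz on [0,R], so strong L² continuity of the density suffices; weak
continuity alone would not control this nonlinear integral. -/
theorem continuousOn_pressure : ContinuousOn (fun t => ∫ x, ρ t x ^ γ) (Icc 0 T) := by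
  obtain ⟨L, hL0, hL⟩ := h.density_lipschitz
  set M := γ * R ^ (γ - 1) with hM
  have hM0 : 0 ≤ M := mul_nonneg (by linarith [h.one_lt]) (Real.rpow_nonneg h.R_nonneg _)
  have hb : ∀ s ∈ Icc 0 T, ∀ t ∈ Icc 0 T, |(∫ x, ρ t x ^ γ) - ∫ x, ρ s x ^ γ| ≤
      M * Real.sqrt (L * |t - s|) := by
    intro s hs t ht
    obtain ⟨hdm, hdb⟩ := h.memLp_density_sub hs ht
    have hd : MemLp (fun x => ρ t x - ρ s x) 2 volume := MemLp.of_bound hdm R hdb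
    rw [← integral_sub (h.integrable_rpow ht) (h.integrable_rpow hs)]
    refine abs_integral_le_integral_abs.trans ?_
    calc ∫ x, |ρ t x ^ γ - ρ s x ^ γ| ≤ ∫ x, M * |ρ t x - ρ s x| := by
          refine integral_mono_ae ((h.integrable_rpow ht).sub (h.integrable_rpow hs)).abs
            ((hd.integrable (by norm_num)).abs.const_mul M) ?_
          filter_upwards [h.slice_bounds hs, h.slice_bounds ht] with x h1 h2
          exact abs_rpow_sub_le h.one_lt h1.1 h2.1 h1.2 h2.2
      _ = M * ∫ x, |ρ t x - ρ s x| := integral_const_mul _ _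
      _ ≤ M * Real.sqrt (L * |t - s|) := by
          gcongr
          refine Real.le_sqrt_of_sq_le ?_
          exact (sq_integral_abs_le hd).trans (hL s hs t ht)
  intro s hs
  rw [ContinuousWithinAt, tendsto_iff_dist_tendsto_zero]
  have hz : Tendsto (fun t => M * Real.sqrt (L * |t - s|)) (𝓝[Icc 0 T] s) (𝓝 0) := by
    have : Continuous fun t => M * Real.sqrt (L * |t - s|) := by fun_prop
    simpa using (this.tendsto s).mono_left nhdsWithin_le_nhds
  refine tendsto_of_tendsto_of_tendsto_of_le_of_le' tendsto_const_nhds hz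
    (Eventually.of_forall fun _ => dist_nonneg) ?_
  filter_upwards [self_mem_nhdsWithin] with t ht
  rw [Real.dist_eq]
  exact hb s hs t ht

theorem integrable_work :
    Integrable (fun z : ℝ × Torus N => ρ z.1 z.2 ^ γ * tr (Du z.1 z.2)) (cyl N T) :=
  (h.memLp_rpow 2).integrable_mul h.memLp_grad_tr

/-- The balance of the internal energy, from the renormalized continuity equation. -/
theorem pressure_eq {t : ℝ} (ht : t ∈ Icc 0 T) :
    (∫ x, ρ t x ^ γ) / (γ - 1) = (∫ x, ρ 0 x ^ γ) / (γ - 1) -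
      ∫ s in Ioo 0 t, ∫ x, ρ s x ^ γ * tr (Du s x) := by
  have hγ : 0 < γ - 1 := by linarith [h.one_lt]
  obtain ⟨b, hb, hbM, hbe⟩ := exists_renormalization h.one_lt R
  have key := sub_eq_integral_of_weak_deriv h.T_pos h.continuousOn_pressure
    (f := fun s => -(γ - 1) * ∫ x, ρ s x ^ γ * tr (Du s x))
    (h.integrable_work.integral_prod_left.const_mul _) ?_ 0 t le_rfl ht.1 ht.2
  · rw [integral_const_mul] at key
    field_simp
    linarith
  · intro χ hχ
    -- The test function is constant in space, so the transport term vanishes, and b'(ρ)ρ - b(ρ) =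
    -- (γ-1)ρ^γ.
    refine Eq.trans (integral_congr_ae ?_) (h.sol.renormalized b hb hbM _
      (hχ.isTest_mul (isSmooth_const (1 : ℝ))))
    filter_upwards [h.ae_bound, ae_restrict_mem measurableSet_Ioo,
      h.integrable_work.prod_right_ae] with s hs hs' hw
    have hsI := Ioo_subset_Icc_self hs'
    have e : ∀ᵐ x, ρ s x ^ γ * deriv χ s + -(γ - 1) * (ρ s x ^ γ * tr (Du s x)) * χ s =
        b (ρ s x) * deriv (fun s => χ s * 1) s
          + ∑ j, b (ρ s x) * u s x j * pderiv j (fun _ : Torus N => χ s * 1) x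
          - (deriv b (ρ s x) * ρ s x - b (ρ s x)) * tr (Du s x) * (χ s * 1) := by
      filter_upwards [hs] with x hx
      obtain ⟨h1, h2⟩ := hbe _ hx.1 hx.2
      rw [h2, h1]
      simp [pderiv]
      ring
    rw [← integral_congr_ae e, integral_add ((h.integrable_rpow hsI).mul_const _)
      ((hw.const_mul _).mul_const _), integral_mul_const, integral_mul_const, integral_const_mul]

end Density

end RegularSolution

end

/-! ### Testing the equations with a smooth field that does not depend on time. -/

section

variable {N : ℕ}

theorem cyl_mono {N : ℕ} {s t T : ℝ} (hs : 0 ≤ s) (ht : t ≤ T) :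
    (volume.restrict (Ioo s t)).prod (volume : Measure (Torus N)) ≤ cyl N T :=
  Measure.prod_mono (Measure.restrict_mono (Ioo_subset_Ioo hs ht) le_rfl) le_rfl

theorem tendsto_eLpNorm_comp_snd {α : Type*} [MeasurableSpace α] {ν : Measure α}
    [IsFiniteMeasure ν] {g : Torus N → ℝ} {F : ℕ → Torus N → ℝ}
    (hg : MemLp g 2 volume) (hF : ∀ n, MemLp (F n) 2 volume)
    (h : Tendsto (fun n => eLpNorm (F n - g) 2 volume) atTop (𝓝 0)) :
    Tendsto (fun n => eLpNorm ((fun z : α × Torus N => F n z.2) - fun z => g z.2) 2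
      (ν.prod volume)) atTop (𝓝 0) := by
  have e : ∀ n, eLpNorm ((fun z : α × Torus N => F n z.2) - fun z => g z.2) 2 (ν.prod volume) =
      ν univ ^ (1 / (2 : ℝ≥0∞)).toReal * eLpNorm (F n - g) 2 volume := by
    intro n
    have hm : Measure.map Prod.snd (ν.prod (volume : Measure (Torus N))) =
        ν univ • (volume : Measure (Torus N)) := Measure.map_snd_prod
    have h1 := eLpNorm_map_measure (p := 2) (μ := ν.prod (volume : Measure (Torus N)))
      (f := Prod.snd) (g := F n - g) (by
        rw [hm]; exact ((hF n).1.sub hg.1).smul_measure _) measurable_snd.aemeasurable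
    rw [hm, eLpNorm_smul_measure_of_ne_top (by simp)] at h1
    rw [← smul_eq_mul, h1]
    rfl
  simp_rw [e]
  have := ENNReal.Tendsto.const_mul (a := ν univ ^ (1 / (2 : ℝ≥0∞)).toReal) h
    (Or.inr (ENNReal.rpow_ne_top_of_nonneg (by positivity) (measure_ne_top _ _)))
  simpa using this

namespace RegularSolution

variable {T γ μ lam R p q : ℝ} {ρ₀ : Torus N → ℝ} {u₀ : Torus N → Vec N}
  {ρ : ℝ → Torus N → ℝ} {u : ℝ → Torus N → Vec N} {Du : ℝ → Torus N → Mat N}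
  {S : ℝ → Torus N → Vec N}

section Kinetic

variable (h : RegularSolution T γ μ lam R p q ρ₀ u₀ ρ u Du S)
include h

/-- Mixed Hölder with a second factor constant in time, whose time integral contributes a power of
T. It allows the convection term to pass to the limit when the frozen field is approximated in L^q.
-/
theorem eLpNorm_momentum_mul_le (j : Fin N) : ∃ C : ℝ≥0∞, C ≠ ⊤ ∧ ∀ w : Torus N → ℝ,
    AEStronglyMeasurable w volume →
    eLpNorm (fun z : ℝ × Torus N => ρ z.1 z.2 * u z.1 z.2 j * w z.2) 2 (cyl N T) ≤
      C * eLpNorm w (ENNReal.ofReal q) volume := by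
  have hp : 0 < p := by linarith [h.two_lt]
  have hq : 0 < q := by linarith [h.two_lt']
  set M := ∫⁻ s in Ioo 0 T, (∫⁻ x, ‖ρ s x • u s x‖ₑ ^ p) ^ (q / p) with hM
  refine ⟨(M ^ (2 / q) * ENNReal.ofReal T ^ (2 / p)) ^ (1 / 2 : ℝ), ?_, fun w hw => ?_⟩
  · exact ENNReal.rpow_ne_top_of_nonneg (by norm_num) (ENNReal.mul_ne_top
      (ENNReal.rpow_ne_top_of_nonneg (by positivity) h.momentum_mixed)
      (ENNReal.rpow_ne_top_of_nonneg (by positivity) (by simp)))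
  · have hb := lintegral_mul_sq_le_mixed h.two_lt h.two_lt' h.line h.aesm_momentum.enorm
      (hw.comp_snd (μ := volume.restrict (Ioo 0 T))).enorm
    simp only [lintegral_const, Measure.restrict_apply_univ, Real.volume_Ioo, sub_zero] at hb
    rw [eLpNorm_eq_lintegral_rpow_enorm_toReal (by simp) (by simp),
      eLpNorm_eq_lintegral_rpow_enorm_toReal (by simpa using hq) (by simp), ENNReal.toReal_ofNat,
      ENNReal.toReal_ofReal hq.le]
    have e : ∀ I : ℝ≥0∞, (M ^ (2 / q) * (I ^ (p / q) * ENNReal.ofReal T) ^ (2 / p)) ^ (1 / 2 : ℝ) =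
        (M ^ (2 / q) * ENNReal.ofReal T ^ (2 / p)) ^ (1 / 2 : ℝ) * I ^ (1 / q) := by
      intro I
      rw [ENNReal.mul_rpow_of_nonneg _ _ (by positivity : 0 ≤ 2 / p), mul_left_comm,
        mul_comm (M ^ (2 / q)), ENNReal.mul_rpow_of_nonneg _ _ (by norm_num : (0 : ℝ) ≤ 1 / 2),
        ← ENNReal.rpow_mul, ← ENNReal.rpow_mul, mul_comm]
      congr 2
      field_simp
    rw [← e]
    refine ENNReal.rpow_le_rpow (le_trans (lintegral_mono fun z => ?_) hb) (by norm_num)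
    rw [enorm_mul]
    gcongr
    rw [enorm_le_iff_norm_le]
    simpa using PiLp.norm_apply_le (ρ z.1 z.2 • u z.1 z.2) j

theorem smooth_test_le_kinetic {t : ℝ} (ht : t ∈ Icc 0 T) {v : Fin N → Torus N → ℝ}
    (hv : ∀ i, IsSmooth (v i)) :
    ∑ i, ((∫ x, ρ t x * u t x i * v i x) - 1 / 2 * ∫ x, ρ t x * v i x ^ 2) ≤
      ∫ x, 1 / 2 * ρ t x * ‖u t x‖ ^ 2 := by
  choose C hC using fun i => (hv i).exists_bound
  have i1 : ∀ i, Integrable (fun x => ρ t x * u t x i * v i x) := fun i => by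
    have : Integrable (fun x => (ρ t x • u t x) i) :=
      memLp_one_iff_integrable.1 (memLp_coord (memLp_one_iff_integrable.2 (h.integrable_momentum ht)) i)
    simpa using this.mul_bdd (c := C i) (hv i).continuous.aestronglyMeasurable (ae_of_all _ (hC i))
  have i2 : ∀ i, Integrable (fun x => ρ t x * v i x ^ 2) := fun i => by
    obtain ⟨B, hB⟩ := ((hv i).pow 2).exists_bound
    exact (h.integrable_density ht).mul_bdd (c := B) ((hv i).pow 2).continuous.aestronglyMeasurable
      (ae_of_all _ hB)
  set V : Torus N → Vec N := fun x => WithLp.toLp 2 (fun i => v i x) with hV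
  have hVc : Continuous V := by
    have := fun i => (hv i).continuous
    exact (PiLp.continuous_toLp 2 _).comp (continuous_pi this)
  obtain ⟨B, hB⟩ := (isCompact_range hVc.norm).bddAbove
  have := h.test_le_kinetic ht (h.energy_le ht).1 hVc.aestronglyMeasurable
    (ae_of_all _ fun x => hB (mem_range_self x))
  refine le_trans (le_of_eq ?_) this
  have e1 : ∀ x, inner ℝ (ρ t x • u t x) (V x) = ∑ i, ρ t x * u t x i * v i x := fun x => by
    simp [hV, PiLp.inner_apply, mul_comm]
  have e2 : ∀ x, 1 / 2 * ρ t x * ‖V x‖ ^ 2 = ∑ i, 1 / 2 * (ρ t x * v i x ^ 2) := fun x => by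
    simp [hV, EuclideanSpace.norm_sq_eq, Finset.mul_sum, mul_assoc]
  simp_rw [e1, e2]
  rw [integral_finsetSum _ fun i _ => i1 i, integral_finsetSum _ fun i _ => (i2 i).const_mul _,
    ← Finset.sum_sub_distrib]
  simp_rw [integral_const_mul]

/-- The left side is exactly ∫ρu·v - ½ρ|v|² at time t: its increment from s comes from the momentum
equation tested with vᵢ and the continuity equation tested with ½vᵢ², where ½∂ⱼ(vᵢ²) = vᵢ∂ⱼvᵢ. -/
theorem smooth_test_add_le {s t : ℝ} (hs : 0 ≤ s) (hst : s ≤ t) (ht : t ≤ T)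
    {v : Fin N → Torus N → ℝ} (hv : ∀ i, IsSmooth (v i)) :
    ∑ i, ((∫ x, ρ s x * u s x i * v i x) - 1 / 2 * ∫ x, ρ s x * v i x ^ 2) +
      ∑ i, ∑ j, ((∫ z, stress γ μ lam ρ u Du i j z * pderiv j (v i) z.2
          ∂(volume.restrict (Ioo s t)).prod volume) -
        ∫ z, ρ z.1 z.2 * u z.1 z.2 j * v i z.2 * pderiv j (v i) z.2
          ∂(volume.restrict (Ioo s t)).prod volume) ≤
      ∫ x, 1 / 2 * ρ t x * ‖u t x‖ ^ 2 := by
  refine le_trans (le_of_eq ?_) (h.smooth_test_le_kinetic ⟨hs.trans hst, ht⟩ hv)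
  rw [← Finset.sum_add_distrib]
  refine Finset.sum_congr rfl fun i _ => ?_
  have h1 := h.momentum_tested i (hv i) hs hst ht
  have h2 := h.mass_tested ((hv i).pow 2) hs hst ht
  have i1 : ∀ j, Integrable (fun z => stress γ μ lam ρ u Du i j z * pderiv j (v i) z.2)
      ((volume.restrict (Ioo s t)).prod volume) := fun j =>
    (integrable_mul_smooth ((h.memLp_stress i j).integrable (by norm_num))
      ((hv i).pderiv j)).mono_measure (cyl_mono hs ht)
  have i2 : ∀ j, Integrable (fun z : ℝ × Torus N =>
      ρ z.1 z.2 * u z.1 z.2 j * v i z.2 * pderiv j (v i) z.2)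
      ((volume.restrict (Ioo s t)).prod volume) := fun j =>
    (integrable_mul_smooth (integrable_mul_smooth ((h.memLp_momentum_coord j).integrable
      (by norm_num)) (hv i)) ((hv i).pderiv j)).mono_measure (cyl_mono hs ht)
  have e2 : ∀ τ x, ∑ j, ρ τ x * u τ x j * pderiv j (fun x => v i x ^ 2) x =
      2 * ∑ j, ρ τ x * u τ x j * v i x * pderiv j (v i) x := fun τ x => by
    rw [Finset.mul_sum]
    refine Finset.sum_congr rfl fun j _ => ?_
    rw [pderiv_sq (hv i)]
    ring
  simp_rw [e2, integral_const_mul] at h2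
  rw [← integral_prod (fun z => ∑ j, stress γ μ lam ρ u Du i j z * pderiv j (v i) z.2)
    (integrable_finsetSum _ fun j _ => i1 j), integral_finsetSum _ fun j _ => i1 j] at h1
  rw [← integral_prod (fun z : ℝ × Torus N => ∑ j, ρ z.1 z.2 * u z.1 z.2 j * v i z.2 *
      pderiv j (v i) z.2) (integrable_finsetSum _ fun j _ => i2 j),
    integral_finsetSum _ fun j _ => i2 j] at h2
  rw [Finset.sum_sub_distrib]
  linarith

end Kinetic

end RegularSolution

end

/-! ### Freezing the velocity at one time. -/

section

variable {N : ℕ}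

/-- Simultaneous approximation of a Sobolev field by smooth fields. -/
theorem exists_smooth_approx {q : ℝ} (hq : 1 ≤ q) {w : Torus N → Vec N} {Dw : Torus N → Mat N}
    (hw2 : MemLp w 2 volume) (hwq : MemLp w (ENNReal.ofReal q) volume) (hD : MemLp Dw 2 volume)
    (hw : ∀ i j : Fin N, HasWeakPartial j (fun x => w x i) (fun x => Dw x (i, j))) :
    ∃ v : ℕ → Fin N → Torus N → ℝ, (∀ n i, IsSmooth (v n i)) ∧
      (∀ i, Tendsto (fun n => eLpNorm (v n i - fun x => w x i) 2 volume) atTop (𝓝 0)) ∧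
      (∀ i, Tendsto (fun n => eLpNorm (v n i - fun x => w x i) (ENNReal.ofReal q) volume)
        atTop (𝓝 0)) ∧
      ∀ i j, Tendsto (fun n => eLpNorm (pderiv j (v n i) - fun x => Dw x (i, j)) 2 volume)
        atTop (𝓝 0) := by
  refine ⟨fun n i => conv (kernel n) (fun x => w x i), fun n i => isSmooth_conv (isSmooth_kernel n)
    ((memLp_coord hw2 i).integrable (by norm_num)), fun i => tendsto_conv_kernel_two
    (memLp_coord hw2 i), fun i => tendsto_eLpNorm_conv_kernel_sub hq (memLp_coord hwq i),
    fun i j => ?_⟩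
  have hpv : ∀ n, pderiv j (conv (kernel n) fun x => w x i) =
      conv (kernel n) (fun x => Dw x (i, j)) := fun n => pderiv_conv_of_weak (isSmooth_kernel n) (hw i j)
  simp_rw [hpv]
  exact tendsto_conv_kernel_two (memLp_coord hD (i, j))

namespace RegularSolution

variable {T γ μ lam R p q : ℝ} {ρ₀ : Torus N → ℝ} {u₀ : Torus N → Vec N}
  {ρ : ℝ → Torus N → ℝ} {u : ℝ → Torus N → Vec N} {Du : ℝ → Torus N → Mat N}
  {S : ℝ → Torus N → Vec N}

section Slope

variable (h : RegularSolution T γ μ lam R p q ρ₀ u₀ ρ u Du S)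
include h

theorem ae_slice : ∀ᵐ s ∂(volume.restrict (Ioo 0 T)), s ∈ Ioo 0 T ∧ MemLp (u s) 2 volume ∧
    MemLp (u s) (ENNReal.ofReal q) volume ∧ MemLp (Du s) 2 volume ∧
    ∀ i j : Fin N, HasWeakPartial j (fun x => u s x i) (fun x => Du s x (i, j)) := by
  have hp : 0 < p := by linarith [h.two_lt]
  have hq : 0 < q := by linarith [h.two_lt']
  filter_upwards [ae_restrict_mem measurableSet_Ioo,
    h.sol.velocity.ae_memLp (by simp) (by simp) (by simp) (by simp),
    h.mixed.ae_memLp (by simpa using hp) (by simp) (by simpa using hq) (by simp),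
    h.sol.velocity_grad.ae_memLp (by simp) (by simp) (by simp) (by simp), h.sol.weak_grad]
    with s h1 h2 h3 h4 h5
  exact ⟨h1, h2, h3, h4, h5⟩

/-- The kinetic energy at time `t` is bounded below by testing the equations between the
times `s` and `t` with the velocity at time `s`. -/
theorem kinetic_add_le : ∀ᵐ s ∂(volume.restrict (Ioo 0 T)), ∀ t ∈ Icc s T,
    (∫ x, 1 / 2 * ρ s x * ‖u s x‖ ^ 2) +
      ∑ i, ∑ j, ((∫ τ in Ioo s t, ∫ x, stress γ μ lam ρ u Du i j (τ, x) * Du s x (i, j)) -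
        ∫ τ in Ioo s t, ∫ x, ρ τ x * u τ x j * (u s x i * Du s x (i, j))) ≤
      ∫ x, 1 / 2 * ρ t x * ‖u t x‖ ^ 2 := by
  have hq : 1 ≤ q := by linarith [h.two_lt']
  filter_upwards [h.ae_slice] with s ⟨hs, hu2, huq, hD, hw⟩ t ht
  have hsI := Ioo_subset_Icc_self hs
  set P := (volume.restrict (Ioo s t)).prod (volume : Measure (Torus N)) with hP
  have hPT : P ≤ cyl N T := cyl_mono hs.1.le ht.2
  have hui : ∀ i, MemLp (fun x => u s x i) 2 volume := fun i => memLp_coord hu2 i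
  have hDi : ∀ i j, MemLp (fun x => Du s x (i, j)) 2 volume := fun i j => memLp_coord hD (i, j)
  obtain ⟨v, hv, hvt, hvq, hpt⟩ := exists_smooth_approx hq hu2 huq hD hw
  have hpd : ∀ n i j, MemLp (pderiv j (v n i)) 2 volume := fun n i j =>
    memLp_two_of_isSmooth ((hv n i).pderiv j)
  have hρm := (h.integrable_density hsI).1
  have hρb : ∀ᵐ x, ‖ρ s x‖ ≤ R := h.norm_density_le hsI
  have hpz : ∀ n i j, MemLp (fun z : ℝ × Torus N => pderiv j (v n i) z.2) 2 P := fun n i j =>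
    (hpd n i j).comp_snd _
  have hDz : ∀ i j, MemLp (fun z : ℝ × Torus N => Du s z.2 (i, j)) 2 P := fun i j =>
    (hDi i j).comp_snd _
  have hptz : ∀ i j, Tendsto (fun n => eLpNorm ((fun z : ℝ × Torus N => pderiv j (v n i) z.2) -
      fun z => Du s z.2 (i, j)) 2 P) atTop (𝓝 0) := fun i j =>
    tendsto_eLpNorm_comp_snd (ν := volume.restrict (Ioo s t)) (g := fun x => Du s x (i, j))
      (F := fun n => pderiv j (v n i)) (hDi i j) (fun n => hpd n i j) (hpt i j)
  have hmom : ∀ i j, (∀ n, MemLp (fun z : ℝ × Torus N => ρ z.1 z.2 * u z.1 z.2 j * v n i z.2) 2 P) ∧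
      MemLp (fun z : ℝ × Torus N => ρ z.1 z.2 * u z.1 z.2 j * u s z.2 i) 2 P ∧
      Tendsto (fun n => eLpNorm ((fun z : ℝ × Torus N => ρ z.1 z.2 * u z.1 z.2 j * v n i z.2) -
        fun z => ρ z.1 z.2 * u z.1 z.2 j * u s z.2 i) 2 P) atTop (𝓝 0) := by
    intro i j
    obtain ⟨C, hC, hb⟩ := h.eLpNorm_momentum_mul_le j
    have hmem : ∀ w : Torus N → ℝ, MemLp w (ENNReal.ofReal q) volume →
        MemLp (fun z : ℝ × Torus N => ρ z.1 z.2 * u z.1 z.2 j * w z.2) 2 P := fun w hw =>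
      MemLp.mono_measure hPT ⟨(h.memLp_momentum_coord j).1.mul hw.1.comp_snd,
        (hb w hw.1).trans_lt (ENNReal.mul_lt_top hC.lt_top hw.2)⟩
    have hvm : ∀ n, MemLp (v n i) (ENNReal.ofReal q) volume := fun n => by
      obtain ⟨B, hB⟩ := (hv n i).exists_bound
      exact MemLp.of_bound (hv n i).continuous.aestronglyMeasurable B (ae_of_all _ hB)
    refine ⟨fun n => hmem _ (hvm n), hmem _ (memLp_coord huq i), ?_⟩
    have h1 := ENNReal.Tendsto.const_mul (a := C) (hvq i) (Or.inr hC)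
    rw [mul_zero] at h1
    refine tendsto_of_tendsto_of_tendsto_of_le_of_le tendsto_const_nhds h1 (fun _ => zero_le)
      fun n => ?_
    refine le_trans ?_ (hb _ ((hvm n).1.sub (memLp_coord huq i).1))
    refine le_trans (le_of_eq ?_) (eLpNorm_mono_measure _ hPT)
    congr 1
    funext z
    simp only [Pi.sub_apply, mul_sub]
  have hst : ∀ i j, MemLp (stress γ μ lam ρ u Du i j) 2 P := fun i j =>
    (h.memLp_stress i j).mono_measure hPT
  have hlim : Tendsto (fun n =>
      ∑ i, ((∫ x, ρ s x * u s x i * v n i x) - 1 / 2 * ∫ x, ρ s x * v n i x ^ 2) +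
      ∑ i, ∑ j, ((∫ z, stress γ μ lam ρ u Du i j z * pderiv j (v n i) z.2 ∂P) -
        ∫ z, ρ z.1 z.2 * u z.1 z.2 j * v n i z.2 * pderiv j (v n i) z.2 ∂P)) atTop
      (𝓝 (∑ i, ((∫ x, ρ s x * u s x i * u s x i) - 1 / 2 * ∫ x, ρ s x * u s x i * u s x i) +
      ∑ i, ∑ j, ((∫ z, stress γ μ lam ρ u Du i j z * Du s z.2 (i, j) ∂P) -
        ∫ z, ρ z.1 z.2 * u z.1 z.2 j * u s z.2 i * Du s z.2 (i, j) ∂P))) := by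
    refine Tendsto.add (tendsto_finsetSum _ fun i _ => Tendsto.sub ?_ (Tendsto.const_mul _ ?_))
      (tendsto_finsetSum _ fun i _ => tendsto_finsetSum _ fun j _ => Tendsto.sub ?_ ?_)
    · have hm := memLp_bdd_mul (hui i) hρm hρb
      exact tendsto_integral_mul_of_tendsto_L2 hm (hui i) (fun _ => hm)
        (fun n => memLp_two_of_isSmooth (hv n i)) (by simp) (hvt i)
    · have hm := fun n => memLp_two_of_isSmooth (hv n i)
      refine (tendsto_integral_mul_of_tendsto_L2 (memLp_bdd_mul (hui i) hρm hρb) (hui i)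
        (fun n => memLp_bdd_mul (hm n) hρm hρb) hm (tendsto_eLpNorm_bdd_mul hρb (hvt i))
        (hvt i)).congr fun n => integral_congr_ae (ae_of_all _ fun x => ?_)
      show ρ s x * v n i x * v n i x = ρ s x * v n i x ^ 2
      ring
    · exact tendsto_integral_mul_of_tendsto_L2 (hst i j) (hDz i j) (fun _ => hst i j)
        (fun n => hpz n i j) (by simp) (hptz i j)
    · obtain ⟨h1, h2, h3⟩ := hmom i j
      exact tendsto_integral_mul_of_tendsto_L2 h2 (hDz i j) h1 (fun n => hpz n i j) h3 (hptz i j)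
  -- In the limit v = u(s), so the tested functional at time s becomes ∫ρ|u|² - ½∫ρ|u|² = K(s), with
  -- no loss at the initial time.
  have hle := le_of_tendsto' hlim fun n => h.smooth_test_add_le hs.1.le ht.1 ht.2 (hv n)
  refine le_trans (le_of_eq ?_) hle
  congr 1
  · have hi : ∀ i, Integrable (fun x => ρ s x * u s x i * u s x i) := fun i =>
      (memLp_bdd_mul (hui i) hρm hρb).integrable_mul (hui i)
    have e : ∀ x, 1 / 2 * ρ s x * ‖u s x‖ ^ 2 = ∑ i, 1 / 2 * (ρ s x * u s x i * u s x i) :=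
      fun x => by
        rw [EuclideanSpace.norm_sq_eq, Finset.mul_sum]
        refine Finset.sum_congr rfl fun i _ => ?_
        rw [Real.norm_eq_abs, sq_abs]
        ring
    simp_rw [e]
    rw [integral_finsetSum _ fun i _ => (hi i).const_mul _]
    refine Finset.sum_congr rfl fun i _ => ?_
    rw [integral_const_mul]
    ring
  · refine Finset.sum_congr rfl fun i _ => Finset.sum_congr rfl fun j _ => ?_
    simp_rw [← mul_assoc]
    congr 1
    · exact (integral_prod _ ((hst i j).integrable_mul (hDz i j))).symm
    · exact (integral_prod _ ((hmom i j).2.1.integrable_mul (hDz i j))).symm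

end Slope

end RegularSolution

end

/-! ### Shift bounds for the fluxes, cut-off in time, and the telescoping inequality. -/

section

section ShiftBounds

variable {X : Type*} [MeasurableSpace X] {μ : Measure X} [SFinite μ]

/-- Cauchy–Schwarz on each set E, with `d` as the square integrable majorant. -/
theorem ShiftBound.of_lintegral_sq_le {f w d : ℝ × X → ℝ} {C : ℝ≥0∞} (hC : C ≠ ⊤)
    (hf : Integrable f (volume.prod μ)) (hw : AEStronglyMeasurable w (volume.prod μ))
    (hd : MemLp d 2 (volume.prod μ))
    (hb : ∀ r : ℝ, ∫⁻ z, (‖f (z.1 + r, z.2)‖ₑ * ‖w z‖ₑ) ^ (2 : ℝ) ∂(volume.prod μ) ≤ C) :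
    ShiftBound f (fun z => w z * d z) μ := by
  refine ⟨hf, hw.mul hd.1, d, hd, C ^ (1 / 2 : ℝ),
    ENNReal.rpow_ne_top_of_nonneg (by norm_num) hC, fun r E hE => ?_⟩
  have hm : AEMeasurable (fun z : ℝ × X => ‖f (z.1 + r, z.2)‖ₑ * ‖w z‖ₑ) (volume.prod μ) :=
    (hf.1.comp_measurePreserving (measurePreserving_timeShift r)).enorm.mul hw.enorm
  have h1 := ENNReal.lintegral_mul_le_Lp_mul_Lq ((volume.prod μ).restrict E)
    (Real.HolderConjugate.two_two) hm.restrict hd.1.enorm.restrict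
  refine le_trans (le_of_eq (lintegral_congr fun z => ?_)) (h1.trans ?_)
  · simp only [Pi.mul_apply, enorm_mul, mul_assoc]
  · gcongr
    exact (setLIntegral_le_lintegral _ _).trans (hb r)

theorem shiftBound_of_memLp_two {f g : ℝ × X → ℝ} (hf : Integrable f (volume.prod μ))
    (hf2 : MemLp f 2 (volume.prod μ)) (hg : MemLp g 2 (volume.prod μ)) : ShiftBound f g μ := by
  have := ShiftBound.of_lintegral_sq_le (w := fun _ => 1) (lintegral_sq_ne_top hf2) hf
    aestronglyMeasurable_const hg (fun r => ?_)
  · simpa using this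
  · simp only [enorm_one, mul_one]
    exact ((measurePreserving_timeShift r).lintegral_comp_emb
      (measurableEmbedding_addRight r |>.prodMap MeasurableEmbedding.id)
      (fun z => ‖f z‖ₑ ^ (2 : ℝ))).le

/-- After the mixed Hölder inequality the shift acts only on an integral over the whole time line,
which is translation invariant. -/
theorem shiftBound_of_mixed {p q : ℝ} (hp : 2 < p) (hq : 2 < q) (hpq : 1 / p + 1 / q = 1 / 2)
    {f w d : ℝ × X → ℝ} (hf : Integrable f (volume.prod μ))
    (hf' : ∫⁻ s, (∫⁻ x, ‖f (s, x)‖ₑ ^ p ∂μ) ^ (q / p) ≠ ⊤)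
    (hw : AEStronglyMeasurable w (volume.prod μ))
    (hw' : ∫⁻ s, (∫⁻ x, ‖w (s, x)‖ₑ ^ q ∂μ) ^ (p / q) ≠ ⊤)
    (hd : MemLp d 2 (volume.prod μ)) : ShiftBound f (fun z => w z * d z) μ := by
  have hp0 : 0 < p := by linarith
  have hq0 : 0 < q := by linarith
  refine ShiftBound.of_lintegral_sq_le (ENNReal.mul_ne_top
    (ENNReal.rpow_ne_top_of_nonneg (by positivity : 0 ≤ 2 / q) hf')
    (ENNReal.rpow_ne_top_of_nonneg (by positivity : 0 ≤ 2 / p) hw')) hf hw hd fun r => ?_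
  have h1 := lintegral_mul_sq_le_mixed hp hq hpq
    (hf.1.comp_measurePreserving (measurePreserving_timeShift r)).enorm hw.enorm
  simp only [Function.comp] at h1
  rwa [lintegral_add_right_eq_self (fun s => (∫⁻ x, ‖f (s, x)‖ₑ ^ p ∂μ) ^ (q / p)) r] at h1

end ShiftBounds

section TimeCut

variable {X : Type*} {T t : ℝ}

/-- The extension by zero of a function on the cylinder over `(0,t)`. -/
def timeCut (t : ℝ) (f : ℝ × X → ℝ) : ℝ × X → ℝ := (Ioo 0 t ×ˢ univ).indicator f

theorem timeCut_of_mem {s : ℝ} (hs : s ∈ Ioo 0 t) (f : ℝ × X → ℝ) (x : X) :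
    timeCut t f (s, x) = f (s, x) := 
  indicator_of_mem (s := Ioo 0 t ×ˢ univ) ⟨hs, mem_univ _⟩ _

theorem timeCut_of_notMem {s : ℝ} (hs : s ∉ Ioo 0 t) (f : ℝ × X → ℝ) (x : X) :
    timeCut t f (s, x) = 0 := indicator_of_notMem (fun h => hs h.1) _

variable [MeasurableSpace X] {μ : Measure X}

theorem lintegral_timeCut_ne_top (ht : t ≤ T) {a b : ℝ} (ha : 0 < a) (hb : 0 < b)
    {f : ℝ × X → ℝ} (hf : ∫⁻ s in Ioo 0 T, (∫⁻ x, ‖f (s, x)‖ₑ ^ a ∂μ) ^ b ≠ ⊤) :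
    ∫⁻ s, (∫⁻ x, ‖timeCut t f (s, x)‖ₑ ^ a ∂μ) ^ b ≠ ⊤ := by
  refine ne_top_of_le_ne_top hf ?_
  rw [← lintegral_indicator measurableSet_Ioo]
  refine lintegral_mono fun s => ?_
  by_cases hs : s ∈ Ioo 0 t
  · rw [indicator_of_mem (Ioo_subset_Ioo_right ht hs)]
    simp_rw [timeCut_of_mem hs]
    exact le_rfl
  · simp [timeCut_of_notMem hs, ha, hb]

/-- The cut-off makes the shifted integrals see only times below t, which gives the end time
min(s+h,t) required by the telescoping inequality. -/
theorem average_timeCut {f g : ℝ × X → ℝ} {s : ℝ} (hs : s ∈ Ioo 0 t) (h : ℝ) :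
    ∫ r in Ioo 0 h, ∫ x, timeCut t f (s + r, x) * timeCut t g (s, x) ∂μ =
      ∫ τ in Ioo s (min (s + h) t), ∫ x, f (τ, x) * g (s, x) ∂μ := by
  rw [← integral_indicator measurableSet_Ioo, ← integral_indicator measurableSet_Ioo,
    ← integral_add_left_eq_self ((Ioo s (min (s + h) t)).indicator _) s]
  refine integral_congr_ae (ae_of_all _ fun r => ?_)
  by_cases hr : r ∈ Ioo 0 h
  · by_cases hr' : s + r ∈ Ioo 0 t
    · have hm : s + r ∈ Ioo s (min (s + h) t) :=
        ⟨by linarith [hr.1], lt_min (by linarith [hr.2]) hr'.2⟩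
      simp only [indicator_of_mem hr, indicator_of_mem hm, timeCut_of_mem hs, timeCut_of_mem hr']
    · have hm : s + r ∉ Ioo s (min (s + h) t) := fun hm =>
        hr' ⟨hs.1.trans hm.1, hm.2.trans_le (min_le_right _ _)⟩
      simp [indicator_of_mem hr, indicator_of_notMem hm, timeCut_of_notMem hr']
  · have hm : s + r ∉ Ioo s (min (s + h) t) := fun hm =>
      hr ⟨by linarith [hm.1], by linarith [hm.2.trans_le (min_le_left _ _)]⟩
    simp [indicator_of_notMem hr, indicator_of_notMem hm]

theorem average_timeCut_of_notMem {f g : ℝ × X → ℝ} {s : ℝ} (hs : s ∉ Ioo 0 t) (h : ℝ) :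
    ∫ r in Ioo 0 h, ∫ x, timeCut t f (s + r, x) * timeCut t g (s, x) ∂μ = 0 := by
  simp [timeCut_of_notMem hs]

variable [SFinite μ]

theorem restrict_cylinder (t : ℝ) : (volume.prod μ).restrict (Ioo (0 : ℝ) t ×ˢ univ) =
    (volume.restrict (Ioo 0 t)).prod μ := by
  rw [← Measure.prod_restrict, Measure.restrict_univ]

theorem memLp_timeCut (ht : t ≤ T) {r : ℝ≥0∞} {f : ℝ × X → ℝ}
    (hf : MemLp f r ((volume.restrict (Ioo 0 T)).prod μ)) :
    MemLp (timeCut t f) r (volume.prod μ) := by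
  rw [timeCut, memLp_indicator_iff_restrict (measurableSet_Ioo.prod MeasurableSet.univ),
    restrict_cylinder]
  exact hf.mono_measure (Measure.prod_mono (Measure.restrict_mono (Ioo_subset_Ioo_right ht) le_rfl)
    le_rfl)

theorem integral_timeCut_mul (t : ℝ) (f g : ℝ × X → ℝ) :
    ∫ z, timeCut t f z * timeCut t g z ∂(volume.prod μ) =
      ∫ z, f z * g z ∂(volume.restrict (Ioo 0 t)).prod μ := by
  rw [← restrict_cylinder, ← integral_indicator (measurableSet_Ioo.prod MeasurableSet.univ)]
  simp_rw [timeCut, ← indicator_mul]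

end TimeCut

/-- Integrated over (0,t), the shifted function contributes ∫ₕᵗ K + hK(t), and ∫ₕᵗ K cancels against
the unshifted integral. -/
theorem integral_le_of_ae_add_le_shift {K Ψ : ℝ → ℝ} {t h : ℝ} (hh : 0 < h) (hht : h < t)
    (hK : IntegrableOn K (Ioo 0 t)) (hΨ : IntegrableOn Ψ (Ioo 0 t))
    (hle : ∀ᵐ s ∂(volume.restrict (Ioo 0 t)), K s + Ψ s ≤ K (min (s + h) t)) :
    ∫ s in Ioo 0 t, Ψ s ≤ h * K t - ∫ s in Ioo 0 h, K s := by
  have hKi : ∀ a b, 0 ≤ a → a ≤ b → b ≤ t → IntervalIntegrable K volume a b := fun a b ha hab hb =>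
    (intervalIntegrable_iff_integrableOn_Ioo_of_le hab).2 (hK.mono_set (Ioo_subset_Ioo ha hb))
  have h1 : IntervalIntegrable (fun s => K (min (s + h) t)) volume 0 (t - h) := by
    have := (hKi h t hh.le hht.le le_rfl).comp_add_right h
    rw [sub_self] at this
    refine this.congr fun s hs => ?_
    rw [uIoc_of_le (by linarith)] at hs
    show K (s + h) = K (min (s + h) t)
    rw [min_eq_left (by linarith [hs.2])]
  have hc : ∀ s ∈ uIoc (t - h) t, K t = K (min (s + h) t) := fun s hs => by
    rw [uIoc_of_le (by linarith)] at hs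
    rw [min_eq_right (by linarith [hs.1])]
  have h2 : IntervalIntegrable (fun s => K (min (s + h) t)) volume (t - h) t :=
    (intervalIntegrable_const (c := K t)).congr hc
  have e1 : ∫ s in (0 : ℝ)..(t - h), K (min (s + h) t) = ∫ s in h..t, K s := by
    have := intervalIntegral.integral_comp_add_right (a := 0) (b := t - h) K h
    rw [zero_add, sub_add_cancel] at this
    rw [← this]
    refine intervalIntegral.integral_congr fun s hs => ?_
    rw [uIcc_of_le (by linarith)] at hs
    show K (min (s + h) t) = K (s + h)
    rw [min_eq_left (by linarith [hs.2])]
  have e2 : ∫ s in (t - h)..t, K (min (s + h) t) = h * K t := by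
    rw [← intervalIntegral.integral_congr_ae (ae_of_all _ hc)]
    simp
  have e3 := intervalIntegral.integral_add_adjacent_intervals h1 h2
  have e4 := intervalIntegral.integral_add_adjacent_intervals (hKi 0 h le_rfl hh.le hht.le)
    (hKi h t hh.le hht.le le_rfl)
  have hI : ∀ (φ : ℝ → ℝ) (b : ℝ), 0 ≤ b → ∫ s in Ioo 0 b, φ s = ∫ s in (0 : ℝ)..b, φ s :=
    fun φ b hb => by rw [intervalIntegral.integral_of_le hb, integral_Ioc_eq_integral_Ioo]
  have hmono := integral_mono_ae (hK.add hΨ)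
    ((intervalIntegrable_iff_integrableOn_Ioo_of_le (hh.trans hht).le).1 (h1.trans h2)) hle
  have hadd : ∫ s in Ioo 0 t, (K + Ψ) s = (∫ s in Ioo 0 t, K s) + ∫ s in Ioo 0 t, Ψ s :=
    integral_add hK hΨ
  rw [hadd, hI _ _ (hh.trans hht).le, hI (fun s => K (min (s + h) t)) _ (hh.trans hht).le] at hmono
  rw [hI K h hh.le]
  linarith

end

/-! ### The kinetic energy balance and the energy equality. -/

section

variable {N : ℕ}

theorem sum_sum_integral_sub {α : Type*} [MeasurableSpace α] {P : Measure α}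
    {f g : Fin N → Fin N → α → ℝ} (hf : ∀ i j, Integrable (f i j) P)
    (hg : ∀ i j, Integrable (g i j) P) :
    ∑ i, ∑ j, ((∫ z, f i j z ∂P) - ∫ z, g i j z ∂P) = ∫ z, ∑ i, ∑ j, (f i j z - g i j z) ∂P := by
  have hi : ∀ i j, Integrable (fun z => f i j z - g i j z) P := fun i j => (hf i j).sub (hg i j)
  rw [integral_finsetSum _ fun i _ => integrable_finsetSum _ fun j _ => hi i j]
  refine Finset.sum_congr rfl fun i _ => ?_
  rw [integral_finsetSum _ fun j _ => hi i j]
  exact Finset.sum_congr rfl fun j _ => (integral_sub (hf i j) (hg i j)).symm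

namespace RegularSolution

variable {T γ μ lam R p q : ℝ} {ρ₀ : Torus N → ℝ} {u₀ : Torus N → Vec N}
  {ρ : ℝ → Torus N → ℝ} {u : ℝ → Torus N → Vec N} {Du : ℝ → Torus N → Mat N}
  {S : ℝ → Torus N → Vec N}

section Balance

variable (h : RegularSolution T γ μ lam R p q ρ₀ u₀ ρ u Du S)
include h

theorem integrable_kinetic :
    Integrable (fun z : ℝ × Torus N => 1 / 2 * ρ z.1 z.2 * ‖u z.1 z.2‖ ^ 2) (cyl N T) := by
  refine ((memLp_two_iff_integrable_sq_norm h.memLp_velocity.1).1 h.memLp_velocity).bdd_mul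
    (c := 1 / 2 * R) (h.aesm_density.const_mul _) ?_
  filter_upwards [h.bound] with z hz
  rw [norm_mul, Real.norm_of_nonneg hz.1]
  norm_num
  exact hz.2

theorem shiftBound_stress {t : ℝ} (ht : t ≤ T) (i j : Fin N) :
    ShiftBound (timeCut t (stress γ μ lam ρ u Du i j))
      (timeCut t fun z => Du z.1 z.2 (i, j)) (volume : Measure (Torus N)) :=
  shiftBound_of_memLp_two
    (memLp_one_iff_integrable.1 (memLp_timeCut ht
      (memLp_one_iff_integrable.2 ((h.memLp_stress i j).integrable (by norm_num)))))
    (memLp_timeCut ht (h.memLp_stress i j)) (memLp_timeCut ht (h.memLp_grad_coord i j))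

theorem shiftBound_convection {t : ℝ} (ht : t ≤ T) (i j : Fin N) :
    ShiftBound (timeCut t fun z => ρ z.1 z.2 * u z.1 z.2 j)
      (timeCut t fun z => u z.1 z.2 i * Du z.1 z.2 (i, j)) (volume : Measure (Torus N)) := by
  have hp : 0 < p := by linarith [h.two_lt]
  have hq : 0 < q := by linarith [h.two_lt']
  have e : (timeCut t fun z : ℝ × Torus N => u z.1 z.2 i * Du z.1 z.2 (i, j)) = fun z =>
      timeCut t (fun z => u z.1 z.2 i) z * timeCut t (fun z => Du z.1 z.2 (i, j)) z :=
    indicator_mul _ _ _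
  rw [e]
  refine shiftBound_of_mixed h.two_lt h.two_lt' h.line
    (memLp_one_iff_integrable.1 (memLp_timeCut ht
      (memLp_one_iff_integrable.2 ((h.memLp_momentum_coord j).integrable (by norm_num)))))
    (lintegral_timeCut_ne_top ht hp (div_pos hq hp) (ne_top_of_le_ne_top h.momentum_mixed ?_))
    (memLp_timeCut ht (memLp_coord h.memLp_velocity i)).1
    (lintegral_timeCut_ne_top ht hq (div_pos hp hq) (ne_top_of_le_ne_top h.velocity_mixed ?_))
    (memLp_timeCut ht (h.memLp_grad_coord i j))
  · gcongr with s x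
    rw [enorm_le_iff_norm_le]
    simpa using PiLp.norm_apply_le (ρ s x • u s x) j
  · gcongr with s x
    rw [enorm_le_iff_norm_le]
    exact PiLp.norm_apply_le _ _

/-- The lower bound for the growth of the kinetic energy. -/
theorem kinetic_zero_add_le {t : ℝ} (ht0 : 0 < t) (ht : t ≤ T) :
    (∫ x, 1 / 2 * ρ 0 x * ‖u 0 x‖ ^ 2) +
      ∑ i, ∑ j, ((∫ z, stress γ μ lam ρ u Du i j z * Du z.1 z.2 (i, j) ∂cyl N t) -
        ∫ z, ρ z.1 z.2 * u z.1 z.2 j * (u z.1 z.2 i * Du z.1 z.2 (i, j)) ∂cyl N t) ≤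
      ∫ x, 1 / 2 * ρ t x * ‖u t x‖ ^ 2 := by
  have h0T : (0 : ℝ) ∈ Icc 0 T := ⟨le_rfl, h.T_pos.le⟩
  set W := ∑ i, ∑ j, ((∫ z, stress γ μ lam ρ u Du i j z * Du z.1 z.2 (i, j) ∂cyl N t) -
        ∫ z, ρ z.1 z.2 * u z.1 z.2 j * (u z.1 z.2 i * Du z.1 z.2 (i, j)) ∂cyl N t) with hW
  set K : ℝ → ℝ := fun t => ∫ x, 1 / 2 * ρ t x * ‖u t x‖ ^ 2 with hK
  let A : Fin N → Fin N → ℝ → ℝ → ℝ := fun i j η s => ∫ r in Ioo 0 η, ∫ x,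
    timeCut t (stress γ μ lam ρ u Du i j) (s + r, x) *
      timeCut t (fun z => Du z.1 z.2 (i, j)) (s, x)
  let B : Fin N → Fin N → ℝ → ℝ → ℝ := fun i j η s => ∫ r in Ioo 0 η, ∫ x,
    timeCut t (fun z => ρ z.1 z.2 * u z.1 z.2 j) (s + r, x) *
      timeCut t (fun z => u z.1 z.2 i * Du z.1 z.2 (i, j)) (s, x)
  have hA : ∀ i j η, Integrable (A i j η) := fun i j η => ((h.shiftBound_stress ht i j).fubini η).1
  have hB : ∀ i j η, Integrable (B i j η) := fun i j η =>
    ((h.shiftBound_convection ht i j).fubini η).1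
  have hlimW : Tendsto (fun η => η⁻¹ * ∑ i, ∑ j, ((∫ s, A i j η s) - ∫ s, B i j η s)) (𝓝[>] 0)
      (𝓝 W) := by
    simp_rw [Finset.mul_sum, mul_sub]
    refine tendsto_finsetSum _ fun i _ => tendsto_finsetSum _ fun j _ => Tendsto.sub ?_ ?_
    · have := (h.shiftBound_stress ht i j).tendsto_average
      rwa [integral_timeCut_mul] at this
    · have := (h.shiftBound_convection ht i j).tendsto_average
      rwa [integral_timeCut_mul] at this
  have hKi : IntegrableOn K (Ioo 0 t) :=
    IntegrableOn.mono_set h.integrable_kinetic.integral_prod_left (Ioo_subset_Ioo_right ht)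
  have hstep : ∀ η ∈ Ioo 0 t, ∑ i, ∑ j, ((∫ s, A i j η s) - ∫ s, B i j η s) ≤
      η * K t - ∫ s in Ioo 0 η, K s := by
    intro η hη
    have hz : ∀ s ∉ Ioo 0 t, ∑ i, ∑ j, (A i j η s - B i j η s) = 0 := fun s hs =>
      Finset.sum_eq_zero fun i _ => Finset.sum_eq_zero fun j _ => by
        simp only [A, B, average_timeCut_of_notMem hs, sub_zero]
    have hi : Integrable (fun s => ∑ i, ∑ j, (A i j η s - B i j η s)) :=
      integrable_finsetSum _ fun i _ => integrable_finsetSum _ fun j _ =>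
        (hA i j η).sub (hB i j η)
    have e : ∑ i, ∑ j, ((∫ s, A i j η s) - ∫ s, B i j η s) =
        ∫ s in Ioo 0 t, ∑ i, ∑ j, (A i j η s - B i j η s) := by
      rw [setIntegral_eq_integral_of_forall_compl_eq_zero hz]
      exact sum_sum_integral_sub (fun i j => hA i j η) (fun i j => hB i j η)
    rw [e]
    refine integral_le_of_ae_add_le_shift hη.1 hη.2 hKi hi.integrableOn ?_
    filter_upwards [ae_restrict_of_ae_restrict_of_subset (Ioo_subset_Ioo_right ht) h.kinetic_add_le,
      ae_restrict_mem measurableSet_Ioo] with s hs hs'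
    have hm := hs (min (s + η) t) ⟨le_min (by linarith [hη.1]) hs'.2.le, (min_le_right _ _).trans ht⟩
    simp only [A, B, average_timeCut hs']
    exact hm
  -- K need not be continuous at 0, so the averages of K over (0,η) are bounded below by those of
  -- each continuous functional `l` ≤ K, and the supremum over the fields v is taken only after the
  -- limit.
  have key := kinetic_le_of_forall_test (B := K t - W) (h.integrable_density h0T)
    ((h.slice_bounds h0T).mono fun x hx => hx.1) (h.integrable_momentum h0T) ?_
  · linarith [key.2]
  · rintro v hv ⟨C, hC⟩
    set l : ℝ → ℝ := fun t => (∫ x, inner ℝ (ρ t x • u t x) (v x)) -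
      (∫ x, 1 / 2 * ρ t x * ‖v x‖ ^ 2) with hl
    have hlc : ContinuousOn l (Icc 0 T) := h.continuousOn_test hv hC
    -- Projecting time onto [0,T] extends `l` continuously to the line, as the averaging lemma uses
    -- a two-sided limit at 0.
    have hproj : Continuous fun r : ℝ => max 0 (min r T) := by fun_prop
    have hlp : Continuous fun r => l (max 0 (min r T)) :=
      hlc.comp_continuous hproj fun r => ⟨le_max_left _ _, max_le h.T_pos.le (min_le_right _ _)⟩
    have hlim := tendsto_average_of_tendsto (hlp.tendsto 0) fun η =>
      (hlp.integrableOn_Icc (a := 0) (b := η)).mono_set Ioo_subset_Icc_self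
    have e0 : max 0 (min 0 T) = 0 := by rw [min_eq_left h.T_pos.le, max_self]
    simp only [e0] at hlim
    have hfin : l 0 + W ≤ K t := by
      refine le_of_tendsto (hlim.add hlimW) ?_
      filter_upwards [Ioo_mem_nhdsGT ht0] with η hη
      have h1 := hstep η hη
      have h2 : ∫ r in Ioo 0 η, l (max 0 (min r T)) ≤ ∫ r in Ioo 0 η, K r := by
        refine setIntegral_mono_on ((hlp.integrableOn_Icc (a := 0) (b := η)).mono_set
          Ioo_subset_Icc_self) (hKi.mono_set (Ioo_subset_Ioo_right hη.2.le)) measurableSet_Ioo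
          fun r hr => ?_
        have hrT : r ∈ Icc 0 T := ⟨hr.1.le, (hr.2.trans hη.2).le.trans ht⟩
        rw [min_eq_left hrT.2, max_eq_right hrT.1]
        exact h.test_le_kinetic hrT (h.energy_le hrT).1 hv hC
      have hη0 := hη.1
      rw [← mul_add, inv_mul_le_iff₀ hη0]
      linarith
    show l 0 ≤ K t - W
    linarith

/-- Pointwise, the convective part ρuᵢuⱼ∂ⱼuᵢ of the stress power cancels the term from the
continuity equation; the pressure work and the viscous terms remain. -/
theorem sum_work_eq {t : ℝ} (ht : t ≤ T) :
    ∑ i, ∑ j, ((∫ z, stress γ μ lam ρ u Du i j z * Du z.1 z.2 (i, j) ∂cyl N t) -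
        ∫ z, ρ z.1 z.2 * u z.1 z.2 j * (u z.1 z.2 i * Du z.1 z.2 (i, j)) ∂cyl N t) =
      (∫ s in Ioo 0 t, ∫ x, ρ s x ^ γ * tr (Du s x)) - dissipation μ lam Du t := by
  have hm : cyl N t ≤ cyl N T := cyl_mono le_rfl ht
  have i1 : ∀ i j, Integrable (fun z => stress γ μ lam ρ u Du i j z * Du z.1 z.2 (i, j))
      (cyl N t) := fun i j =>
    ((h.memLp_stress i j).integrable_mul (h.memLp_grad_coord i j)).mono_measure hm
  have i2 : ∀ i j, Integrable (fun z : ℝ × Torus N =>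
      ρ z.1 z.2 * u z.1 z.2 j * (u z.1 z.2 i * Du z.1 z.2 (i, j))) (cyl N t) := fun i j => by
    refine Integrable.mono_measure (((h.memLp_convection i j).integrable_mul
      (h.memLp_grad_coord i j)).congr (ae_of_all _ fun z => ?_)) hm
    simp only [Pi.mul_apply]
    ring
  have i3 := h.integrable_work.mono_measure hm
  have i4 := h.integrable_grad_sq.mono_measure hm
  have i5 := h.integrable_tr_sq.mono_measure hm
  have e : ∀ z : ℝ × Torus N, ∑ i, ∑ j, (stress γ μ lam ρ u Du i j z * Du z.1 z.2 (i, j) -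
      ρ z.1 z.2 * u z.1 z.2 j * (u z.1 z.2 i * Du z.1 z.2 (i, j))) =
      ρ z.1 z.2 ^ γ * tr (Du z.1 z.2) - (2 * μ * ‖Du z.1 z.2‖ ^ 2 + lam * tr (Du z.1 z.2) ^ 2) := by
    intro z
    have e1 : ∀ i j, stress γ μ lam ρ u Du i j z * Du z.1 z.2 (i, j) -
        ρ z.1 z.2 * u z.1 z.2 j * (u z.1 z.2 i * Du z.1 z.2 (i, j)) =
        (if i = j then (ρ z.1 z.2 ^ γ - lam * tr (Du z.1 z.2)) * Du z.1 z.2 (i, j) else 0) -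
          2 * μ * Du z.1 z.2 (i, j) ^ 2 := fun i j => by
      rw [stress]
      split_ifs <;> ring
    simp_rw [e1, Finset.sum_sub_distrib, Finset.sum_ite_eq, Finset.mem_univ, if_true,
      ← Finset.mul_sum]
    rw [EuclideanSpace.norm_sq_eq, Fintype.sum_prod_type]
    simp only [Real.norm_eq_abs, sq_abs]
    rw [tr]
    ring
  have i6 : Integrable (fun z : ℝ × Torus N => 2 * μ * ‖Du z.1 z.2‖ ^ 2 +
      lam * tr (Du z.1 z.2) ^ 2) (cyl N t) := (i4.const_mul _).add (i5.const_mul _)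
  rw [sum_sum_integral_sub i1 i2]
  simp_rw [e]
  rw [integral_sub i3 i6, integral_add (i4.const_mul _) (i5.const_mul _), integral_const_mul,
    integral_const_mul, integral_prod _ i3, integral_prod _ i4, integral_prod _ i5, dissipation]

/-- Where ρ₀ ≠ 0 the momenta determine the velocity; on vacuum the energy density does not see it.
-/
theorem energy_zero : energy γ (ρ 0) (u 0) = energy γ ρ₀ u₀ := by
  refine integral_congr_ae ?_
  filter_upwards [h.sol.density_init, h.sol.momentum_init] with x h1 h2
  rw [h1] at h2 ⊢
  by_cases h0 : ρ₀ x = 0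
  · simp [h0]
  · rw [(smul_right_injective _ h0) h2]

theorem energy_equality {t : ℝ} (ht : t ∈ Icc 0 T) :
    energy γ (ρ t) (u t) + dissipation μ lam Du t = energy γ ρ₀ u₀ := by
  rcases ht.1.eq_or_lt with h0 | h0
  · rw [← h0, h.energy_zero]
    simp [dissipation]
  · have h0T : (0 : ℝ) ∈ Icc 0 T := ⟨le_rfl, h.T_pos.le⟩
    refine le_antisymm (h.energy_le ht).2 ?_
    -- The pressure work gained by the kinetic energy is exactly what the internal energy loses, so
    -- it drops out of the sum.
    have h1 := h.kinetic_zero_add_le h0 ht.2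
    rw [h.sum_work_eq ht.2] at h1
    rw [← h.energy_zero, h.energy_eq ht (h.energy_le ht).1, h.energy_eq h0T (h.energy_le h0T).1,
      h.pressure_eq ht]
    linarith

end Balance

end RegularSolution

/-- The Shinbrot-type condition embeds into one of two pairs of exponents with
`1/p + 1/q = 1/2`. -/
theorem exists_exponents {p q : ℝ≥0∞} (hpq : 1 / p + 1 / q ≤ 5 / 12) (hq : 6 ≤ q) :
    ∃ p' q' : ℝ, 2 < p' ∧ p' ≤ q' ∧ 1 / p' + 1 / q' = 1 / 2 ∧ ENNReal.ofReal p' ≤ p ∧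
      ENNReal.ofReal q' ≤ q := by
  -- The pairs are (3, 6) and (12/5, 12). If p < 3, then 1/p > 1/3 forces 1/q ≤ 1/12, while 1/p ≤
  -- 5/12 gives p ≥ 12/5.
  by_cases hp : 3 ≤ p
  · exact ⟨3, 6, by norm_num, by norm_num, by norm_num, by simpa using hp, by simpa using hq⟩
  · have h1 : 1 / 3 < 1 / p := by simpa using hp
    have e : (1 / 3 : ℝ≥0∞) + 1 / 12 = 5 / 12 := by
      rw [← ENNReal.toReal_eq_toReal_iff' (by simp)
        (by simp [ENNReal.div_eq_top]),
        ENNReal.toReal_add (by simp) (by simp)]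
      norm_num
    have hp' : 12 / 5 ≤ p := by
      have := ENNReal.inv_le_inv.2 ((self_le_add_right _ _).trans hpq)
      rwa [one_div, inv_inv, ENNReal.inv_div (by simp) (by simp)] at this
    have hq' : 12 ≤ q := by
      by_contra hlt
      have h2 : 1 / 12 < 1 / q := by simpa using hlt
      exact absurd (hpq.trans_lt (e ▸ ENNReal.add_lt_add h1 h2)) (lt_irrefl _)
    refine ⟨12 / 5, 12, by norm_num, by norm_num, by norm_num, ?_, by simpa using hq'⟩
    rwa [ENNReal.ofReal_div_of_pos (by norm_num), ENNReal.ofReal_ofNat, ENNReal.ofReal_ofNat]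

end

end CNS

end

end

theorem theorem2 (N : ℕ) (hN : N = 2 ∨ N = 3) (T γ μ lam : ℝ) (hT : 0 < T) (hγ : 1 < γ)
    (hμ : 0 < μ) (hlam : 0 ≤ 2 * μ + N * lam)
    (ρ₀ : CNS.Torus N → ℝ) (u₀ : CNS.Torus N → CNS.Vec N)
    (ρ : ℝ → CNS.Torus N → ℝ) (u : ℝ → CNS.Torus N → CNS.Vec N)
    (Du : ℝ → CNS.Torus N → CNS.Mat N)
    (hsol : CNS.IsWeakSolution T γ μ lam ρ₀ u₀ ρ u Du)
    (ρhigh : ℝ)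
    (hρ : ∀ᵐ z ∂((volume.restrict (Set.Ioo 0 T)).prod (volume : Measure (CNS.Torus N))),
      0 ≤ ρ z.1 z.2 ∧ ρ z.1 z.2 ≤ ρhigh)
    (hsqrt : ∃ S : ℝ → CNS.Torus N → CNS.Vec N, CNS.MemLpLq T S ⊤ 2 ∧
      ∀ᵐ t ∂(volume.restrict (Set.Ioo 0 T)), ∀ j : Fin N,
        CNS.HasWeakPartial j (fun x => Real.sqrt (ρ t x)) (fun x => S t x j))
    (p q k : ℝ≥0∞) (hpq : 1 / p + 1 / q ≤ 5 / 12) (hq : 6 ≤ q)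
    (hu : CNS.MemLpLq T u p q)
    (hkq : 1 / k + 1 / q ≤ 1 / 2) (hu₀ : MemLp u₀ k volume) :
    ∀ t ∈ Set.Icc 0 T,
      Integrable (fun x => ρ t x * ‖u t x‖ ^ 2) ∧ Integrable (fun x => ρ t x ^ γ) ∧
      CNS.energy γ (ρ t) (u t) + CNS.dissipation μ lam Du t = CNS.energy γ ρ₀ u₀ := by
  obtain ⟨S, hS, hSw⟩ := hsqrt
  obtain ⟨p', q', h2, hle, hline, hp', hq'⟩ := CNS.exists_exponents hpq hq
  -- Time interval and torus have finite measure, so the exponents of u may be lowered onto the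
  -- line.
  have h : CNS.RegularSolution T γ μ lam ρhigh p' q' ρ₀ u₀ ρ u Du S :=
    ⟨hT, hγ, hsol, hρ, hS, hSw, h2, hle, hline,
      hu.mono hp' hq' (by simpa using h2.trans_le hle |>.trans' two_pos) (by simp)⟩
  exact fun t ht => ⟨(h.energy_le ht).1, h.integrable_rpow ht, h.energy_equality ht⟩
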